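/- Let $X$ be an irreducible normal complex affine variety of dimension $3$ with an algebraic action of $SL_2=SL_2(\mathbb C)$. Let $q:X\to Y=\operatorname{Spec}\mathcal O(X)^{SL_2}$ be the categorical quotient, and suppose that $Y\cong\mathbb C$. Fix such an identification, and assume that the scheme-theoretic fiber $q^{-1}(0)$ is reduced and that all scheme-theoretic fibers $q^{-1}(a)$, $a\in\mathbb C\setminus\{0\}$, are isomorphic to each other (as schemes over $\mathbb C$). Then $X$ is $SL_2$-equivariantly isomorphic to one of the following: - $\mathbb F^a_n\times\mathbb C$ for some integer $n\ge 1$, where $\mathbb F^a_n$ is the affine cone over the rational normal curve of degree $n$, i.e. the affine variety whose coordinate ring is the subalgebra of $\mathbb C[u,v]$ generated by the monomials of degree $n$, and $SL_2$ acts on $\mathbb F^a_n$ only, by the action induced by the standard action on $\mathbb C^2$; - $X_k:=\{((x,y,z),\delta)\in\mathbb C^3\times\mathbb C \mid 4xz-y^2=\delta^k\}$ for some integer $k\ge 0$, where $SL_2$ acts on $\mathbb C^3$ via the $3$-dimensional irreducible representation, in coordinates in which $4xz-y^2$ is invariant, and trivially on the coordinate $\delta$; - the quotient $X_k/\mathbb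 Z_2$ for some integer $k\ge 0$, where the generator of $\mathbb Z_2$ acts by $((x,y,z),\delta)\mapsto((-x,-y,-z),\delta)$ and $SL_2$ acts by the action induced from $X_k$. -/

import Mathlib

open Polynomial

noncomputable section

namespace SL2Var

/-- The group `SL₂(ℂ)`. -/
abbrev SL2 : Type := Matrix.SpecialLinearGroup (Fin 2) ℂ

/-! An affine variety is represented by its coordinate ring, a finitely generated `ℂ`-algebra `A`.
A left action of `SL₂` on the variety is represented by the left action `(g • f)(p) = f (g⁻¹ p)` on
functions. -/

/-- An action of `SL₂(ℂ)` by `ℂ`-algebra endomorphisms (hence automorphisms, as `SL₂(ℂ)` is a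
group) of the coordinate ring `A`. Multiplication in `A →ₐ[ℂ] A` is composition. -/
abbrev Action (A : Type*) [CommRing A] [Algebra ℂ A] := SL2 →* (A →ₐ[ℂ] A)

/-- The action is algebraic, i.e. the action map `SL₂ × X → X` is a morphism of varieties: for each
regular function `f` on `X`, the function `(g, p) ↦ (g • f)(p)` belongs to `𝒪(SL₂) ⊗ 𝒪(X)`, that
is, it is a finite sum of products of a polynomial in the entries of `g` and a function on `X`. -/
def IsAlgebraicAction {A : Type*} [CommRing A] [Algebra ℂ A] (ρ : Action A) : Prop :=
  ∀ f : A, ∃ (r : ℕ) (c : Fin r → MvPolynomial (Fin 2 × Fin 2) ℂ) (h : Fin r → A),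
    ∀ g : SL2, ρ g f = ∑ i, MvPolynomial.eval (fun ij => g.1 ij.1 ij.2) (c i) • h i

/-- The ring of invariant functions; the categorical quotient `Y` is its spectrum. -/
def invariants {A : Type*} [CommRing A] [Algebra ℂ A] (ρ : Action A) : Subalgebra ℂ A :=
  ⨅ g : SL2, AlgHom.equalizer (ρ g) (AlgHom.id ℂ A)

/-- Given an identification `Y ≅ ℂ` (as an isomorphism `e` of coordinate rings), the ideal of `A`
generated by the maximal ideal of the point `a ∈ ℂ ≅ Y`. -/
def fiberIdeal {A : Type*} [CommRing A] [Algebra ℂ A] {ρ : Action A}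
    (e : ℂ[X] ≃ₐ[ℂ] invariants ρ) (a : ℂ) : Ideal A :=
  Ideal.span {(e (X - C a) : A)}

/-- The coordinate ring of the scheme-theoretic fiber `q⁻¹(a)` of the categorical quotient
`q : X → Y ≅ ℂ`. -/
abbrev Fiber {A : Type*} [CommRing A] [Algebra ℂ A] {ρ : Action A}
    (e : ℂ[X] ≃ₐ[ℂ] invariants ρ) (a : ℂ) : Type _ :=
  A ⧸ fiberIdeal e a

/-- Two affine `SL₂`-varieties are equivariantly isomorphic. -/
def EquivariantlyIsomorphic {A B : Type*} [CommRing A] [Algebra ℂ A] [CommRing B] [Algebra ℂ B]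
    (ρ : Action A) (σ : Action B) : Prop :=
  ∃ φ : A ≃ₐ[ℂ] B, ∀ (g : SL2) (f : A), φ (ρ g f) = σ g (φ f)

/-! ### Constructions of actions -/

/-- `f ↦ (p ↦ f (M p))`, the pullback of polynomials along the linear map with matrix `M`. -/
def subst {m : ℕ} (M : Matrix (Fin m) (Fin m) ℂ) :
    MvPolynomial (Fin m) ℂ →ₐ[ℂ] MvPolynomial (Fin m) ℂ :=
  MvPolynomial.aeval fun i => ∑ j, MvPolynomial.C (M i j) * MvPolynomial.X j

theorem subst_one {m : ℕ} : subst (1 : Matrix (Fin m) (Fin m) ℂ) = AlgHom.id ℂ _ := by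
  ext1 i
  simp [subst, Matrix.one_apply]

theorem subst_mul {m : ℕ} (M N : Matrix (Fin m) (Fin m) ℂ) :
    subst (M * N) = (subst N).comp (subst M) := by
  ext1 i
  simp only [subst, MvPolynomial.aeval_X, AlgHom.comp_apply, map_sum, map_mul,
    MvPolynomial.algHom_C, MvPolynomial.algebraMap_eq, Matrix.mul_apply, Finset.sum_mul,
    Finset.mul_sum]
  rw [Finset.sum_comm]
  simp only [mul_assoc]

/-- The action on the polynomial ring `𝒪(ℂᵐ)` induced by a linear action on `ℂᵐ`:
`(g • f)(p) = f (τ(g⁻¹) p)`. -/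
def linearAction {m : ℕ} (τ : SL2 →* Matrix (Fin m) (Fin m) ℂ) : Action (MvPolynomial (Fin m) ℂ) where
  toFun g := subst (τ g⁻¹)
  map_one' := by rw [inv_one, map_one, subst_one]; rfl
  map_mul' g h := by rw [mul_inv_rev, map_mul, subst_mul]; rfl

/-- The action on an invariant subalgebra. -/
def subalgebraAction {A : Type*} [CommRing A] [Algebra ℂ A] (ρ : Action A) (S : Subalgebra ℂ A)
    (hS : ∀ g, ∀ f ∈ S, ρ g f ∈ S) : Action S where
  toFun g := ((ρ g).comp S.val).codRestrict S fun f => hS g f f.2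
  map_one' := by ext f; simp
  map_mul' g h := by
    ext f
    exact DFunLike.congr_fun (map_mul ρ g h) f.1

/-- The action on the quotient by an invariant ideal, i.e. on an invariant closed subscheme. -/
def quotientAction {A : Type*} [CommRing A] [Algebra ℂ A] (ρ : Action A) (I : Ideal A)
    (hI : ∀ g, I ≤ I.comap (ρ g)) : Action (A ⧸ I) where
  toFun g := Ideal.quotientMapₐ I (ρ g) (hI g)
  map_one' := by
    apply Ideal.Quotient.algHom_ext
    ext f; simp
  map_mul' g h := by
    apply Ideal.Quotient.algHom_ext
    ext f; simp

/-- If `A = 𝒪(X)`, then `A[X] = 𝒪(X × ℂ)`, and this is the action on `X × ℂ` which is trivial on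
the second factor. -/
def timesLine {A : Type*} [CommRing A] [Algebra ℂ A] (ρ : Action A) : Action A[X] where
  toFun g := Polynomial.mapAlgHom (ρ g)
  map_one' := by rw [map_one]; exact Polynomial.mapAlgHom_id
  map_mul' g h := by
    refine AlgHom.ext fun f => ?_
    simp only [map_mul, AlgHom.mul_apply, Polynomial.coe_mapAlgHom, Polynomial.map_map]
    rfl

/-! ### The cones -/

/-- The standard representation of `SL₂` on `ℂ²`. -/
def standardRep : SL2 →* Matrix (Fin 2) (Fin 2) ℂ where
  toFun g := g.1
  map_one' := rfl
  map_mul' _ _ := rfl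

/-- The (homogeneous) coordinate ring of the affine cone over the rational normal curve of
degree `n`: the subalgebra of `ℂ[u, v]` generated by the monomials `uⁿ⁻ⁱ vⁱ`, `0 ≤ i ≤ n`. -/
def coneRing (n : ℕ) : Subalgebra ℂ (MvPolynomial (Fin 2) ℂ) :=
  Algebra.adjoin ℂ
    {f | ∃ i ≤ n, f = (MvPolynomial.X 0 : MvPolynomial (Fin 2) ℂ) ^ (n - i) * MvPolynomial.X 1 ^ i}

theorem mem_coneRing_of_isHomogeneous {n : ℕ} {f : MvPolynomial (Fin 2) ℂ}
    (hf : f.IsHomogeneous n) : f ∈ coneRing n := by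
  have key : ∀ i ≤ n, (MvPolynomial.X 0 : MvPolynomial (Fin 2) ℂ) ^ (n - i) *
      MvPolynomial.X 1 ^ i ∈ coneRing n := fun i hi => Algebra.subset_adjoin ⟨i, hi, rfl⟩
  rw [f.as_sum]
  refine Subalgebra.sum_mem _ fun d hd => ?_
  have hdeg : d 0 + d 1 = n := by
    have := hf (MvPolynomial.mem_support_iff.mp hd)
    simpa [Finsupp.weight_apply, Finsupp.sum_fintype] using this
  rw [MvPolynomial.monomial_eq, ← MvPolynomial.algebraMap_eq, ← Algebra.smul_def]
  refine Subalgebra.smul_mem _ ?_ _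
  rw [Finsupp.prod_fintype _ _ (by simp), Fin.prod_univ_two]
  have := key (d 1) (by omega)
  rwa [show n - d 1 = d 0 by omega] at this

theorem coneRing_invariant (n : ℕ) (g : SL2) :
    ∀ f ∈ coneRing n, linearAction standardRep g f ∈ coneRing n := by
  have hlin : ∀ i, (linearAction standardRep g (MvPolynomial.X i)).IsHomogeneous 1 := by
    intro i
    simp only [linearAction, subst, MonoidHom.coe_mk, OneHom.coe_mk, MvPolynomial.aeval_X]
    refine MvPolynomial.IsHomogeneous.sum _ _ _ fun j _ => ?_
    simpa using (MvPolynomial.isHomogeneous_C (Fin 2) _).mul (MvPolynomial.isHomogeneous_X ℂ j)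
  have : coneRing n ≤ (coneRing n).comap (linearAction standardRep g) := by
    refine Algebra.adjoin_le ?_
    rintro _ ⟨i, hi, rfl⟩
    refine mem_coneRing_of_isHomogeneous ?_
    change (linearAction standardRep g _).IsHomogeneous n
    rw [map_mul, map_pow, map_pow]
    have := ((hlin 0).pow (n - i)).mul ((hlin 1).pow i)
    rwa [show 1 * (n - i) + 1 * i = n by omega] at this
  exact fun f hf => this hf

/-- `SL₂` acting on the affine cone `𝔽ᵃₙ` over the rational normal curve of degree `n`. -/
def coneAction (n : ℕ) : Action (coneRing n) :=
  subalgebraAction (linearAction standardRep) (coneRing n) (coneRing_invariant n)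

/-! ### The quadric families and their quotients -/

/-- The 3-dimensional irreducible representation of `SL₂`, in coordinates in which `4xz - y²` is
invariant: `(x, y, z)` corresponds to the symmetric matrix `S` with rows `(x, y/2)`, `(y/2, z)`,
and `g` acts by `S ↦ g S gᵀ`. -/
def irreducibleRep3 : SL2 →* Matrix (Fin 3) (Fin 3) ℂ where
  toFun g :=
    !![g.1 0 0 ^ 2, g.1 0 0 * g.1 0 1, g.1 0 1 ^ 2;
      2 * g.1 0 0 * g.1 1 0, g.1 0 0 * g.1 1 1 + g.1 0 1 * g.1 1 0, 2 * g.1 0 1 * g.1 1 1;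
      g.1 1 0 ^ 2, g.1 1 0 * g.1 1 1, g.1 1 1 ^ 2]
  map_one' := by
    ext i j
    fin_cases i <;> fin_cases j <;> simp
  map_mul' g h := by
    ext i j
    fin_cases i <;> fin_cases j <;>
      simp [Matrix.mul_apply, Fin.sum_univ_succ] <;> ring

/-- The quadratic form `4xz - y²` on `ℂ³`. -/
def quadric : MvPolynomial (Fin 3) ℂ :=
  4 * MvPolynomial.X 0 * MvPolynomial.X 2 - MvPolynomial.X 1 ^ 2

theorem linearAction_quadric (g : SL2) : linearAction irreducibleRep3 g quadric = quadric := by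
  have hdet : (g⁻¹).1 0 0 * (g⁻¹).1 1 1 - (g⁻¹).1 0 1 * (g⁻¹).1 1 0 = 1 := by
    rw [← Matrix.det_fin_two]; exact (g⁻¹).2
  simp only [linearAction, MonoidHom.coe_mk, OneHom.coe_mk]
  generalize g⁻¹ = h at hdet
  have hC := congrArg (MvPolynomial.C (σ := Fin 3)) hdet
  simp only [map_sub, map_mul, map_one] at hC
  simp only [quadric, subst, irreducibleRep3, MonoidHom.coe_mk, OneHom.coe_mk, map_sub, map_mul,
    map_pow, map_ofNat, MvPolynomial.aeval_X, Fin.sum_univ_three]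
  simp only [Matrix.of_apply, Matrix.cons_val', Matrix.cons_val, map_add, map_mul, map_pow,
    map_ofNat]
  linear_combination (4 * MvPolynomial.X 0 * MvPolynomial.X 2 - MvPolynomial.X 1 ^ 2) *
    (MvPolynomial.C (h.1 0 0) * MvPolynomial.C (h.1 1 1)
      - MvPolynomial.C (h.1 0 1) * MvPolynomial.C (h.1 1 0) + 1) * hC

/-- The ideal of `X_k = {((x, y, z), δ) ∈ ℂ³ × ℂ | 4xz - y² = δᵏ}` in
`𝒪(ℂ³ × ℂ) = ℂ[x, y, z][δ]`. -/
def familyIdeal (k : ℕ) : Ideal (MvPolynomial (Fin 3) ℂ)[X] :=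
  Ideal.span {C quadric - X ^ k}

/-- The coordinate ring of `X_k`. -/
abbrev FamilyRing (k : ℕ) : Type := (MvPolynomial (Fin 3) ℂ)[X] ⧸ familyIdeal k

theorem familyIdeal_invariant (k : ℕ) (g : SL2) :
    familyIdeal k ≤ (familyIdeal k).comap (timesLine (linearAction irreducibleRep3) g) := by
  refine Ideal.span_le.mpr (Set.singleton_subset_iff.mpr ?_)
  change timesLine (linearAction irreducibleRep3) g _ ∈ familyIdeal k
  have : timesLine (linearAction irreducibleRep3) g (C quadric - X ^ k) = C quadric - X ^ k := by
    simp only [timesLine, MonoidHom.coe_mk, OneHom.coe_mk, Polynomial.coe_mapAlgHom,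
      Polynomial.map_sub, Polynomial.map_pow, Polynomial.map_X, Polynomial.map_C]
    exact congrArg (fun f => C f - X ^ k) (linearAction_quadric g)
  rw [this]
  exact Ideal.subset_span rfl

/-- `SL₂` acting on `X_k`, via the 3-dimensional irreducible representation on `ℂ³`. -/
def familyAction (k : ℕ) : Action (FamilyRing k) :=
  quotientAction (timesLine (linearAction irreducibleRep3)) (familyIdeal k)
    (familyIdeal_invariant k)

/-- The pullback of functions along `((x, y, z), δ) ↦ ((-x, -y, -z), δ)`. -/
def negation : (MvPolynomial (Fin 3) ℂ)[X] →ₐ[ℂ] (MvPolynomial (Fin 3) ℂ)[X] :=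
  Polynomial.mapAlgHom (subst (-1))

theorem familyIdeal_negation (k : ℕ) : familyIdeal k ≤ (familyIdeal k).comap negation := by
  refine Ideal.span_le.mpr (Set.singleton_subset_iff.mpr ?_)
  change negation _ ∈ familyIdeal k
  have hq : subst (-1) quadric = quadric := by
    simp only [quadric, subst, map_sub, map_mul, map_pow, map_ofNat, MvPolynomial.aeval_X,
      Fin.sum_univ_three]
    simp
  have : negation (C quadric - X ^ k) = C quadric - X ^ k := by
    simp only [negation, Polynomial.coe_mapAlgHom,
      Polynomial.map_sub, Polynomial.map_pow, Polynomial.map_X, Polynomial.map_C]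
    exact congrArg (fun f => C f - X ^ k) hq
  rw [this]
  exact Ideal.subset_span rfl

/-- The generator of the action of `ℤ₂` on `X_k` with weights `(1, 1, 1)` on `ℂ³` and trivial on
the base. -/
def involution (k : ℕ) : FamilyRing k →ₐ[ℂ] FamilyRing k :=
  Ideal.quotientMapₐ (familyIdeal k) negation (familyIdeal_negation k)

/-- The coordinate ring of the quotient `X_k / ℤ₂`: the ring of `ℤ₂`-invariant functions. -/
def quotientRing (k : ℕ) : Subalgebra ℂ (FamilyRing k) :=
  AlgHom.equalizer (involution k) (AlgHom.id ℂ (FamilyRing k))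

theorem involution_comm (k : ℕ) (g : SL2) :
    (involution k).comp (familyAction k g) = (familyAction k g).comp (involution k) := by
  have h1 : (subst (-1 : Matrix (Fin 3) (Fin 3) ℂ)).comp (linearAction irreducibleRep3 g) =
      (linearAction irreducibleRep3 g).comp (subst (-1)) := by
    simp only [linearAction, MonoidHom.coe_mk, OneHom.coe_mk, ← subst_mul]
    simp
  have h2 : negation.comp (timesLine (linearAction irreducibleRep3) g) =
      (timesLine (linearAction irreducibleRep3) g).comp negation := by
    refine AlgHom.ext fun f => ?_
    simp only [negation, timesLine, MonoidHom.coe_mk, OneHom.coe_mk, AlgHom.comp_apply,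
      Polynomial.coe_mapAlgHom, Polynomial.map_map]
    exact congrArg (fun φ : _ →ₐ[ℂ] _ => f.map φ.toRingHom) h1
  apply Ideal.Quotient.algHom_ext
  refine AlgHom.ext fun f => ?_
  exact congrArg (Ideal.Quotient.mkₐ ℂ (familyIdeal k)) (DFunLike.congr_fun h2 f)

theorem quotientRing_invariant (k : ℕ) (g : SL2) :
    ∀ f ∈ quotientRing k, familyAction k g f ∈ quotientRing k := by
  intro f hf
  have h := DFunLike.congr_fun (involution_comm k g) f
  have hf' : involution k f = f := hf
  change involution k (familyAction k g f) = familyAction k g f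
  simpa [hf'] using h

/-- `SL₂` acting on `X_k / ℤ₂`. -/
def quotientFamilyAction (k : ℕ) : Action (quotientRing k) :=
  subalgebraAction (familyAction k) (quotientRing k) (quotientRing_invariant k)

end SL2Var

end

/-!
The algebra `A` of functions on `X` is studied through the infinitesimal action of `SL₂`: the raising
and lowering operators `E` and `F` are locally nilpotent derivations, and `A` is spanned by the
elements `F ^ i v` with `v` a highest weight vector. Let `t` be the coordinate of the base, so that
the invariants are `ℂ[t]`.

*Highest weight vectors.* Since `dim X = 3` and `X` is normal, the highest weight vectors of a given
weight form a free `ℂ[t]`-module of rank at most one (`exists_generator`), and the weights that occur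
are the multiples of some `n ≥ 1` (`exists_weight_generator`). Let `f` generate those of weight `n`,
and let `h` generate those of weight `m n`. Then `f ^ m = c(t) h`. For almost all `b` the fiber over
`b` is reduced: its nilpotent functions form a subrepresentation, so nonzero ones would include a highest
weight vector, but these are not nilpotent where `c` has no zeros, because a generator `h` does not
vanish on any fiber (`isReduced_fiber`). By hypothesis all fibers are then reduced, so that `c` has no
zeros, and `A` is generated by `t` and the `F ^ i f` (`exists_presentation`).

*Relations.* Put `x = F f / n`, so that `E x = f`. The element `f (F x) - (n - 1) x ^ 2` is a highest
weight vector of weight `2 n - 4`, a multiple of `n`. So it vanishes, unless it is `α(t)` with `n = 2`,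
or `α(t) f` with `n = 4` (`exists_isSlice`). As `t`, `f`, `x` are algebraically independent and every
element of `A` becomes a polynomial in them after multiplication by a power of `f`, this relation
determines `A` with its action (`Presentation.equivariantlyIsomorphic`).

*The function `α`.* Over a zero of `α` the fiber is a cone, whose vertex is fixed by every vector field
(`hasFixedPoint_fiber`). Over the other points even the vector fields `E` and `F` have no common zero
(`not_hasFixedPoint_fiber`). Isomorphisms of fibers preserve this distinction, so if `α ≠ 0`, it has
no zeros except possibly `0`, and after rescaling `f` it is `t ^ k / 4`.

The three types of varieties in the theorem satisfy the same relations: `𝔽ᵃₙ × ℂ` for `α = 0`, and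
`X_k` and `X_k / ℤ₂` for `α = t ^ k / 4` with `n = 2` and `n = 4` respectively.
-/

open Polynomial

noncomputable section

namespace SL2Var

/-! ### Additive one-parameter groups of automorphisms and locally nilpotent derivations -/

/-- If a polynomial with coefficients in `A` takes values in a complex subspace at infinitely many
complex numbers, then its coefficients lie in that subspace. -/
theorem coeff_mem_of_eval_mem {A : Type*} [CommRing A] [Algebra ℂ A] (N : Submodule ℂ A) (p : A[X])
    {s : Set ℂ} (hs : s.Infinite) (h : ∀ x ∈ s, p.eval (algebraMap ℂ A x) ∈ N) (k : ℕ) :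
    p.coeff k ∈ N := by
  by_contra hk
  obtain ⟨l, hl, hN⟩ := Submodule.exists_le_ker_of_notMem hk
  set q : ℂ[X] := ∑ i ∈ Finset.range (p.natDegree + 1), monomial i (l (p.coeff i)) with hq
  have hcoeff : ∀ i, q.coeff i = l (p.coeff i) := by
    intro i
    simp only [hq, finsetSum_coeff, coeff_monomial, Finset.sum_ite_eq', Finset.mem_range]
    split_ifs with hi
    · rfl
    · rw [coeff_eq_zero_of_natDegree_lt (by omega), map_zero]
  have heval : ∀ x : ℂ, q.eval x = l (p.eval (algebraMap ℂ A x)) := by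
    intro x
    rw [eval_eq_sum_range (p := p), map_sum, hq, eval_finsetSum]
    refine Finset.sum_congr rfl fun i _ => ?_
    rw [eval_monomial, ← map_pow, mul_comm (p.coeff i), ← Algebra.smul_def, map_smul, smul_eq_mul,
      mul_comm]
  have hq0 : q = 0 := by
    refine eq_zero_of_infinite_isRoot q (hs.mono fun x hx => ?_)
    rw [Set.mem_ofPred_eq, IsRoot, heval]
    exact hN (h x hx)
  exact hl (by rw [← hcoeff, hq0, coeff_zero])

theorem eq_zero_of_eval_eq_zero {A : Type*} [CommRing A] [Algebra ℂ A] (p : A[X])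
    {s : Set ℂ} (hs : s.Infinite) (h : ∀ x ∈ s, p.eval (algebraMap ℂ A x) = 0) : p = 0 :=
  Polynomial.ext fun k => by
    simpa using coeff_mem_of_eval_mem (⊥ : Submodule ℂ A) p hs (by simpa using h) k

theorem eq_of_eval_eq {A : Type*} [CommRing A] [Algebra ℂ A] {p q : A[X]}
    (h : ∀ x : ℂ, p.eval (algebraMap ℂ A x) = q.eval (algebraMap ℂ A x)) : p = q :=
  sub_eq_zero.1 (eq_zero_of_eval_eq_zero (p - q) Set.infinite_univ fun x _ => by simp [h x])

section Flow

variable {A : Type*} [CommRing A] [Algebra ℂ A]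

/-- The functions `a` whose translates `θ x a` depend polynomially on the complex parameter `x`. -/
def polynomialLocus (θ : ℂ → A →ₐ[ℂ] A) : Subalgebra ℂ A where
  carrier := {a | ∃ p : A[X], ∀ x, θ x a = p.eval (algebraMap ℂ A x)}
  mul_mem' := by
    rintro a b ⟨p, hp⟩ ⟨q, hq⟩
    exact ⟨p * q, fun x => by rw [map_mul, hp, hq, eval_mul]⟩
  add_mem' := by
    rintro a b ⟨p, hp⟩ ⟨q, hq⟩
    exact ⟨p + q, fun x => by rw [map_add, hp, hq, eval_add]⟩
  algebraMap_mem' c := ⟨C (algebraMap ℂ A c), fun x => by simp⟩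

/-- An algebraic action of the additive group `ℂ` by automorphisms of `A`. -/
structure PolyFlow (θ : ℂ → A →ₐ[ℂ] A) : Prop where
  add : ∀ x y a, θ (x + y) a = θ y (θ x a)
  zero : ∀ a, θ 0 a = a
  poly : ∀ a, ∃ p : A[X], ∀ x, θ x a = p.eval (algebraMap ℂ A x)

namespace PolyFlow

variable {θ : ℂ → A →ₐ[ℂ] A} (h : PolyFlow θ)

/-- The polynomial `p` with `θ x a = p(x)` for all `x`. -/
def orbit (a : A) : A[X] := (h.poly a).choose

theorem eval_orbit (a : A) (x : ℂ) : (h.orbit a).eval (algebraMap ℂ A x) = θ x a :=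
  ((h.poly a).choose_spec x).symm

theorem orbit_eq {a : A} {p : A[X]} (hp : ∀ x, θ x a = p.eval (algebraMap ℂ A x)) :
    h.orbit a = p :=
  eq_of_eval_eq fun x => by rw [eval_orbit, hp]

theorem orbit_coeff_zero (a : A) : (h.orbit a).coeff 0 = a := by
  have := h.eval_orbit a 0
  rwa [map_zero, h.zero, ← coeff_zero_eq_eval_zero] at this

theorem orbit_add (a b : A) : h.orbit (a + b) = h.orbit a + h.orbit b :=
  h.orbit_eq fun x => by rw [map_add, eval_add, eval_orbit, eval_orbit]

theorem orbit_mul (a b : A) : h.orbit (a * b) = h.orbit a * h.orbit b :=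
  h.orbit_eq fun x => by rw [map_mul, eval_mul, eval_orbit, eval_orbit]

theorem orbit_smul (c : ℂ) (a : A) : h.orbit (c • a) = c • h.orbit a :=
  h.orbit_eq fun x => by rw [map_smul, eval_smul, eval_orbit]

/-- The infinitesimal generator: the derivative at `x = 0` of `x ↦ θ x a`. -/
def gen : Derivation ℂ A A :=
  Derivation.mk'
    { toFun := fun a => (h.orbit a).coeff 1
      map_add' := fun a b => by rw [orbit_add, coeff_add]
      map_smul' := fun c a => by rw [orbit_smul, coeff_smul, RingHom.id_apply] }
    (fun a b => by
      simp only [LinearMap.coe_mk, AddHom.coe_mk, smul_eq_mul]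
      rw [orbit_mul, mul_coeff_one, orbit_coeff_zero, orbit_coeff_zero]
      ring)

theorem gen_apply (a : A) : h.gen a = (h.orbit a).coeff 1 := rfl

theorem gen_eq {a : A} {p : A[X]} (hp : ∀ x, θ x a = p.eval (algebraMap ℂ A x)) :
    h.gen a = p.coeff 1 := by rw [gen_apply, h.orbit_eq hp]

/-- The group law `θ (x + y) = θ y ∘ θ x`, read off coefficient by coefficient. -/
theorem orbit_coeff (a : A) (k : ℕ) :
    h.orbit ((h.orbit a).coeff k) = hasseDeriv k (h.orbit a) := by
  refine h.orbit_eq fun y => ?_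
  rw [← taylor_coeff]
  suffices (h.orbit a).map (θ y : A →+* A) = taylor (algebraMap ℂ A y) (h.orbit a) by
    rw [← this, coeff_map]; rfl
  refine eq_of_eval_eq fun x => ?_
  rw [taylor_eval, ← map_add, eval_orbit, h.add, ← eval_orbit h a x]
  have : algebraMap ℂ A x = (θ y : A →+* A) (algebraMap ℂ A x) := by simp
  conv_lhs => rw [this]
  rw [eval_map, eval₂_at_apply]
  rfl

theorem gen_coeff (a : A) (k : ℕ) :
    h.gen ((h.orbit a).coeff k) = ((k + 1 : ℕ) : A) * (h.orbit a).coeff (k + 1) := by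
  rw [gen_apply, orbit_coeff, hasseDeriv_coeff, add_comm 1 k, Nat.choose_succ_self_right]

theorem gen_iterate (a : A) (k : ℕ) :
    h.gen^[k] a = (k.factorial : A) * (h.orbit a).coeff k := by
  induction k with
  | zero => simp [orbit_coeff_zero]
  | succ k ih =>
    rw [Function.iterate_succ_apply', ih, ← nsmul_eq_mul, map_nsmul, gen_coeff, nsmul_eq_mul,
      Nat.factorial_succ]
    push_cast
    ring

theorem coeff_eq (a : A) (k : ℕ) :
    (h.orbit a).coeff k = ((k.factorial : ℂ)⁻¹) • h.gen^[k] a := by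
  rw [gen_iterate, ← nsmul_eq_mul, ← Nat.cast_smul_eq_nsmul ℂ, smul_smul, inv_mul_cancel₀, one_smul]
  exact_mod_cast k.factorial_ne_zero

theorem exists_gen_iterate_eq_zero (a : A) : ∃ N, h.gen^[N] a = 0 :=
  ⟨(h.orbit a).natDegree + 1, by
    rw [gen_iterate, coeff_eq_zero_of_natDegree_lt (Nat.lt_succ_self _), mul_zero]⟩

theorem fixed_of_gen_eq_zero {a : A} (ha : h.gen a = 0) (x : ℂ) : θ x a = a := by
  have : h.orbit a = C a := by
    ext k
    rcases k with _ | k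
    · simp [orbit_coeff_zero]
    · rw [coeff_eq, Function.iterate_succ_apply, ha, iterate_map_zero, coeff_C_succ, smul_zero]
  rw [← eval_orbit h, this, eval_C]

theorem gen_eq_zero_of_fixed {a : A} (ha : ∀ x, θ x a = a) : h.gen a = 0 := by
  rw [h.gen_eq (p := C a) (fun x => by rw [ha, eval_C]), coeff_C_succ]

theorem gen_mem {N : Submodule ℂ A} {a : A} (ha : ∀ x, θ x a ∈ N) : h.gen a ∈ N :=
  coeff_mem_of_eval_mem N (h.orbit a) Set.infinite_univ (fun x _ => by
    rw [h.eval_orbit a x]; exact ha x) 1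

variable {B : Type*} [CommRing B] [Algebra ℂ B] {η : ℂ → B →ₐ[ℂ] B} (h' : PolyFlow η)

theorem map_orbit (φ : A →ₐ[ℂ] B) {a : A} (hφ : ∀ x, φ (θ x a) = η x (φ a)) :
    h'.orbit (φ a) = (h.orbit a).map (φ : A →+* B) := by
  refine h'.orbit_eq fun x => ?_
  rw [← hφ, ← eval_orbit h]
  have : algebraMap ℂ B x = (φ : A →+* B) (algebraMap ℂ A x) := by simp
  rw [this, eval_map, eval₂_at_apply]
  rfl

theorem map_gen (φ : A →ₐ[ℂ] B) (hφ : ∀ x a, φ (θ x a) = η x (φ a)) (a : A) :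
    φ (h.gen a) = h'.gen (φ a) := by
  rw [gen_apply, gen_apply, h.map_orbit h' φ (fun x => hφ x a), coeff_map]
  rfl

theorem map_flow (φ : A →ₐ[ℂ] B) (hφ : ∀ a, φ (h.gen a) = h'.gen (φ a)) (x : ℂ) (a : A) :
    φ (θ x a) = η x (φ a) := by
  have key : h'.orbit (φ a) = (h.orbit a).map (φ : A →+* B) := by
    ext k
    have : ∀ k, φ (h.gen^[k] a) = h'.gen^[k] (φ a) := fun k =>
      Function.Semiconj.iterate_right (f := φ) hφ k a
    rw [coeff_map, coeff_eq, coeff_eq, ← this]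
    exact (map_smul φ _ _).symm
  rw [← h'.eval_orbit, ← h.eval_orbit, key]
  have : algebraMap ℂ B x = (φ : A →+* B) (algebraMap ℂ A x) := by simp
  rw [this, eval_map, eval₂_at_apply]
  rfl

end PolyFlow

end Flow

/-! ### One-parameter subgroups of `SL₂` -/

/-- The unipotent element with upper right entry `x`. -/
def upper (x : ℂ) : SL2 := ⟨!![1, x; 0, 1], by simp⟩

/-- The unipotent element with lower left entry `y`. -/
def lower (y : ℂ) : SL2 := ⟨!![1, 0; y, 1], by simp⟩

/-- The diagonal element with entries `z`, `z⁻¹`. -/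
def torus (z : ℂˣ) : SL2 := ⟨!![(z : ℂ), 0; 0, ((z⁻¹ : ℂˣ) : ℂ)], by simp⟩

@[simp]
theorem upper_coe (x : ℂ) : (upper x).1 = !![1, x; 0, 1] := rfl

@[simp]
theorem lower_coe (y : ℂ) : (lower y).1 = !![1, 0; y, 1] := rfl

@[simp]
theorem torus_coe (z : ℂˣ) : (torus z).1 = !![(z : ℂ), 0; 0, (z : ℂ)⁻¹] := by simp [torus]

theorem upper_add (x y : ℂ) : upper (x + y) = upper y * upper x := by
  ext i j; fin_cases i <;> fin_cases j <;> simp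

theorem lower_add (x y : ℂ) : lower (x + y) = lower y * lower x := by
  ext i j; fin_cases i <;> fin_cases j <;> simp [add_comm]

theorem upper_zero : upper 0 = 1 := by
  ext i j; fin_cases i <;> fin_cases j <;> simp

theorem lower_zero : lower 0 = 1 := by
  ext i j; fin_cases i <;> fin_cases j <;> simp

theorem torus_mul (z w : ℂˣ) : torus (z * w) = torus z * torus w := by
  ext i j; fin_cases i <;> fin_cases j <;> simp [mul_comm]

theorem torus_mul_upper (z : ℂˣ) (x : ℂ) :
    torus z * upper x = upper ((z : ℂ) ^ 2 * x) * torus z := by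
  ext i j; fin_cases i <;> fin_cases j <;> simp [pow_two]
  field_simp

theorem torus_mul_lower (z : ℂˣ) (x : ℂ) :
    torus z * lower x = lower (((z⁻¹ : ℂˣ) : ℂ) ^ 2 * x) * torus z := by
  ext i j; fin_cases i <;> fin_cases j <;> simp [pow_two]
  field_simp

theorem upper_mul_lower (x y : ℂ) (z : ℂˣ) (hz : (z : ℂ) = 1 + x * y) :
    upper x * lower y = lower (y / z) * torus z * upper (x / z) := by
  have h0 : (1 + x * y) ≠ 0 := hz ▸ z.ne_zero
  ext i j; fin_cases i <;> fin_cases j <;> simp [hz]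
  · field_simp
  · rw [div_mul_cancel₀ _ h0]
  · rw [div_mul_cancel₀ _ h0, div_eq_mul_inv]
    linear_combination -(mul_inv_cancel₀ h0)

/-- `SL₂` is generated by its upper and lower unipotent elements. -/
theorem closure_upper_lower (S : Submonoid SL2) (hu : ∀ x, upper x ∈ S) (hl : ∀ y, lower y ∈ S) :
    S = ⊤ := by
  have key : ∀ g : SL2, g.1 1 0 ≠ 0 → g ∈ S := by
    intro g hg
    have hdet : g.1 0 0 * g.1 1 1 - g.1 0 1 * g.1 1 0 = 1 := by
      rw [← Matrix.det_fin_two]; exact g.2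
    have : g = upper ((g.1 0 0 - 1) / g.1 1 0) * lower (g.1 1 0) *
        upper ((g.1 1 1 - 1) / g.1 1 0) := by
      ext i j; fin_cases i <;> fin_cases j <;> simp
      · field_simp
        ring
      · field_simp
        linear_combination -hdet
      · field_simp
        ring
    rw [this]
    exact S.mul_mem (S.mul_mem (hu _) (hl _)) (hu _)
  refine eq_top_iff.2 fun g _ => ?_
  by_cases hg : g.1 1 0 = 0
  · have hdet : g.1 0 0 * g.1 1 1 - g.1 0 1 * g.1 1 0 = 1 := by
      rw [← Matrix.det_fin_two]; exact g.2
    have h00 : g.1 0 0 ≠ 0 := by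
      rintro h0
      rw [h0, hg] at hdet
      simp at hdet
    have h1 : lower (-1) * (lower 1 * g) = g := by
      rw [← mul_assoc, ← lower_add, add_neg_cancel, lower_zero, one_mul]
    rw [← h1]
    refine S.mul_mem (hl _) (key _ ?_)
    simp only [Matrix.SpecialLinearGroup.coe_mul, Matrix.mul_apply, Fin.sum_univ_two, lower_coe]
    simpa [hg] using h00
  · exact key g hg

/-! ### The infinitesimal action of `SL₂` -/

section Flows

variable {A : Type*} [CommRing A] [Algebra ℂ A] {ρ : Action A}

/-- The weight spaces of the diagonal torus. -/
def weightSpace (ρ : Action A) (j : ℤ) : Submodule ℂ A where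
  carrier := {a | ∀ z : ℂˣ, ρ (torus z) a = ((z : ℂ) ^ j) • a}
  add_mem' ha hb z := by rw [map_add, ha z, hb z, smul_add]
  zero_mem' z := by simp
  smul_mem' c a ha z := by rw [map_smul, ha z, smul_comm]

theorem mul_mem_weightSpace {i j : ℤ} {a b : A} (ha : a ∈ weightSpace ρ i)
    (hb : b ∈ weightSpace ρ j) : a * b ∈ weightSpace ρ (i + j) := fun z => by
  rw [map_mul, ha z, hb z, smul_mul_smul_comm, zpow_add₀ z.ne_zero]

theorem pow_mem_weightSpace {i : ℤ} {a : A} (ha : a ∈ weightSpace ρ i) (m : ℕ) :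
    a ^ m ∈ weightSpace ρ (m * i) := fun z => by
  rw [map_pow, ha z, _root_.smul_pow, mul_comm, zpow_mul, zpow_natCast]

theorem mem_invariants {a : A} : a ∈ invariants ρ ↔ ∀ g, ρ g a = a := by
  simp [invariants, Algebra.mem_iInf, AlgHom.mem_equalizer]

theorem invariants_le_weightSpace {a : A} (ha : a ∈ invariants ρ) : a ∈ weightSpace ρ 0 :=
  fun z => by rw [mem_invariants.1 ha, zpow_zero, one_smul]

theorem eval_aeval {σ : Type*} (P : σ → ℂ[X]) (c : MvPolynomial σ ℂ) (x : ℂ) :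
    (MvPolynomial.aeval P c).eval x = MvPolynomial.eval (fun i => (P i).eval x) c := by
  have := MvPolynomial.comp_aeval_apply (B := ℂ) P (Polynomial.aeval x) c
  simpa [Polynomial.coe_aeval_eq_eval, MvPolynomial.aeval_eq_eval] using this

theorem eval_map_mul_C (p : ℂ[X]) (a : A) (x : ℂ) :
    (p.map (algebraMap ℂ A) * C a).eval (algebraMap ℂ A x) = p.eval x • a := by
  rw [eval_mul, eval_C, eval_map, eval₂_at_apply, Algebra.smul_def]

theorem polyFlow_upper (hρ : IsAlgebraicAction ρ) : PolyFlow fun x => ρ (upper x) where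
  add x y a := by rw [upper_add, map_mul]; rfl
  zero a := by rw [upper_zero, map_one]; rfl
  poly a := by
    obtain ⟨r, c, h, hg⟩ := hρ a
    refine ⟨∑ i, (MvPolynomial.aeval (fun ij : Fin 2 × Fin 2 =>
      (!![1, X; 0, 1] : Matrix _ _ ℂ[X]) ij.1 ij.2) (c i)).map (algebraMap ℂ A) * C (h i),
      fun x => ?_⟩
    rw [hg, eval_finsetSum]
    refine Finset.sum_congr rfl fun i _ => ?_
    rw [eval_map_mul_C, eval_aeval]
    congr 3
    ext ⟨k, l⟩
    fin_cases k <;> fin_cases l <;> simp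

theorem polyFlow_lower (hρ : IsAlgebraicAction ρ) : PolyFlow fun x => ρ (lower x) where
  add x y a := by rw [lower_add, map_mul]; rfl
  zero a := by rw [lower_zero, map_one]; rfl
  poly a := by
    obtain ⟨r, c, h, hg⟩ := hρ a
    refine ⟨∑ i, (MvPolynomial.aeval (fun ij : Fin 2 × Fin 2 =>
      (!![1, 0; X, 1] : Matrix _ _ ℂ[X]) ij.1 ij.2) (c i)).map (algebraMap ℂ A) * C (h i),
      fun x => ?_⟩
    rw [hg, eval_finsetSum]
    refine Finset.sum_congr rfl fun i _ => ?_
    rw [eval_map_mul_C, eval_aeval]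
    congr 3
    ext ⟨k, l⟩
    fin_cases k <;> fin_cases l <;> simp

/-- The matrix entries of the torus are Laurent polynomials in the parameter. -/
theorem exists_torus_poly (c : MvPolynomial (Fin 2 × Fin 2) ℂ) : ∃ (N : ℕ) (p : ℂ[X]),
    ∀ z : ℂˣ, (z : ℂ) ^ N * MvPolynomial.eval (fun ij => (torus z).1 ij.1 ij.2) c = p.eval (z : ℂ) := by
  induction c using MvPolynomial.induction_on with
  | C a => exact ⟨0, C a, fun z => by simp⟩
  | add c d hc hd =>
    obtain ⟨N, p, hp⟩ := hc
    obtain ⟨M, q, hq⟩ := hd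
    refine ⟨N + M, X ^ M * p + X ^ N * q, fun z => ?_⟩
    simp only [map_add, eval_add, eval_mul, eval_pow, eval_X, ← hp, ← hq]
    ring
  | mul_X c ij hc =>
    obtain ⟨N, p, hp⟩ := hc
    obtain ⟨k, l⟩ := ij
    fin_cases k <;> fin_cases l
    · exact ⟨N, p * X, fun z => by simp [← hp, mul_assoc]⟩
    · exact ⟨0, 0, fun z => by simp⟩
    · exact ⟨0, 0, fun z => by simp⟩
    · refine ⟨N + 1, p, fun z => ?_⟩
      rw [← hp, map_mul, MvPolynomial.eval_X, pow_succ]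
      have : (torus z).1 1 1 = (z : ℂ)⁻¹ := by simp
      change _ * (_ * (torus z).1 1 1) = _
      rw [this]
      field_simp

theorem exists_torus_orbit (hρ : IsAlgebraicAction ρ) (a : A) : ∃ (N : ℕ) (p : A[X]),
    ∀ z : ℂˣ, (z : ℂ) ^ N • ρ (torus z) a = p.eval (algebraMap ℂ A z) := by
  obtain ⟨r, c, h, hg⟩ := hρ a
  choose N p hp using fun i => exists_torus_poly (c i)
  refine ⟨∑ i, N i, ∑ i, (X ^ (∑ j ∈ Finset.univ.erase i, N j) * p i).map (algebraMap ℂ A) * C (h i),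
    fun z => ?_⟩
  rw [hg, eval_finsetSum, Finset.smul_sum]
  refine Finset.sum_congr rfl fun i _ => ?_
  rw [eval_map_mul_C, eval_mul, ← hp, smul_smul, eval_pow, eval_X, ← mul_assoc, ← pow_add,
    Finset.sum_erase_add _ _ (Finset.mem_univ i)]

theorem infinite_ne_zero : {z : ℂ | z ≠ 0}.Infinite :=
  (Set.finite_singleton (0 : ℂ)).infinite_compl

/-- Complete reducibility of the torus action: a torus-stable subspace is the sum of its weight
components. -/
theorem mem_iSup_weightSpace (hρ : IsAlgebraicAction ρ) (N : Submodule ℂ A)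
    (hN : ∀ z, ∀ a ∈ N, ρ (torus z) a ∈ N) {a : A} (ha : a ∈ N) :
    a ∈ ⨆ j, N ⊓ weightSpace ρ j := by
  obtain ⟨M, p, hp⟩ := exists_torus_orbit hρ a
  have hmem : ∀ k, p.coeff k ∈ N := coeff_mem_of_eval_mem N p infinite_ne_zero fun x hx => by
    rw [← Units.val_mk0 hx, ← hp]
    exact N.smul_mem _ (hN _ _ ha)
  have hwt : ∀ k : ℕ, p.coeff k ∈ weightSpace ρ ((k : ℤ) - M) := by
    intro k w
    have h1 : p.map (ρ (torus w) : A →+* A) * C (algebraMap ℂ A ((w : ℂ) ^ M)) =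
        p.comp (C (algebraMap ℂ A w) * X) := by
      refine sub_eq_zero.1 (eq_zero_of_eval_eq_zero _ infinite_ne_zero fun z hz => ?_)
      rw [eval_sub, sub_eq_zero, eval_mul, eval_C, eval_comp, eval_mul, eval_C, eval_X, ← map_mul]
      have h2 := hp (w * Units.mk0 z hz)
      have h3 := congrArg (ρ (torus w)) (hp (Units.mk0 z hz))
      rw [Units.val_mul, Units.val_mk0] at h2
      rw [Units.val_mk0] at h3
      rw [← h2, torus_mul, map_mul]
      have h4 : eval (algebraMap ℂ A z) (p.map (ρ (torus w) : A →+* A)) =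
          ρ (torus w) (eval (algebraMap ℂ A z) p) := by
        have : algebraMap ℂ A z = (ρ (torus w) : A →+* A) (algebraMap ℂ A z) := by simp
        conv_lhs => rw [this]
        rw [eval_map, eval₂_at_apply]
        rfl
      rw [h4, ← h3, map_smul, mul_comm, ← Algebra.smul_def, smul_smul, mul_pow]
      rfl
    have h5 := congrArg (fun q => q.coeff k) h1
    simp only [coeff_mul_C, coeff_map, comp_C_mul_X_coeff] at h5
    rw [mul_comm, mul_comm (p.coeff k), ← map_pow, ← Algebra.smul_def, ← Algebra.smul_def] at h5
    rw [zpow_sub₀ w.ne_zero, zpow_natCast, zpow_natCast, div_eq_inv_mul, ← smul_smul, ← h5,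
      smul_smul, inv_mul_cancel₀ (pow_ne_zero _ w.ne_zero), one_smul]
    rfl
  have hsum : a = ∑ k ∈ Finset.range (p.natDegree + 1), p.coeff k := by
    have := hp 1
    rw [← mul_one (1 : ℂˣ), torus_mul] at this
    have h1 : torus 1 = 1 := by
      ext i j; fin_cases i <;> fin_cases j <;> simp
    simpa [h1, eval_eq_sum_range] using this
  rw [hsum]
  exact Submodule.sum_mem _ fun k _ => Submodule.mem_iSup_of_mem _ ⟨hmem k, hwt k⟩

section Raising

variable (hρ : IsAlgebraicAction ρ)

/-- The raising operator. -/
abbrev raising : Derivation ℂ A A := (polyFlow_upper hρ).gen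

/-- The lowering operator. -/
abbrev lowering : Derivation ℂ A A := (polyFlow_lower hρ).gen

theorem raising_mem_weightSpace {j : ℤ} {a : A} (ha : a ∈ weightSpace ρ j) :
    raising hρ a ∈ weightSpace ρ (j + 2) := by
  intro z
  set h := polyFlow_upper hρ
  have key : (h.orbit a).map (ρ (torus z) : A →+* A) =
      C (algebraMap ℂ A ((z : ℂ) ^ j)) * (h.orbit a).comp (C (algebraMap ℂ A ((z : ℂ) ^ 2)) * X) := by
    refine eq_of_eval_eq fun x => ?_
    rw [eval_mul, eval_C, eval_comp, eval_mul, eval_C, eval_X, ← map_mul, h.eval_orbit]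
    have : algebraMap ℂ A x = (ρ (torus z) : A →+* A) (algebraMap ℂ A x) := by simp
    conv_lhs => rw [this]
    rw [eval_map, eval₂_at_apply, h.eval_orbit]
    change (ρ (torus z) * ρ (upper x)) a = _
    rw [← map_mul, torus_mul_upper, map_mul, AlgHom.mul_apply, ha z, map_smul, Algebra.smul_def]
  have := congrArg (fun q => q.coeff 1) key
  simp only [coeff_C_mul, coeff_map, comp_C_mul_X_coeff, pow_one] at this
  change ρ (torus z) (h.gen a) = _ • h.gen a
  rw [h.gen_apply, zpow_add₀ z.ne_zero, Algebra.smul_def, map_mul, zpow_ofNat]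
  refine Eq.trans this ?_
  ring

theorem lowering_mem_weightSpace {j : ℤ} {a : A} (ha : a ∈ weightSpace ρ j) :
    lowering hρ a ∈ weightSpace ρ (j - 2) := by
  intro z
  set h := polyFlow_lower hρ
  have key : (h.orbit a).map (ρ (torus z) : A →+* A) =
      C (algebraMap ℂ A ((z : ℂ) ^ j)) *
        (h.orbit a).comp (C (algebraMap ℂ A (((z⁻¹ : ℂˣ) : ℂ) ^ 2)) * X) := by
    refine eq_of_eval_eq fun x => ?_
    rw [eval_mul, eval_C, eval_comp, eval_mul, eval_C, eval_X, ← map_mul, h.eval_orbit]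
    have : algebraMap ℂ A x = (ρ (torus z) : A →+* A) (algebraMap ℂ A x) := by simp
    conv_lhs => rw [this]
    rw [eval_map, eval₂_at_apply, h.eval_orbit]
    change (ρ (torus z) * ρ (lower x)) a = _
    rw [← map_mul, torus_mul_lower, map_mul, AlgHom.mul_apply, ha z, map_smul, Algebra.smul_def]
  have := congrArg (fun q => q.coeff 1) key
  simp only [coeff_C_mul, coeff_map, comp_C_mul_X_coeff, pow_one] at this
  change ρ (torus z) (h.gen a) = _ • h.gen a
  rw [h.gen_apply, sub_eq_add_neg, zpow_add₀ z.ne_zero, Algebra.smul_def, map_mul, zpow_neg,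
    zpow_ofNat, ← inv_pow, ← Units.val_inv_eq_inv_val]
  refine Eq.trans this ?_
  ring

theorem hasDerivAt_eval {σ : Type*} [Fintype σ] (γ : ℂ → σ → ℂ) (γ' : σ → ℂ) (x : ℂ)
    (hγ : ∀ i, HasDerivAt (fun t => γ t i) (γ' i) x) (c : MvPolynomial σ ℂ) :
    HasDerivAt (fun t => MvPolynomial.eval (γ t) c)
      (∑ i, MvPolynomial.eval (γ x) (MvPolynomial.pderiv i c) * γ' i) x := by
  classical
  induction c using MvPolynomial.induction_on with
  | C a => simpa using hasDerivAt_const x a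
  | add c d hc hd =>
    simp only [map_add, add_mul, Finset.sum_add_distrib]
    exact hc.fun_add hd
  | mul_X c i hc =>
    simp only [map_mul, MvPolynomial.eval_X]
    refine (hc.fun_mul (hγ i)).congr_deriv ?_
    simp only [Derivation.leibniz, smul_eq_mul, map_add, add_mul, map_mul, MvPolynomial.eval_X,
      Finset.sum_add_distrib, MvPolynomial.pderiv_X]
    rw [add_comm, Finset.sum_mul]
    congr 1
    · rw [Finset.sum_eq_single i]
      · simp
      · intro b _ hb
        simp [hb.symm]
      · simp
    · exact Finset.sum_congr rfl fun _ _ => by ring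

theorem pderiv_comm {σ : Type*} (i k : σ) (P : MvPolynomial σ ℂ) :
    MvPolynomial.pderiv i (MvPolynomial.pderiv k P) =
      MvPolynomial.pderiv k (MvPolynomial.pderiv i P) := by
  classical
  have : ⁅(MvPolynomial.pderiv i : Derivation ℂ (MvPolynomial σ ℂ) (MvPolynomial σ ℂ)),
      (MvPolynomial.pderiv k : Derivation ℂ (MvPolynomial σ ℂ) (MvPolynomial σ ℂ))⁆ = 0 := by
    refine MvPolynomial.derivation_ext fun m => ?_
    rw [Derivation.commutator_apply]
    simp only [MvPolynomial.pderiv_X, Pi.single_apply, Derivation.coe_zero, Pi.zero_apply]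
    split_ifs <;> simp
  have := DFunLike.congr_fun this P
  rwa [Derivation.commutator_apply, Derivation.coe_zero, Pi.zero_apply, sub_eq_zero] at this

/-- The value of a polynomial in the matrix entries. -/
def evalMatrix (M : Matrix (Fin 2) (Fin 2) ℂ) : MvPolynomial (Fin 2 × Fin 2) ℂ →+* ℂ :=
  MvPolynomial.eval fun ij => M ij.1 ij.2

/-- The chain rule along a curve of matrices. -/
theorem hasDerivAt_evalMatrix (Q : MvPolynomial (Fin 2 × Fin 2) ℂ)
    (M : ℂ → Matrix (Fin 2) (Fin 2) ℂ) (M' : Matrix (Fin 2) (Fin 2) ℂ) (x : ℂ)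
    (hM : ∀ i k, HasDerivAt (fun t => M t i k) (M' i k) x) :
    HasDerivAt (fun t => evalMatrix (M t) Q)
      (evalMatrix (M x) (MvPolynomial.pderiv (0, 0) Q) * M' 0 0 +
        evalMatrix (M x) (MvPolynomial.pderiv (0, 1) Q) * M' 0 1 +
        (evalMatrix (M x) (MvPolynomial.pderiv (1, 0) Q) * M' 1 0 +
          evalMatrix (M x) (MvPolynomial.pderiv (1, 1) Q) * M' 1 1)) x := by
  have h := hasDerivAt_eval (σ := Fin 2 × Fin 2) (fun t ij => M t ij.1 ij.2)
    (fun ij => M' ij.1 ij.2) x (fun ij => hM ij.1 ij.2) Q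
  rw [Fintype.sum_prod_type, Fin.sum_univ_two, Fin.sum_univ_two, Fin.sum_univ_two] at h
  exact h

theorem hasDerivAt_matrix {M : ℂ → Matrix (Fin 2) (Fin 2) ℂ} {M' : Matrix (Fin 2) (Fin 2) ℂ} {x : ℂ}
    (h00 : HasDerivAt (fun t => M t 0 0) (M' 0 0) x) (h01 : HasDerivAt (fun t => M t 0 1) (M' 0 1) x)
    (h10 : HasDerivAt (fun t => M t 1 0) (M' 1 0) x)
    (h11 : HasDerivAt (fun t => M t 1 1) (M' 1 1) x) (i k : Fin 2) :
    HasDerivAt (fun t => M t i k) (M' i k) x := by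
  fin_cases i <;> fin_cases k <;> assumption

theorem PolyFlow.hasDerivAt {θ : ℂ → A →ₐ[ℂ] A} (h : PolyFlow θ) (l : A →ₗ[ℂ] ℂ) (a : A) :
    HasDerivAt (fun x => l (θ x a)) (l (h.gen a)) 0 := by
  have h1 : (fun x => l (θ x a)) = fun x => ∑ k ∈ Finset.range ((h.orbit a).natDegree + 2),
      l ((h.orbit a).coeff k) * x ^ k := by
    funext x
    rw [← h.eval_orbit, eval_eq_sum_range' (n := (h.orbit a).natDegree + 2) (by omega), map_sum]
    refine Finset.sum_congr rfl fun k _ => ?_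
    rw [← map_pow, mul_comm, ← Algebra.smul_def, map_smul, smul_eq_mul, mul_comm]
  rw [h1]
  have h2 : HasDerivAt (fun x : ℂ => ∑ k ∈ Finset.range ((h.orbit a).natDegree + 2),
      l ((h.orbit a).coeff k) * x ^ k) (∑ k ∈ Finset.range ((h.orbit a).natDegree + 2),
      l ((h.orbit a).coeff k) * (k * 0 ^ (k - 1))) 0 :=
    HasDerivAt.fun_sum fun k _ => (hasDerivAt_pow k 0).const_mul _
  convert h2 using 1
  rw [Finset.sum_eq_single 1]
  · simp [h.gen_apply]
  · intro b _ hb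
    rcases b with _ | _ | b
    · simp
    · simp at hb
    · simp
  · simp

section Commutator

variable {l : A →ₗ[ℂ] ℂ} {a : A} {P : MvPolynomial (Fin 2 × Fin 2) ℂ}

theorem linearForm_raising_lower (hl : ∀ g : SL2, l (ρ g a) = evalMatrix g.1 P) (y : ℂ) :
    l (raising hρ (ρ (lower y) a)) =
      y * evalMatrix !![1, 0; y, 1] (MvPolynomial.pderiv (0, 0) P) +
        evalMatrix !![1, 0; y, 1] (MvPolynomial.pderiv (0, 1) P) := by
  have d1 := (polyFlow_upper hρ).hasDerivAt l (ρ (lower y) a)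
  have d2 := hasDerivAt_evalMatrix P (fun x => !![1 + x * y, x; y, 1]) !![y, 1; 0, 0] 0
    (hasDerivAt_matrix
      (by simpa using ((hasDerivAt_id' (0 : ℂ)).mul_const y).const_add 1)
      (by simpa using hasDerivAt_id' (0 : ℂ)) (by simpa using hasDerivAt_const (0 : ℂ) y)
      (by simpa using hasDerivAt_const (0 : ℂ) (1 : ℂ)))
  have h1 : (fun x => l (ρ (upper x) (ρ (lower y) a))) = fun x =>
      evalMatrix !![1 + x * y, x; y, 1] P := by
    funext x
    rw [← AlgHom.mul_apply, ← map_mul, hl]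
    simp
  rw [h1] at d1
  rw [d1.unique d2]
  simp [mul_comm]

theorem linearForm_lowering_upper (hl : ∀ g : SL2, l (ρ g a) = evalMatrix g.1 P) (x : ℂ) :
    l (lowering hρ (ρ (upper x) a)) =
      x * evalMatrix !![1, x; 0, 1] (MvPolynomial.pderiv (1, 1) P) +
        evalMatrix !![1, x; 0, 1] (MvPolynomial.pderiv (1, 0) P) := by
  have d1 := (polyFlow_lower hρ).hasDerivAt l (ρ (upper x) a)
  have d2 := hasDerivAt_evalMatrix P (fun y => !![1, x; y, 1 + x * y]) !![0, 0; 1, x] 0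
    (hasDerivAt_matrix
      (by simpa using hasDerivAt_const (0 : ℂ) (1 : ℂ)) (by simpa using hasDerivAt_const (0 : ℂ) x)
      (by simpa using hasDerivAt_id' (0 : ℂ))
      (by simpa using ((hasDerivAt_id' (0 : ℂ)).const_mul x).const_add 1))
  have h1 : (fun y => l (ρ (lower y) (ρ (upper x) a))) = fun y =>
      evalMatrix !![1, x; y, 1 + x * y] P := by
    funext y
    rw [← AlgHom.mul_apply, ← map_mul, hl]
    simp [mul_comm, add_comm]
  rw [h1] at d1
  rw [d1.unique d2]
  simp [mul_comm, add_comm]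

theorem linearForm_raising_lowering (hl : ∀ g : SL2, l (ρ g a) = evalMatrix g.1 P) :
    l (raising hρ (lowering hρ a)) = evalMatrix 1 (MvPolynomial.pderiv (0, 0) P) +
      evalMatrix 1 (MvPolynomial.pderiv (1, 0) (MvPolynomial.pderiv (0, 1) P)) := by
  have d1 := (polyFlow_lower hρ).hasDerivAt (l ∘ₗ (raising hρ : A →ₗ[ℂ] A)) a
  have hlow : ∀ i k, HasDerivAt (fun y => (!![1, 0; y, 1] : Matrix (Fin 2) (Fin 2) ℂ) i k)
      ((!![0, 0; 1, 0] : Matrix (Fin 2) (Fin 2) ℂ) i k) 0 := hasDerivAt_matrix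
    (by simpa using hasDerivAt_const (0 : ℂ) (1 : ℂ)) (by simpa using hasDerivAt_const (0 : ℂ) (0 : ℂ))
    (by simpa using hasDerivAt_id' (0 : ℂ)) (by simpa using hasDerivAt_const (0 : ℂ) (1 : ℂ))
  have d2 := ((hasDerivAt_id' (0 : ℂ)).fun_mul (hasDerivAt_evalMatrix (MvPolynomial.pderiv (0, 0) P)
    (fun y => !![1, 0; y, 1]) _ 0 hlow)).fun_add
    (hasDerivAt_evalMatrix (MvPolynomial.pderiv (0, 1) P) (fun y => !![1, 0; y, 1]) _ 0 hlow)
  have h1 : (fun y => (l ∘ₗ (raising hρ : A →ₗ[ℂ] A)) (ρ (lower y) a)) = _ :=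
    funext (linearForm_raising_lower hρ hl)
  rw [h1] at d1
  refine (d1.unique d2).trans ?_
  simp [Matrix.one_fin_two]

theorem linearForm_lowering_raising (hl : ∀ g : SL2, l (ρ g a) = evalMatrix g.1 P) :
    l (lowering hρ (raising hρ a)) = evalMatrix 1 (MvPolynomial.pderiv (1, 1) P) +
      evalMatrix 1 (MvPolynomial.pderiv (0, 1) (MvPolynomial.pderiv (1, 0) P)) := by
  have d1 := (polyFlow_upper hρ).hasDerivAt (l ∘ₗ (lowering hρ : A →ₗ[ℂ] A)) a
  have hupp : ∀ i k, HasDerivAt (fun x => (!![1, x; 0, 1] : Matrix (Fin 2) (Fin 2) ℂ) i k)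
      ((!![0, 1; 0, 0] : Matrix (Fin 2) (Fin 2) ℂ) i k) 0 := hasDerivAt_matrix
    (by simpa using hasDerivAt_const (0 : ℂ) (1 : ℂ)) (by simpa using hasDerivAt_id' (0 : ℂ))
    (by simpa using hasDerivAt_const (0 : ℂ) (0 : ℂ)) (by simpa using hasDerivAt_const (0 : ℂ) (1 : ℂ))
  have d2 := ((hasDerivAt_id' (0 : ℂ)).fun_mul (hasDerivAt_evalMatrix (MvPolynomial.pderiv (1, 1) P)
    (fun x => !![1, x; 0, 1]) _ 0 hupp)).fun_add
    (hasDerivAt_evalMatrix (MvPolynomial.pderiv (1, 0) P) (fun x => !![1, x; 0, 1]) _ 0 hupp)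
  have h1 : (fun x => (l ∘ₗ (lowering hρ : A →ₗ[ℂ] A)) (ρ (upper x) a)) = _ :=
    funext (linearForm_lowering_upper hρ hl)
  rw [h1] at d1
  refine (d1.unique d2).trans ?_
  simp [Matrix.one_fin_two]

theorem linearForm_weight (hl : ∀ g : SL2, l (ρ g a) = evalMatrix g.1 P) {j : ℤ}
    (ha : a ∈ weightSpace ρ j) :
    (j : ℂ) * l a = evalMatrix 1 (MvPolynomial.pderiv (0, 0) P) -
      evalMatrix 1 (MvPolynomial.pderiv (1, 1) P) := by
  have d1 : HasDerivAt (fun z : ℂ => z ^ j * l a) (j * (1 : ℂ) ^ (j - 1) * l a) 1 :=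
    (hasDerivAt_zpow j 1 (Or.inl one_ne_zero)).mul_const _
  have d2 := hasDerivAt_evalMatrix P (fun z => !![z, 0; 0, z⁻¹]) !![1, 0; 0, -1] 1
    (hasDerivAt_matrix
      (by simpa using hasDerivAt_id' (1 : ℂ)) (by simpa using hasDerivAt_const (1 : ℂ) (0 : ℂ))
      (by simpa using hasDerivAt_const (1 : ℂ) (0 : ℂ))
      (by simpa using hasDerivAt_inv (one_ne_zero (α := ℂ))))
  have h1 : (fun z : ℂ => z ^ j * l a) =ᶠ[nhds 1] fun z => evalMatrix !![z, 0; 0, z⁻¹] P := by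
    filter_upwards [isOpen_ne.mem_nhds (one_ne_zero (α := ℂ))] with z hz
    have h1 := hl (torus (Units.mk0 z hz))
    rw [ha, map_smul, smul_eq_mul] at h1
    simpa using h1
  have h2 := d1.unique (d2.congr_of_eventuallyEq h1)
  rw [one_zpow, mul_one] at h2
  rw [h2]
  simp [Matrix.one_fin_two]
  ring

end Commutator

/-- The commutation relation `[E, F] = H`, where `H` acts on the weight space of weight `j` as
multiplication by `j`. It is obtained by comparing the mixed second derivatives at the identity of
`l (u(x) v(y) a)` and `l (v(y) u(x) a)` for a linear form `l` on `A`, where `u(x)` and `v(y)` are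
the upper and the lower unipotent elements. -/
theorem raising_lowering {j : ℤ} {a : A} (ha : a ∈ weightSpace ρ j) :
    raising hρ (lowering hρ a) - lowering hρ (raising hρ a) = (j : ℂ) • a := by
  obtain ⟨r, c, h, hg⟩ := hρ a
  rw [← sub_eq_zero, ← Module.forall_dual_apply_eq_zero_iff ℂ]
  intro l
  have hl : ∀ g : SL2, l (ρ g a) = evalMatrix g.1 (∑ i, l (h i) • c i) := by
    intro g
    simp only [hg, map_sum, map_smul, evalMatrix, MvPolynomial.smul_eval, smul_eq_mul]
    exact Finset.sum_congr rfl fun i _ => mul_comm _ _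
  rw [map_sub, map_sub, map_smul, smul_eq_mul, linearForm_raising_lowering hρ hl,
    linearForm_lowering_raising hρ hl, linearForm_weight hl ha, pderiv_comm (1, 0)]
  ring

end Raising

end Flows

/-! ### Locally finite representations of `𝔰𝔩₂` -/

/-- A locally finite representation of `𝔰𝔩₂`: raising and lowering operators that are locally
nilpotent, together with subspaces `W j` of vectors of weight `j`. -/
structure Sl2Module {V : Type*} [AddCommGroup V] [Module ℂ V] (E F : V →ₗ[ℂ] V)
    (W : ℤ → Submodule ℂ V) : Prop where
  raise : ∀ {j a}, a ∈ W j → E a ∈ W (j + 2)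
  lower : ∀ {j a}, a ∈ W j → F a ∈ W (j - 2)
  bracket : ∀ {j a}, a ∈ W j → E (F a) = F (E a) + (j : ℂ) • a
  nilE : ∀ a, ∃ N, E^[N] a = 0
  nilF : ∀ a, ∃ N, F^[N] a = 0

namespace Sl2Module

variable {V : Type*} [AddCommGroup V] [Module ℂ V] {E F : V →ₗ[ℂ] V} {W : ℤ → Submodule ℂ V}
  (h : Sl2Module E F W)
include h

theorem raise_iterate {j : ℤ} {a : V} (ha : a ∈ W j) (k : ℕ) : E^[k] a ∈ W (j + 2 * k) := by
  induction k with
  | zero => simpa using ha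
  | succ k ih =>
    rw [Function.iterate_succ_apply']
    convert h.raise ih using 2
    push_cast
    ring

theorem lower_iterate {j : ℤ} {a : V} (ha : a ∈ W j) (k : ℕ) : F^[k] a ∈ W (j - 2 * k) := by
  induction k with
  | zero => simpa using ha
  | succ k ih =>
    rw [Function.iterate_succ_apply']
    convert h.lower ih using 2
    push_cast
    ring

theorem raise_iterate_lower {j : ℤ} {a : V} (ha : a ∈ W j) (k : ℕ) :
    E^[k + 1] (F a) = F (E^[k + 1] a) + (((k + 1) * (j + k) : ℤ) : ℂ) • E^[k] a := by
  induction k with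
  | zero => simpa using h.bracket ha
  | succ k ih =>
    rw [Function.iterate_succ_apply', ih, map_add, map_smul, h.bracket (h.raise_iterate ha (k + 1)),
      ← Function.iterate_succ_apply' E, ← Function.iterate_succ_apply' E, add_assoc, ← add_smul]
    push_cast
    congr 2
    ring

theorem raise_lower_iterate {j : ℤ} {w : V} (hw : w ∈ W j) (hE : E w = 0) (k : ℕ) :
    E (F^[k + 1] w) = (((k + 1) * (j - k) : ℤ) : ℂ) • F^[k] w := by
  induction k with
  | zero => simpa [hE] using h.bracket hw
  | succ k ih =>
    rw [Function.iterate_succ_apply' F (k + 1), h.bracket (h.lower_iterate hw (k + 1)), ih, map_smul,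
      ← Function.iterate_succ_apply' F, ← add_smul]
    push_cast
    congr 1
    ring

theorem exists_raise_iterate_lower_iterate {j : ℤ} {w : V} (hw : w ∈ W j) (hE : E w = 0) (K : ℕ)
    (hK : K ≤ j) : ∃ c : ℂ, c ≠ 0 ∧ E^[K] (F^[K] w) = c • w := by
  induction K with
  | zero => exact ⟨1, one_ne_zero, by simp⟩
  | succ K ih =>
    obtain ⟨c, hc, he⟩ := ih (by push_cast at hK; omega)
    refine ⟨(((K + 1) * (j - K) : ℤ) : ℂ) * c, mul_ne_zero ?_ hc, ?_⟩
    · push_cast at hK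
      exact_mod_cast mul_ne_zero (by omega) (by omega)
    · rw [Function.iterate_succ_apply, h.raise_lower_iterate hw hE]
      have : E^[K] ((((K + 1) * (j - K) : ℤ) : ℂ) • F^[K] w) =
          (((K + 1) * (j - K) : ℤ) : ℂ) • E^[K] (F^[K] w) := by
        simpa only [Module.End.pow_apply] using map_smul (E ^ K) _ (F^[K] w)
      rw [this, he, smul_smul]

/-- The weight `d` of a primitive vector is a natural number, and `d + 1` applications of the
lowering operator annihilate the vector. -/
theorem weight_of_primitive {j : ℤ} {w : V} (hw : w ∈ W j) (hE : E w = 0) (h0 : w ≠ 0) :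
    ∃ d : ℕ, j = d ∧ F^[d + 1] w = 0 := by
  classical
  have hex := h.nilF w
  obtain ⟨k, hk⟩ : ∃ k, Nat.find hex = k + 1 := Nat.exists_eq_succ_of_ne_zero fun h1 => h0 <| by
    have := Nat.find_spec hex
    rwa [h1] at this
  have h1 : F^[k + 1] w = 0 := hk ▸ Nat.find_spec hex
  have h2 : F^[k] w ≠ 0 := Nat.find_min hex (by omega)
  have h3 := h.raise_lower_iterate hw hE k
  rw [h1, map_zero, eq_comm, smul_eq_zero_iff_left h2, Int.cast_eq_zero, mul_eq_zero] at h3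
  refine ⟨k, ?_, h1⟩
  omega

/-- The powers `E ^ k` are injective on weight spaces of weight at most `-k`. -/
theorem eq_zero_of_raise_iterate_eq_zero {j : ℤ} {a : V} (ha : a ∈ W j) {k : ℕ} (hk : k ≤ -j)
    (hE : E^[k] a = 0) : a = 0 := by
  classical
  obtain ⟨L, hL⟩ := h.nilF a
  induction L generalizing j a k with
  | zero => exact hL
  | succ L ih =>
    have hFa : F a = 0 := by
      refine ih (h.lower ha) (k := k + 1) (by push_cast; omega) ?_ hL
      rw [h.raise_iterate_lower ha, hE, Function.iterate_succ_apply', hE]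
      simp
    by_contra h0
    have hex : ∃ m, E^[m] a = 0 := ⟨k, hE⟩
    obtain ⟨m, hm⟩ : ∃ m, Nat.find hex = m + 1 := Nat.exists_eq_succ_of_ne_zero fun h1 => h0 <| by
      have := Nat.find_spec hex
      rwa [h1] at this
    have h1 : E^[m + 1] a = 0 := hm ▸ Nat.find_spec hex
    have h2 : E^[m] a ≠ 0 := Nat.find_min hex (by omega)
    have h3 : m + 1 ≤ k := hm ▸ Nat.find_min' hex hE
    have h4 := h.raise_iterate_lower ha m
    rw [hFa, h1, map_zero, zero_add, ← Module.End.pow_apply, map_zero, eq_comm,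
      smul_eq_zero_iff_left h2, Int.cast_eq_zero, mul_eq_zero] at h4
    omega

/-- A subrepresentation is spanned by the vectors `F ^ i v` with `v` primitive (a highest weight
vector). -/
theorem mem_span_primitive {N : Submodule ℂ V} (hNE : ∀ a ∈ N, E a ∈ N) (hNF : ∀ a ∈ N, F a ∈ N)
    {j : ℤ} {a : V} (haN : a ∈ N) (ha : a ∈ W j) :
    a ∈ Submodule.span ℂ {b | ∃ (i d : ℕ) (v : V), v ∈ N ∧ v ∈ W d ∧ E v = 0 ∧ b = F^[i] v} := by
  obtain ⟨K, hK⟩ := h.nilE a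
  have hNE' : ∀ k, ∀ a ∈ N, E^[k] a ∈ N := by
    intro k
    induction k with
    | zero => exact fun a ha => ha
    | succ k ih => exact fun a ha => ih _ (hNE a ha)
  have hNF' : ∀ k, ∀ a ∈ N, F^[k] a ∈ N := by
    intro k
    induction k with
    | zero => exact fun a ha => ha
    | succ k ih => exact fun a ha => ih _ (hNF a ha)
  induction K generalizing a with
  | zero => rw [show a = 0 from hK]; exact Submodule.zero_mem _
  | succ K ih =>
    by_cases h0 : a = 0
    · rw [h0]; exact Submodule.zero_mem _
    by_cases hw0 : E^[K] a = 0
    · exact ih haN ha hw0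
    have hEw : E (E^[K] a) = 0 := by rwa [← Function.iterate_succ_apply' E]
    have hwW := h.raise_iterate ha K
    obtain ⟨d, hd, -⟩ := h.weight_of_primitive hwW hEw hw0
    have hKj : -j ≤ K := by
      by_contra hlt
      exact h0 (h.eq_zero_of_raise_iterate_eq_zero ha (k := K + 1) (by push_cast; omega) hK)
    obtain ⟨c, hc, he⟩ := h.exists_raise_iterate_lower_iterate hwW hEw K (by omega)
    have hb : c⁻¹ • F^[K] (E^[K] a) ∈ Submodule.span ℂ
        {b | ∃ (i d : ℕ) (v : V), v ∈ N ∧ v ∈ W d ∧ E v = 0 ∧ b = F^[i] v} :=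
      Submodule.smul_mem _ _ (Submodule.subset_span
        ⟨K, d, E^[K] a, hNE' K a haN, hd ▸ hwW, hEw, rfl⟩)
    rw [← sub_add_cancel a (c⁻¹ • F^[K] (E^[K] a))]
    refine Submodule.add_mem _ (ih ?_ ?_ ?_) hb
    · exact N.sub_mem haN (N.smul_mem _ (hNF' _ _ (hNE' _ _ haN)))
    · refine Submodule.sub_mem _ ha (Submodule.smul_mem _ _ ?_)
      have := h.lower_iterate hwW K
      rwa [add_sub_cancel_right] at this
    · rw [← Module.End.pow_apply, map_sub, map_smul, Module.End.pow_apply, Module.End.pow_apply, he,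
        smul_smul, inv_mul_cancel₀ hc, one_smul, sub_self]

end Sl2Module

section

variable {A : Type*} [CommRing A] [Algebra ℂ A] {ρ : Action A} (hρ : IsAlgebraicAction ρ)
include hρ

theorem sl2Module : Sl2Module (raising hρ : A →ₗ[ℂ] A) (lowering hρ : A →ₗ[ℂ] A)
    (weightSpace ρ) where
  raise := raising_mem_weightSpace hρ
  lower := lowering_mem_weightSpace hρ
  bracket ha := by
    have := raising_lowering hρ ha
    rw [sub_eq_iff_eq_add'] at this
    exact this
  nilE := (polyFlow_upper hρ).exists_gen_iterate_eq_zero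
  nilF := (polyFlow_lower hρ).exists_gen_iterate_eq_zero

/-- The highest weight vectors of weight `d`. -/
def primitive (d : ℕ) : Submodule ℂ A :=
  weightSpace ρ d ⊓ LinearMap.ker (raising hρ : A →ₗ[ℂ] A)

omit hρ in
theorem mem_primitive {hρ : IsAlgebraicAction ρ} {d : ℕ} {a : A} :
    a ∈ primitive hρ d ↔ a ∈ weightSpace ρ d ∧ raising hρ a = 0 := by
  simp [primitive]

theorem upper_primitive {d : ℕ} {a : A} (ha : a ∈ primitive hρ d) (x : ℂ) : ρ (upper x) a = a :=
  (polyFlow_upper hρ).fixed_of_gen_eq_zero (mem_primitive.1 ha).2 x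

/-- An invariant subspace is spanned by the translates `F ^ i v` of its highest weight vectors. -/
theorem mem_span_lowering_primitive (N : Submodule ℂ A) (hN : ∀ g, ∀ a ∈ N, ρ g a ∈ N) {a : A}
    (ha : a ∈ N) : a ∈ Submodule.span ℂ
      {b | ∃ (i d : ℕ) (v : A), v ∈ N ∧ v ∈ primitive hρ d ∧ b = (lowering hρ)^[i] v} := by
  have h1 := mem_iSup_weightSpace hρ N (fun z => hN _) ha
  refine (iSup_le fun j => ?_ : (⨆ j, N ⊓ weightSpace ρ j) ≤ _) h1
  rintro b ⟨hb, hbj⟩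
  refine Submodule.span_mono ?_ ((sl2Module hρ).mem_span_primitive (N := N)
    (fun a ha => (polyFlow_upper hρ).gen_mem fun x => hN _ _ ha)
    (fun a ha => (polyFlow_lower hρ).gen_mem fun x => hN _ _ ha) hb hbj)
  rintro _ ⟨i, d, v, hv, hd, hE, rfl⟩
  exact ⟨i, d, v, hv, mem_primitive.2 ⟨hd, hE⟩, rfl⟩

/-- A function fixed by the unipotent elements is invariant. -/
theorem mem_invariants_of_derivations {a : A} (hE : raising hρ a = 0) (hF : lowering hρ a = 0) :
    a ∈ invariants ρ := by
  rw [mem_invariants]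
  let S : Submonoid SL2 :=
    { carrier := {g | ρ g a = a}
      one_mem' := by simp
      mul_mem' := fun {g h} hg hh => by
        change ρ (g * h) a = a
        rw [map_mul, AlgHom.mul_apply, show ρ h a = a from hh, show ρ g a = a from hg] }
  have hS : S = ⊤ := closure_upper_lower S
    (fun x => (polyFlow_upper hρ).fixed_of_gen_eq_zero hE x)
    (fun x => (polyFlow_lower hρ).fixed_of_gen_eq_zero hF x)
  exact fun g => (hS ▸ Submonoid.mem_top g : g ∈ S)

theorem primitive_zero {a : A} : a ∈ primitive hρ 0 ↔ a ∈ invariants ρ := by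
  constructor
  · intro ha
    obtain ⟨h1, h2⟩ := mem_primitive.1 ha
    refine mem_invariants_of_derivations hρ h2 ?_
    by_cases h0 : a = 0
    · rw [h0, map_zero]
    · obtain ⟨d, hd, h3⟩ := (sl2Module hρ).weight_of_primitive h1 h2 h0
      obtain rfl : d = 0 := by simpa using hd.symm
      exact h3
  · intro ha
    exact mem_primitive.2 ⟨invariants_le_weightSpace ha,
      (polyFlow_upper hρ).gen_eq_zero_of_fixed fun x => mem_invariants.1 ha _⟩

end

/-! ### Dimension and transcendence degree -/

/-- In the fraction field of a finitely generated domain of Krull dimension `n`, there are no more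
than `n` algebraically independent elements. -/
theorem card_le_of_algebraicIndependent {A : Type*} [CommRing A] [IsDomain A] [Algebra ℂ A]
    [Algebra.FiniteType ℂ A] {n : ℕ} (hdim : ringKrullDim A = n) {ι : Type} [Fintype ι]
    {x : ι → FractionRing A} (hx : AlgebraicIndependent ℂ x) : Fintype.card ι ≤ n := by
  obtain ⟨s, g, hinj, hint⟩ := exists_integral_inj_algHom_of_fg ℂ A
  let _ := g.toRingHom.toAlgebra
  have : Algebra.IsIntegral (MvPolynomial (Fin s) ℂ) A := ⟨hint⟩
  have : FaithfulSMul (MvPolynomial (Fin s) ℂ) A :=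
    (faithfulSMul_iff_algebraMap_injective _ _).2 hinj
  have : IsScalarTower ℂ (MvPolynomial (Fin s) ℂ) A :=
    IsScalarTower.of_algebraMap_eq fun c => (g.commutes c).symm
  have hs : s ≤ n := by
    have h1 : (s : WithBot ℕ∞) ≤ ringKrullDim (MvPolynomial (Fin s) ℂ) := by
      rw [MvPolynomial.ringKrullDim_of_isNoetherianRing, ringKrullDim_eq_zero_of_field]
      simp
    obtain ⟨l, hl⟩ := Order.le_krullDim_iff.1 h1
    obtain ⟨Q, hQ, hQl⟩ := Ideal.exists_ideal_over_prime_of_isIntegral_of_isDomain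
      (S := A) l.head.asIdeal (by
        rw [(RingHom.injective_iff_ker_eq_bot (algebraMap (MvPolynomial (Fin s) ℂ) A)).1 hinj]
        exact bot_le)
    have := hQ
    have : Q.LiesOver l.head.asIdeal := ⟨hQl.symm⟩
    obtain ⟨l', hl', -⟩ := Ideal.exists_ltSeries_of_hasGoingUp l Q
    have h2 : ((l'.length : ℕ) : WithBot ℕ∞) ≤ ringKrullDim A := Order.LTSeries.length_le_krullDim l'
    rw [hdim, hl', hl] at h2
    exact_mod_cast h2
  have : IsScalarTower ℂ (MvPolynomial (Fin s) ℂ) (FractionRing A) :=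
    IsScalarTower.of_algebraMap_eq fun c => by
      rw [IsScalarTower.algebraMap_apply ℂ A (FractionRing A),
        IsScalarTower.algebraMap_apply ℂ (MvPolynomial (Fin s) ℂ) A,
        ← IsScalarTower.algebraMap_apply]
  have : FaithfulSMul (MvPolynomial (Fin s) ℂ) (FractionRing A) :=
    (faithfulSMul_iff_algebraMap_injective _ _).2 (by
      rw [IsScalarTower.algebraMap_eq _ A (FractionRing A)]
      exact (IsFractionRing.injective A (FractionRing A)).comp hinj)
  have : Algebra.IsAlgebraic A (FractionRing A) :=
    (IsFractionRing.comap_isAlgebraic_iff (K := FractionRing A)).2 inferInstance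
  have : Algebra.IsAlgebraic (MvPolynomial (Fin s) ℂ) (FractionRing A) :=
    Algebra.IsAlgebraic.trans _ A _
  have h3 := lift_trdeg_add_eq ℂ (MvPolynomial (Fin s) ℂ) (FractionRing A)
  rw [trdeg_eq_zero (R := MvPolynomial (Fin s) ℂ), MvPolynomial.trdeg_of_isDomain] at h3
  have h4 := hx.lift_cardinalMk_le_trdeg
  simp at h3 h4
  rw [← h3] at h4
  have : Fintype.card ι ≤ s := by exact_mod_cast h4
  omega

section Transcendence

variable {A : Type*} [CommRing A] [Algebra ℂ A] (S : Subalgebra ℂ A)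

theorem aeval_map_fixed {φ : A →ₐ[ℂ] A} (hS : ∀ s ∈ S, φ s = s) (P : S[X]) (y : A) :
    φ ((P.map (algebraMap S A)).eval y) = (P.map (algebraMap S A)).eval (φ y) := by
  rw [eval_map, eval_map, ← RingHom.coe_coe φ, hom_eval₂]
  congr 1
  ext s
  exact hS s s.2

/-- If a one-parameter family of automorphisms moves `y` to `y + x f`, with `f` not a zero divisor,
then `y` is transcendental over every subalgebra fixed by these automorphisms. -/
theorem transcendental_of_translation (θ : ℂ → A →ₐ[ℂ] A) (hS : ∀ x, ∀ s ∈ S, θ x s = s) {y f : A}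
    (hf : f ∈ nonZeroDivisors A) (hy : ∀ x, θ x y = y + x • f) : Transcendental S y := by
  rw [transcendental_iff]
  intro P hP
  set p := P.map (algebraMap S A) with hp
  have h0 : p.eval y = 0 := by rw [hp, eval_map_algebraMap, hP]
  have h1 : (taylor y p).comp (C f * X) = 0 := by
    refine eq_zero_of_eval_eq_zero _ Set.infinite_univ fun x _ => ?_
    rw [eval_comp, taylor_eval, eval_mul, eval_C, eval_X, mul_comm, ← Algebra.smul_def, add_comm,
      ← hy, hp, ← aeval_map_fixed S (hS x), ← hp, h0, map_zero]
  have h2 : taylor y p = 0 := by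
    ext k
    have := congrArg (fun q => q.coeff k) h1
    simp only [comp_C_mul_X_coeff, coeff_zero] at this
    rw [coeff_zero]
    exact (mul_right_mem_nonZeroDivisors_eq_zero_iff (pow_mem hf k)).1 this
  have h3 : p = 0 := taylor_injective y (by rw [h2, map_zero])
  exact (Polynomial.map_eq_zero_iff Subtype.val_injective).1 h3

/-- If a torus scales `f` by a nontrivial character, with `f` not a zero divisor, then `f` is
transcendental over every subalgebra fixed by the torus. -/
theorem transcendental_of_weight (θ : ℂˣ → A →ₐ[ℂ] A) (hS : ∀ z, ∀ s ∈ S, θ z s = s) {f : A}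
    (hf : f ∈ nonZeroDivisors A) {n : ℕ} (hn : 0 < n) (hθ : ∀ z, θ z f = ((z : ℂ) ^ n) • f) :
    Transcendental S f := by
  rw [transcendental_iff]
  intro P hP
  set p := P.map (algebraMap S A) with hp
  have h0 : p.eval f = 0 := by rw [hp, eval_map_algebraMap, hP]
  have h1 : p.comp (C f * X) = 0 := by
    refine eq_zero_of_eval_eq_zero _ infinite_ne_zero fun x hx => ?_
    obtain ⟨w, rfl⟩ := IsAlgClosed.exists_pow_nat_eq x hn
    have hw : w ≠ 0 := by rintro rfl; exact hx (zero_pow hn.ne')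
    have := hθ (Units.mk0 w hw)
    rw [Units.val_mk0] at this
    rw [eval_comp, eval_mul, eval_C, eval_X, mul_comm, ← Algebra.smul_def,
      ← this, hp, ← aeval_map_fixed S (hS _), ← hp, h0, map_zero]
  have h3 : p = 0 := by
    ext k
    have := congrArg (fun q => q.coeff k) h1
    simp only [comp_C_mul_X_coeff, coeff_zero] at this
    rw [coeff_zero]
    exact (mul_right_mem_nonZeroDivisors_eq_zero_iff (pow_mem hf k)).1 this
  exact (Polynomial.map_eq_zero_iff Subtype.val_injective).1 h3

theorem fixed_of_mem_adjoin {φ : A →ₐ[ℂ] A} {s : Set A} (h : ∀ a ∈ s, φ a = a) :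
    ∀ a ∈ Algebra.adjoin ℂ s, φ a = a := by
  have : Algebra.adjoin ℂ s ≤ AlgHom.equalizer φ (AlgHom.id ℂ A) := Algebra.adjoin_le h
  exact fun a ha => this ha

end Transcendence

/-! ### Highest weight vectors -/

section HighestWeight

variable {A : Type*} [CommRing A] [Algebra ℂ A] {ρ : Action A} {hρ : IsAlgebraicAction ρ}

theorem one_mem_primitive : (1 : A) ∈ primitive hρ 0 :=
  (primitive_zero hρ).2 (one_mem _)

theorem mul_mem_primitive {d e : ℕ} {f g : A} (hf : f ∈ primitive hρ d) (hg : g ∈ primitive hρ e) :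
    f * g ∈ primitive hρ (d + e) := by
  rw [mem_primitive] at *
  refine ⟨?_, ?_⟩
  · have := mul_mem_weightSpace hf.1 hg.1
    exact_mod_cast this
  · rw [Derivation.leibniz, hf.2, hg.2, smul_zero, smul_zero, add_zero]

theorem pow_mem_primitive {d : ℕ} {f : A} (hf : f ∈ primitive hρ d) (m : ℕ) :
    f ^ m ∈ primitive hρ (m * d) := by
  induction m with
  | zero => simpa using one_mem_primitive
  | succ m ih =>
    rw [pow_succ, Nat.succ_mul]
    exact mul_mem_primitive ih hf

theorem inv_mul_mem_primitive {d : ℕ} {c f : A} (hc : c ∈ invariants ρ) (hf : f ∈ primitive hρ d) :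
    c * f ∈ primitive hρ d := by
  have := mul_mem_primitive ((primitive_zero hρ).2 hc) hf
  rwa [zero_add] at this

theorem mem_primitive_of_mul [IsDomain A] {k e : ℕ} {h g : A} (hg : g ∈ primitive hρ e)
    (hg0 : g ≠ 0) (hhg : h * g ∈ primitive hρ (k + e)) : h ∈ primitive hρ k := by
  rw [mem_primitive] at *
  refine ⟨fun z => ?_, ?_⟩
  · have h1 := hhg.1 z
    rw [map_mul, hg.1 z, mul_smul_comm, Nat.cast_add, zpow_add₀ z.ne_zero,
      mul_comm ((z : ℂ) ^ (k : ℤ)), ← smul_smul, ← smul_mul_assoc] at h1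
    rw [← smul_mul_assoc, ← smul_mul_assoc] at h1
    have h2 := mul_right_cancel₀ hg0 h1
    exact smul_right_injective A (zpow_ne_zero (e : ℤ) z.ne_zero) h2
  · have h1 := hhg.2
    rw [Derivation.leibniz, hg.2, smul_zero, zero_add, smul_eq_mul, mul_eq_zero] at h1
    exact h1.resolve_left hg0

theorem rho_injective (g : SL2) : Function.Injective (ρ g) := by
  refine Function.LeftInverse.injective (g := ρ g⁻¹) fun a => ?_
  rw [← AlgHom.mul_apply, ← map_mul, inv_mul_cancel, map_one]
  rfl

variable (e : ℂ[X] ≃ₐ[ℂ] invariants ρ)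

/-- Polynomials in the coordinate of the base, as invariant functions. -/
def base : ℂ[X] →ₐ[ℂ] A := (invariants ρ).val.comp e.toAlgHom

theorem base_mem (p : ℂ[X]) : base e p ∈ invariants ρ := (e p).2

theorem rho_base (g : SL2) (p : ℂ[X]) : ρ g (base e p) = base e p :=
  mem_invariants.1 (base_mem e p) g

theorem base_injective : Function.Injective (base e) :=
  Subtype.val_injective.comp e.injective

theorem exists_base_eq {a : A} (ha : a ∈ invariants ρ) : ∃ p, base e p = a :=
  ⟨e.symm ⟨a, ha⟩, by simp [base]⟩

theorem raising_base (hρ : IsAlgebraicAction ρ) (p : ℂ[X]) : raising hρ (base e p) = 0 :=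
  (polyFlow_upper hρ).gen_eq_zero_of_fixed fun _ => rho_base e _ p

theorem lowering_base (hρ : IsAlgebraicAction ρ) (p : ℂ[X]) : lowering hρ (base e p) = 0 :=
  (polyFlow_lower hρ).gen_eq_zero_of_fixed fun _ => rho_base e _ p

theorem base_mul_mem_primitive {d : ℕ} (p : ℂ[X]) {f : A} (hf : f ∈ primitive hρ d) :
    base e p * f ∈ primitive hρ d := inv_mul_mem_primitive (base_mem e p) hf

variable [IsDomain A]

omit [IsDomain A] in
theorem base_ne_zero {p : ℂ[X]} (hp : p ≠ 0) : base e p ≠ 0 :=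
  (map_ne_zero_iff _ (base_injective e)).2 hp

theorem isUnit_of_base {p : ℂ[X]} (h : IsUnit (base e p)) : IsUnit p := by
  obtain ⟨w, hw⟩ := h.exists_right_inv
  have : w ∈ invariants ρ := by
    rw [mem_invariants]
    intro g
    refine mul_left_cancel₀ h.ne_zero ?_
    rw [hw, ← rho_base e g p, ← map_mul, hw, map_one]
  obtain ⟨q, rfl⟩ := exists_base_eq e this
  exact IsUnit.of_mul_eq_one q (base_injective e (by rw [map_mul, hw, map_one]))

/-- The extension of an automorphism to the fraction field. -/
def fractionAction (ρ : Action A) (g : SL2) : FractionRing A →ₐ[ℂ] FractionRing A :=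
  IsFractionRing.liftAlgHom (g := (Algebra.algHom ℂ A (FractionRing A)).comp (ρ g))
    ((IsFractionRing.injective A (FractionRing A)).comp (rho_injective g))

theorem fractionAction_algebraMap (g : SL2) (a : A) :
    fractionAction ρ g (algebraMap A (FractionRing A) a) = algebraMap A (FractionRing A) (ρ g a) :=
  (IsFractionRing.lift_algebraMap (K := FractionRing A) (g := ((Algebra.algHom ℂ A
    (FractionRing A)).comp (ρ g) : A →+* FractionRing A))
    ((IsFractionRing.injective A (FractionRing A)).comp (rho_injective g)) a).trans rfl

omit [IsDomain A] in
theorem raising_lowering_primitive {d : ℕ} {g : A} (hg : g ∈ primitive hρ d) :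
    raising hρ (lowering hρ g) = (d : ℂ) • g := by
  have := raising_lowering hρ (mem_primitive.1 hg).1
  rw [(mem_primitive.1 hg).2, map_zero, sub_zero] at this
  exact_mod_cast this

omit [IsDomain A] in
theorem upper_lowering_primitive {d : ℕ} {g : A} (hg : g ∈ primitive hρ d) (x : ℂ) :
    ρ (upper x) (lowering hρ g) = lowering hρ g + x • ((d : ℂ) • g) := by
  set fU := polyFlow_upper hρ
  have h1 : fU.gen (lowering hρ g) = (d : ℂ) • g := raising_lowering_primitive hg
  have h2 : fU.gen (fU.gen (lowering hρ g)) = 0 := by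
    rw [h1, Derivation.map_smul]
    exact (congrArg _ (mem_primitive.1 hg).2).trans (smul_zero _)
  have : fU.orbit (lowering hρ g) = C (lowering hρ g) + C ((d : ℂ) • g) * X := by
    ext k
    rcases k with _ | _ | k
    · simp [fU.orbit_coeff_zero]
    · rw [zero_add, ← fU.gen_apply, h1]
      simp
    · rw [fU.coeff_eq, Function.iterate_succ_apply, Function.iterate_succ_apply, h2,
        iterate_map_zero, smul_zero]
      simp
  rw [← fU.eval_orbit, this, eval_add, eval_mul, eval_C, eval_C, eval_X, mul_comm,
    ← Algebra.smul_def]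

variable [Algebra.FiniteType ℂ A] [IsIntegrallyClosed A]

/-- Two highest weight vectors `f`, `g` of the same weight are proportional over the function field
of the base. Otherwise the base coordinate, `f / g`, `g` and `F g` would be four algebraically
independent elements of the function field; and once `f / g` is algebraic over the base, a
multiple of it is integral, hence regular by normality, and invariant. -/
theorem exists_base_mul_eq (hdim : ringKrullDim A = 3) {d : ℕ} {f g : A}
    (hf : f ∈ primitive hρ d) (hg : g ∈ primitive hρ d) (hg0 : g ≠ 0) :
    ∃ p q, p ≠ 0 ∧ base e p * f = base e q * g := by
  rcases Nat.eq_zero_or_pos d with rfl | hd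
  · obtain ⟨q, rfl⟩ := exists_base_eq e ((primitive_zero hρ).1 hf)
    obtain ⟨p, rfl⟩ := exists_base_eq e ((primitive_zero hρ).1 hg)
    exact ⟨p, q, fun h => hg0 (by rw [h, map_zero]), mul_comm _ _⟩
  set L := FractionRing A
  set i := algebraMap A L
  have hi : Function.Injective i := IsFractionRing.injective A L
  have hgL : i g ≠ 0 := (map_ne_zero_iff _ hi).2 hg0
  set r : L := i f / i g
  set t : L := i (base e X)
  have ht : AlgebraicIndependent ℂ (fun _ : Unit => t) := by
    rw [algebraicIndependent_unique_type_iff, transcendental_iff]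
    intro p hp
    have h1 : Polynomial.aeval t p = i (base e p) := by
      have h2 := Polynomial.aeval_algHom_apply (Algebra.algHom ℂ A L) (base e X) p
      have h3 := Polynomial.aeval_algHom_apply (base e) X p
      rw [Polynomial.aeval_X_left, AlgHom.id_apply] at h3
      rw [h3] at h2
      exact h2
    rw [h1] at hp
    by_contra h0
    exact base_ne_zero e h0 (hi (by rw [hp, map_zero]))
  have hfixt : ∀ x, fractionAction ρ x t = t := fun x => by
    rw [fractionAction_algebraMap, rho_base]
  have hr_alg : IsAlgebraic (Algebra.adjoin ℂ (Set.range fun _ : Unit => t)) r := by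
    by_contra hr
    have h1 := AlgebraicIndependent.option_iff.2 ⟨ht, hr⟩
    have hUr : ∀ x, fractionAction ρ (upper x) r = r := fun x => by
      rw [map_div₀, fractionAction_algebraMap, fractionAction_algebraMap, upper_primitive hρ hf,
        upper_primitive hρ hg]
    have hTr : ∀ z, fractionAction ρ (torus z) r = r := fun z => by
      rw [map_div₀, fractionAction_algebraMap, fractionAction_algebraMap, (mem_primitive.1 hf).1 z,
        (mem_primitive.1 hg).1 z, Algebra.smul_def, Algebra.smul_def, map_mul, map_mul,
        mul_div_mul_left]
      rw [map_ne_zero_iff _ hi, map_ne_zero_iff _ (algebraMap ℂ A).injective]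
      exact zpow_ne_zero _ z.ne_zero
    have h2 := AlgebraicIndependent.option_iff.2 ⟨h1, transcendental_of_weight _
      (fun z => fractionAction ρ (torus z)) (fun z => fixed_of_mem_adjoin (by
        rintro _ ⟨_ | _, rfl⟩
        · exact hTr z
        · exact hfixt _)) (f := i g) (mem_nonZeroDivisors_of_ne_zero hgL) hd (fun z => by
        rw [fractionAction_algebraMap, (mem_primitive.1 hg).1 z, zpow_natCast, Algebra.smul_def,
          map_mul, Algebra.smul_def]
        rfl)⟩
    have h3 := AlgebraicIndependent.option_iff.2 ⟨h2, transcendental_of_translation _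
      (fun x => fractionAction ρ (upper x)) (fun x => fixed_of_mem_adjoin (by
        rintro _ ⟨_ | _ | _, rfl⟩
        · exact (fractionAction_algebraMap _ _).trans (by rw [upper_primitive hρ hg]; rfl)
        · exact hUr x
        · exact hfixt _)) (y := i (lowering hρ g)) (f := i ((d : ℂ) • g))
        (mem_nonZeroDivisors_of_ne_zero ((map_ne_zero_iff _ hi).2
          (smul_ne_zero (Nat.cast_ne_zero.2 hd.ne') hg0))) (fun x => by
        rw [fractionAction_algebraMap, upper_lowering_primitive hg, map_add,
          Algebra.smul_def x, map_mul, Algebra.smul_def x (i _)]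
        rfl)⟩
    have := card_le_of_algebraicIndependent hdim h3
    simp at this
  obtain ⟨⟨y, hy⟩, hy0, hint⟩ := hr_alg.exists_integral_multiple
  obtain ⟨p, rfl⟩ : ∃ p, i (base e p) = y := by
    have h1 : Algebra.adjoin ℂ (Set.range fun _ : Unit => t) ≤
        ((Algebra.algHom ℂ A L).comp (base e)).range :=
      Algebra.adjoin_le (by rintro _ ⟨_, rfl⟩; exact ⟨X, rfl⟩)
    exact h1 hy
  have hint' : IsIntegral A (i (base e p) * r) := by
    have h1 : Algebra.adjoin ℂ (Set.range fun _ : Unit => t) ≤ (Algebra.algHom ℂ A L).range :=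
      Algebra.adjoin_le (by rintro _ ⟨_, rfl⟩; exact ⟨_, rfl⟩)
    obtain ⟨P, hP, hPe⟩ := hint
    have h2 : ∀ s : Algebra.adjoin ℂ (Set.range fun _ : Unit => t),
        IsIntegral A (algebraMap (Algebra.adjoin ℂ (Set.range fun _ : Unit => t)) L s) := by
      rintro ⟨s, hs⟩
      obtain ⟨a, rfl⟩ := h1 hs
      exact isIntegral_algebraMap
    have h3 : IsIntegral (integralClosure A L) (i (base e p) * r) := by
      refine ⟨P.map (RingHom.codRestrict (algebraMap _ L) (integralClosure A L).toSubring h2),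
        hP.map _, ?_⟩
      rw [eval₂_map]
      exact hPe
    exact isIntegral_trans _ h3
  obtain ⟨h, hh⟩ := IsIntegrallyClosed.isIntegral_iff.1 hint'
  have hhg : h * g = base e p * f := hi (by
    rw [map_mul, map_mul]
    change i h = _ at hh
    rw [hh]
    rw [mul_assoc, div_mul_cancel₀ _ hgL])
  have hp0 : p ≠ 0 := fun h0 => hy0 (Subtype.ext (by simp [h0]))
  have hprim : h ∈ primitive hρ 0 := mem_primitive_of_mul hg hg0 (by
    rw [hhg, zero_add]
    exact base_mul_mem_primitive e p hf)
  obtain ⟨q, rfl⟩ := exists_base_eq e ((primitive_zero hρ).1 hprim)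
  exact ⟨p, q, hp0, hhg.symm⟩

/-- The highest weight vectors of a given weight form a free module of rank at most one over the
ring of functions on the base. -/
theorem exists_generator (hdim : ringKrullDim A = 3) {d : ℕ} (hd : ∃ g ∈ primitive hρ d, g ≠ 0) :
    ∃ f ∈ primitive hρ d, f ≠ 0 ∧ ∀ h ∈ primitive hρ d, ∃ q, h = base e q * f := by
  have : IsNoetherianRing A := Algebra.FiniteType.isNoetherianRing ℂ A
  obtain ⟨g, hg, hg0⟩ := hd
  -- A generator is a highest weight vector whose principal ideal in `A` is maximal.
  obtain ⟨I, ⟨f, hf, hf0, rfl⟩, hmax⟩ := (wellFounded_gt (α := Ideal A)).has_min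
    {I | ∃ f ∈ primitive hρ d, f ≠ 0 ∧ I = Ideal.span {f}} ⟨_, g, hg, hg0, rfl⟩
  refine ⟨f, hf, hf0, fun h hh => ?_⟩
  obtain ⟨p, q, hp, hpq⟩ := exists_base_mul_eq e hdim hh hf hf0
  let _ : GCDMonoid ℂ[X] := EuclideanDomain.gcdMonoid ℂ[X]
  obtain ⟨p', q', hp', hq', hu⟩ := extract_gcd p q
  obtain ⟨a, b, hab⟩ := (gcd_isUnit_iff p' q').1 hu
  have hgcd : gcd p q ≠ 0 := fun h0 => hp (by rw [hp', h0, zero_mul])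
  have hpq' : base e p' * h = base e q' * f := by
    refine mul_left_cancel₀ (base_ne_zero e hgcd) ?_
    rw [← mul_assoc, ← mul_assoc, ← map_mul, ← map_mul, ← hp', ← hq', hpq]
  -- By Bézout, `f` is the multiple `p' k` of another highest weight vector `k`.
  have hk : f = base e p' * (base e a * f + base e b * h) := by
    have h1 := congrArg (base e) hab
    rw [map_add, map_mul, map_mul, map_one] at h1
    linear_combination -f * h1 - base e b * hpq'
  have hkprim : base e a * f + base e b * h ∈ primitive hρ d :=
    Submodule.add_mem _ (base_mul_mem_primitive e a hf) (base_mul_mem_primitive e b hh)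
  have hk0 : base e a * f + base e b * h ≠ 0 := fun h0 => hf0 (by rw [hk, h0, mul_zero])
  have hle : Ideal.span {f} ≤ Ideal.span {base e a * f + base e b * h} := by
    rw [Ideal.span_singleton_le_span_singleton]
    exact ⟨base e p', by rw [mul_comm]; exact hk⟩
  have hge : Ideal.span {base e a * f + base e b * h} ≤ Ideal.span {f} := by
    by_contra hlt
    exact hmax _ ⟨_, hkprim, hk0, rfl⟩ (lt_of_le_not_ge hle hlt)
  rw [Ideal.span_singleton_le_span_singleton] at hge
  obtain ⟨c, hc⟩ := hge
  have hunit : IsUnit p' := isUnit_of_base e (IsUnit.of_mul_eq_one c (by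
    refine mul_right_cancel₀ hk0 ?_
    rw [one_mul]
    conv_rhs => rw [hc, hk]
    ring))
  obtain ⟨v, hv⟩ := hunit.exists_left_inv
  refine ⟨v * q', ?_⟩
  have h1 := congrArg (base e) hv
  rw [map_mul, map_one] at h1
  rw [map_mul]
  linear_combination -h * h1 + base e v * hpq'

include e in
/-- The weights of highest weight vectors are closed under subtraction, by normality. -/
theorem exists_primitive_sub (hdim : ringKrullDim A = 3) {k d : ℕ} {f g : A}
    (hf : f ∈ primitive hρ (k + d)) (hf0 : f ≠ 0) (hg : g ∈ primitive hρ d) (hg0 : g ≠ 0) :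
    ∃ h ∈ primitive hρ k, h ≠ 0 := by
  rcases Nat.eq_zero_or_pos d with rfl | hd
  · exact ⟨f, hf, hf0⟩
  have h1 : f ^ d ∈ primitive hρ (d * (k + d)) := pow_mem_primitive hf d
  have h2 : g ^ (k + d) ∈ primitive hρ (d * (k + d)) := by
    rw [mul_comm]
    exact pow_mem_primitive hg _
  obtain ⟨p, q, hp, hpq⟩ := exists_base_mul_eq e hdim h1 h2 (pow_ne_zero _ hg0)
  set L := FractionRing A
  set i := algebraMap A L
  have hi : Function.Injective i := IsFractionRing.injective A L
  have hgL : i g ≠ 0 := (map_ne_zero_iff _ hi).2 hg0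
  have h3 : (i (base e p * f) / i g) ^ d = i (base e p ^ (d - 1) * base e q * g ^ k) := by
    rw [div_pow, div_eq_iff (pow_ne_zero _ hgL), ← map_pow i, ← map_pow i, ← map_mul i]
    congr 1
    rw [mul_pow, mul_assoc, ← pow_add, mul_assoc, ← hpq, ← mul_assoc, ← pow_succ,
      Nat.sub_add_cancel hd]
  obtain ⟨h, hh⟩ := IsIntegrallyClosed.exists_algebraMap_eq_of_isIntegral_pow (K := L) hd
    (h3 ▸ isIntegral_algebraMap : IsIntegral A ((i (base e p * f) / i g) ^ d))
  have hhg : h * g = base e p * f := hi (by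
    rw [map_mul]
    change i h = _ at hh
    rw [hh, div_mul_cancel₀ _ hgL])
  refine ⟨h, mem_primitive_of_mul hg hg0 (by
    rw [hhg]; exact base_mul_mem_primitive e p hf), ?_⟩
  rintro rfl
  rw [zero_mul, eq_comm, mul_eq_zero] at hhg
  exact hhg.elim (base_ne_zero e hp) hf0

omit [IsDomain A] [Algebra.FiniteType ℂ A] [IsIntegrallyClosed A] in
include e in
/-- There is a highest weight vector of positive weight: otherwise all functions are invariant, and
the dimension is one. -/
theorem exists_primitive_pos (hdim : ringKrullDim A = 3) :
    ∃ d, 0 < d ∧ ∃ f ∈ primitive hρ d, f ≠ 0 := by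
  by_contra hno
  push Not at hno
  have hall : ∀ a : A, a ∈ invariants ρ := by
    intro a
    have h1 := mem_span_lowering_primitive hρ ⊤ (fun _ _ _ => Submodule.mem_top)
      (Submodule.mem_top (x := a))
    refine (Submodule.span_le (p := Subalgebra.toSubmodule (invariants ρ))).2 ?_ h1
    rintro _ ⟨i, d, v, -, hv, rfl⟩
    rcases Nat.eq_zero_or_pos d with rfl | hd
    · obtain ⟨p, rfl⟩ := exists_base_eq e ((primitive_zero hρ).1 hv)
      rcases i with _ | i
      · exact base_mem e p
      · rw [Function.iterate_succ_apply, lowering_base, iterate_map_zero]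
        exact zero_mem _
    · rw [hno d hd v hv, iterate_map_zero]
      exact zero_mem _
  have hsurj : Function.Surjective (base e) := fun a => exists_base_eq e (hall a)
  have h1 := ringKrullDim_le_of_surjective (base e : ℂ[X] →+* A) hsurj
  rw [hdim, Polynomial.ringKrullDim_of_isNoetherianRing, ringKrullDim_eq_zero_of_field] at h1
  norm_cast at h1

include e in
/-- The weights of highest weight vectors are the multiples of some `n ≥ 1`. -/
theorem exists_weight_generator (hdim : ringKrullDim A = 3) :
    ∃ n, 0 < n ∧ (∃ f ∈ primitive hρ n, f ≠ 0) ∧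
      ∀ d, (∃ f ∈ primitive hρ d, f ≠ 0) → n ∣ d := by
  classical
  have hex := exists_primitive_pos (hρ := hρ) e hdim
  obtain ⟨hn, g, hg, hg0⟩ := Nat.find_spec hex
  refine ⟨Nat.find hex, hn, ⟨g, hg, hg0⟩, fun d => ?_⟩
  induction d using Nat.strong_induction_on with
  | _ d ih =>
    rintro ⟨f, hf, hf0⟩
    rcases Nat.eq_zero_or_pos d with rfl | hd
    · exact dvd_zero _
    have hle : Nat.find hex ≤ d := Nat.find_min' hex ⟨hd, f, hf, hf0⟩
    have hsub : d - Nat.find hex + Nat.find hex = d := Nat.sub_add_cancel hle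
    have h1 := ih (d - Nat.find hex) (by omega)
      (exists_primitive_sub e hdim (hsub.symm ▸ hf) hf0 hg hg0)
    have := h1.add (dvd_refl (Nat.find hex))
    rwa [hsub] at this

end HighestWeight

/-! ### Reconstruction of an algebra from a slice of its lowering derivation -/

/-- The derivation `Δ` of `ℂ[T, Y, Z]` that corresponds to `f F` under `T ↦ t`, `Y ↦ f`, `Z ↦ x`,
if `F t = 0`, `F f = n x` and `f (F x) = (n - 1) x² + R(t, f, x)`. -/
def universalDerivation (n : ℕ) (R : MvPolynomial (Fin 3) ℂ) :
    Derivation ℂ (MvPolynomial (Fin 3) ℂ) (MvPolynomial (Fin 3) ℂ) :=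
  MvPolynomial.mkDerivation ℂ ![0, (n : MvPolynomial (Fin 3) ℂ) * MvPolynomial.X 1 * MvPolynomial.X 2,
    ((n : MvPolynomial (Fin 3) ℂ) - 1) * MvPolynomial.X 2 ^ 2 + R]

/-- The elements `t`, `f`, `x` satisfy the relations that determine the derivation `F` on the
functions of `t`, `f^{±1}` and `x`. The element `x / f` is a slice of the raising operator. -/
structure IsSlice {A : Type*} [CommRing A] [Algebra ℂ A] (F : Derivation ℂ A A) (n : ℕ)
    (R : MvPolynomial (Fin 3) ℂ) (t f x : A) : Prop where
  map_t : F t = 0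
  map_f : F f = n * x
  map_x : f * F x = (n - 1) * x ^ 2 + MvPolynomial.aeval ![t, f, x] R

namespace IsSlice

variable {A : Type*} [CommRing A] [Algebra ℂ A] {F : Derivation ℂ A A} {n : ℕ}
  {R : MvPolynomial (Fin 3) ℂ} {t f x : A} (h : IsSlice F n R t f x)
include h

theorem map_aeval (Q : MvPolynomial (Fin 3) ℂ) :
    f * F (MvPolynomial.aeval ![t, f, x] Q) =
      MvPolynomial.aeval ![t, f, x] (universalDerivation n R Q) := by
  induction Q using MvPolynomial.induction_on with
  | C a =>
    rw [MvPolynomial.aeval_C, Derivation.map_algebraMap, mul_zero, ← MvPolynomial.algebraMap_eq,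
      Derivation.map_algebraMap, map_zero]
  | add p q hp hq => rw [map_add, map_add, map_add, map_add, mul_add, hp, hq]
  | mul_X p i hp =>
    have hi : f * F (MvPolynomial.aeval ![t, f, x] (MvPolynomial.X i : MvPolynomial (Fin 3) ℂ)) =
        MvPolynomial.aeval ![t, f, x] (universalDerivation n R (MvPolynomial.X i)) := by
      rw [universalDerivation, MvPolynomial.mkDerivation_X]
      fin_cases i
      · simp [h.map_t]
      · simp [h.map_f]
        ring
      · simp [h.map_x]
    rw [map_mul, Derivation.leibniz, Derivation.leibniz, smul_eq_mul, smul_eq_mul, smul_eq_mul,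
      smul_eq_mul, map_add, map_mul, map_mul, ← hp, ← hi]
    ring

/-- If `f ^ N * y` is a polynomial in `t`, `f`, `x`, then so is `f ^ (N + 1) * F y`. -/
theorem map_of_pow_mul_eq {N : ℕ} {y : A} {Q : MvPolynomial (Fin 3) ℂ}
    (hy : f ^ N * y = MvPolynomial.aeval ![t, f, x] Q) :
    f ^ (N + 1) * F y = MvPolynomial.aeval ![t, f, x]
      (universalDerivation n R Q -
        (N : MvPolynomial (Fin 3) ℂ) * (n : MvPolynomial (Fin 3) ℂ) * MvPolynomial.X 2 * Q) := by
  have h1 := h.map_aeval Q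
  rw [← hy, Derivation.leibniz, Derivation.leibniz_pow, h.map_f] at h1
  rw [map_sub, ← h1, map_mul, ← hy]
  simp only [smul_eq_mul, map_mul, map_natCast, MvPolynomial.aeval_X, nsmul_eq_mul]
  rcases N with _ | N
  · simp
  · simp
    ring

variable {B : Type*} [CommRing B] [Algebra ℂ B] {G : Derivation ℂ B B} {t' f' x' : B}
  (h' : IsSlice G n R t' f' x')
include h'

/-- The graph of the homomorphism that is built in `IsSlice.exists_algHom`: pairs of elements of
`A` and `B` which are given by the same expression `Q(t, f, x) / f ^ N`. -/
def graph (_ : IsSlice F n R t f x) (_ : IsSlice G n R t' f' x') : Subalgebra ℂ (A × B) where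
  carrier := {y | ∃ (N : ℕ) (Q : MvPolynomial (Fin 3) ℂ),
    f ^ N * y.1 = MvPolynomial.aeval ![t, f, x] Q ∧ f' ^ N * y.2 = MvPolynomial.aeval ![t', f', x'] Q}
  mul_mem' := by
    rintro y z ⟨N, Q, h1, h2⟩ ⟨M, P, h3, h4⟩
    refine ⟨N + M, Q * P, ?_, ?_⟩
    · rw [map_mul, ← h1, ← h3, Prod.fst_mul]
      ring
    · rw [map_mul, ← h2, ← h4, Prod.snd_mul]
      ring
  add_mem' := by
    rintro y z ⟨N, Q, h1, h2⟩ ⟨M, P, h3, h4⟩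
    refine ⟨N + M, MvPolynomial.X 1 ^ M * Q + MvPolynomial.X 1 ^ N * P, ?_, ?_⟩
    · rw [map_add, map_mul, map_mul, ← h1, ← h3, Prod.fst_add]
      simp
      ring
    · rw [map_add, map_mul, map_mul, ← h2, ← h4, Prod.snd_add]
      simp
      ring
  algebraMap_mem' c := ⟨0, MvPolynomial.C c, by simp, by simp⟩

/-- Suppose that `A` is generated by `t` and the `F ^ i f`, and that `t`, `f`, `x` are algebraically
independent. Then for any elements `t'`, `f'`, `x'` that satisfy the same relations, with `f'` not a zero
divisor, there is a homomorphism with `t ↦ t'` and `f ↦ f'` that intertwines the derivations. -/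
theorem exists_algHom (hind : AlgebraicIndependent ℂ ![t, f, x])
    (hgen : Algebra.adjoin ℂ (insert t (Set.range fun i => F^[i] f)) = ⊤)
    (hf' : f' ∈ nonZeroDivisors B) :
    ∃ φ : A →ₐ[ℂ] B, φ t = t' ∧ φ f = f' ∧ ∀ a, φ (F a) = G (φ a) := by
  set Z := graph h h'
  have hF : ∀ y ∈ Z, (F y.1, G y.2) ∈ Z := by
    rintro y ⟨N, Q, h1, h2⟩
    exact ⟨N + 1, _, h.map_of_pow_mul_eq h1, h'.map_of_pow_mul_eq h2⟩
  have ht : (t, t') ∈ Z := ⟨0, MvPolynomial.X 0, by simp, by simp⟩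
  have hf : (f, f') ∈ Z := ⟨0, MvPolynomial.X 1, by simp, by simp⟩
  have hiter : ∀ i, (F^[i] f, G^[i] f') ∈ Z := by
    intro i
    induction i with
    | zero => exact hf
    | succ i ih =>
      rw [Function.iterate_succ_apply', Function.iterate_succ_apply']
      exact hF _ ih
  set π : Z →ₐ[ℂ] A := (AlgHom.fst ℂ A B).comp Z.val with hπ
  have huniq : ∀ {a : A} {b b' : B}, (a, b) ∈ Z → (a, b') ∈ Z → b = b' := by
    rintro a b b' ⟨N, Q, h1, h2⟩ ⟨M, P, h3, h4⟩
    have h5 : MvPolynomial.X 1 ^ M * Q = MvPolynomial.X 1 ^ N * P := by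
      refine hind ?_
      rw [map_mul, map_mul, ← h1, ← h3]
      simp
      ring
    have h6 := congrArg (MvPolynomial.aeval ![t', f', x']) h5
    rw [map_mul, map_mul, ← h2, ← h4] at h6
    simp only [map_pow, MvPolynomial.aeval_X] at h6
    change f' ^ M * (f' ^ N * b) = f' ^ N * (f' ^ M * b') at h6
    rw [← mul_assoc, ← mul_assoc, ← pow_add, ← pow_add, add_comm N M] at h6
    exact (mul_cancel_left_mem_nonZeroDivisors (pow_mem hf' _)).1 h6
  have hbij : Function.Bijective π := by
    constructor
    · rintro ⟨⟨a, b⟩, h1⟩ ⟨⟨a', b'⟩, h2⟩ h3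
      obtain rfl : a = a' := h3
      exact Subtype.ext (Prod.ext rfl (huniq h1 h2))
    · rw [← AlgHom.range_eq_top, eq_top_iff, ← hgen]
      refine Algebra.adjoin_le ?_
      rintro _ (rfl | ⟨i, rfl⟩)
      · exact ⟨⟨_, ht⟩, rfl⟩
      · exact ⟨⟨_, hiter i⟩, rfl⟩
  set E := AlgEquiv.ofBijective π hbij
  set φ : A →ₐ[ℂ] B := ((AlgHom.snd ℂ A B).comp Z.val).comp E.symm.toAlgHom
  have hφ : ∀ a, (a, φ a) ∈ Z := by
    intro a
    have h1 : (E.symm a).1.1 = a := E.apply_symm_apply a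
    have h2 : (a, φ a) = (E.symm a).1 := Prod.ext h1.symm rfl
    rw [h2]
    exact (E.symm a).2
  exact ⟨φ, huniq (hφ t) ht, huniq (hφ f) hf, fun a => huniq (hφ _) (hF _ (hφ a))⟩

end IsSlice

/-- A presentation of an `SL₂`-algebra over the line with coordinate `t`, by a highest weight vector
`f` of weight `n` whose translates generate the algebra. All the relations are consequences of the
one that gives `f (F x)`, where `F` is the lowering operator and `x = F f / n`. -/
structure Presentation {A : Type*} [CommRing A] [Algebra ℂ A] (ρ : Action A)
    (hF : PolyFlow fun y => ρ (lower y)) (n : ℕ) (R : MvPolynomial (Fin 3) ℂ) (t f x : A) :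
    Prop where
  pos : 0 < n
  t_inv : ∀ g, ρ g t = t
  t_transcendental : Transcendental ℂ t
  f_upper : ∀ s, ρ (upper s) f = f
  f_torus : ∀ z, ρ (torus z) f = ((z : ℂ) ^ n) • f
  f_regular : f ∈ nonZeroDivisors A
  x_upper : ∀ s, ρ (upper s) x = x + s • f
  isSlice : IsSlice hF.gen n R t f x
  generates : Algebra.adjoin ℂ (insert t (Set.range fun i => hF.gen^[i] f)) = ⊤

namespace Presentation

variable {A : Type*} [CommRing A] [Algebra ℂ A] {ρ : Action A}
  {hF : PolyFlow fun y => ρ (lower y)} {n : ℕ} {R : MvPolynomial (Fin 3) ℂ} {t f x : A}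

theorem algebraicIndependent_of_weights (hn : 0 < n) (ht : ∀ g, ρ g t = t)
    (htr : Transcendental ℂ t) (hfu : ∀ s, ρ (upper s) f = f)
    (hft : ∀ z, ρ (torus z) f = ((z : ℂ) ^ n) • f) (hf : f ∈ nonZeroDivisors A)
    (hx : ∀ s, ρ (upper s) x = x + s • f) : AlgebraicIndependent ℂ ![t, f, x] := by
  have h0 : AlgebraicIndependent ℂ (fun _ : Unit => t) := by
    rwa [algebraicIndependent_unique_type_iff]
  have h1 := AlgebraicIndependent.option_iff.2 ⟨h0, transcendental_of_weight _
    (fun z => ρ (torus z)) (fun z => fixed_of_mem_adjoin (by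
      rintro _ ⟨_, rfl⟩
      exact ht _)) hf hn hft⟩
  have h2 := AlgebraicIndependent.option_iff.2 ⟨h1, transcendental_of_translation _
    (fun s => ρ (upper s)) (fun s => fixed_of_mem_adjoin (by
      rintro _ ⟨_ | _, rfl⟩
      · exact hfu s
      · exact ht _)) hf hx⟩
  have h3 := h2.comp ![some (some ()), some none, none] (by
    intro i j hij
    fin_cases i <;> fin_cases j <;> simp_all)
  convert h3 using 1
  funext i
  fin_cases i <;> rfl

theorem algebraicIndependent (h : Presentation ρ hF n R t f x) :
    AlgebraicIndependent ℂ ![t, f, x] :=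
  algebraicIndependent_of_weights h.pos h.t_inv h.t_transcendental h.f_upper h.f_torus h.f_regular
    h.x_upper

theorem upper_lower (h : Presentation ρ hF n R t f x) {s y : ℂ} (hsy : 1 + s * y ≠ 0) :
    ρ (upper s) (ρ (lower y) f) = ((1 + s * y) ^ n) • ρ (lower (y / (1 + s * y))) f := by
  rw [← AlgHom.mul_apply, ← map_mul, upper_mul_lower s y (Units.mk0 _ hsy) rfl, map_mul, map_mul,
    AlgHom.mul_apply, AlgHom.mul_apply, h.f_upper, h.f_torus, map_smul, Units.val_mk0]

variable {B : Type*} [CommRing B] [Algebra ℂ B] {σ : Action B}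
  {hG : PolyFlow fun y => σ (lower y)} {t' f' x' : B}

theorem infinite_one_add_mul_ne_zero (s : ℂ) : {y : ℂ | 1 + s * y ≠ 0}.Infinite := by
  refine ((Set.finite_singleton (-1 / s)).infinite_compl).mono ?_
  intro y hy h0
  refine hy ?_
  have hs : s ≠ 0 := by
    rintro rfl
    simp at h0
  rw [Set.mem_singleton_iff, eq_div_iff hs]
  linear_combination h0

/-- Two `SL₂`-algebras with the same presentation are equivariantly isomorphic. -/
theorem equivariantlyIsomorphic (h : Presentation ρ hF n R t f x)
    (h' : Presentation σ hG n R t' f' x') : EquivariantlyIsomorphic ρ σ := by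
  obtain ⟨φ, hφt, hφf, hφF⟩ :=
    h.isSlice.exists_algHom h'.isSlice h.algebraicIndependent h.generates h'.f_regular
  obtain ⟨ψ, hψt, hψf, hψF⟩ :=
    h'.isSlice.exists_algHom h.isSlice h'.algebraicIndependent h'.generates h.f_regular
  have hφi : ∀ i, φ (hF.gen^[i] f) = hG.gen^[i] f' := fun i => by
    rw [← hφf]; exact Function.Semiconj.iterate_right (f := φ) hφF i f
  have hψi : ∀ i, ψ (hG.gen^[i] f') = hF.gen^[i] f := fun i => by
    rw [← hψf]; exact Function.Semiconj.iterate_right (f := ψ) hψF i f'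
  have h1 : φ.comp ψ = AlgHom.id ℂ B := AlgHom.ext_of_adjoin_eq_top h'.generates (by
    rintro _ (rfl | ⟨i, rfl⟩)
    · simp [hψt, hφt]
    · simp [hψi, hφi])
  have h2 : ψ.comp φ = AlgHom.id ℂ A := AlgHom.ext_of_adjoin_eq_top h.generates (by
    rintro _ (rfl | ⟨i, rfl⟩)
    · simp [hψt, hφt]
    · simp [hψi, hφi])
  have hlow : ∀ y a, φ (ρ (lower y) a) = σ (lower y) (φ a) := fun y a =>
    hF.map_flow hG φ hφF y a
  have hupp : ∀ s, φ.comp (ρ (upper s)) = (σ (upper s)).comp φ := by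
    intro s
    refine AlgHom.ext_of_adjoin_eq_top h.generates ?_
    rintro _ (rfl | ⟨i, rfl⟩)
    · simp [h.t_inv, hφt, h'.t_inv]
    -- The translates `ρ (lower y) f` with `1 + s * y ≠ 0` span the space of the `F ^ i f`.
    · have key := coeff_mem_of_eval_mem
        (LinearMap.eqLocus (φ.comp (ρ (upper s))).toLinearMap ((σ (upper s)).comp φ).toLinearMap)
        (hF.orbit f) (infinite_one_add_mul_ne_zero s) (fun y hy => by
          rw [hF.eval_orbit]
          change φ (ρ (upper s) (ρ (lower y) f)) = σ (upper s) (φ (ρ (lower y) f))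
          rw [h.upper_lower hy, hlow, hφf, h'.upper_lower hy, map_smul, hlow, hφf]) i
      change φ (ρ (upper s) _) = σ (upper s) (φ _) at key
      change φ (ρ (upper s) (hF.gen^[i] f)) = σ (upper s) (φ (hF.gen^[i] f))
      rw [hF.gen_iterate, ← nsmul_eq_mul, map_nsmul, map_nsmul, key, map_nsmul, map_nsmul]
  refine ⟨AlgEquiv.ofAlgHom φ ψ h1 h2, fun g a => ?_⟩
  let S : Submonoid SL2 :=
    { carrier := {g | ∀ a, φ (ρ g a) = σ g (φ a)}
      one_mem' := fun a => by simp
      mul_mem' := fun {g k} hg hk a => by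
        rw [map_mul, map_mul, AlgHom.mul_apply, AlgHom.mul_apply, hg, hk] }
  have hS : S = ⊤ := closure_upper_lower S (fun s a => DFunLike.congr_fun (hupp s) a) hlow
  exact (hS ▸ Submonoid.mem_top g : g ∈ S) a

end Presentation

/-! ### Presentations from highest weight vectors -/

section Analysis

variable {A : Type*} [CommRing A] [Algebra ℂ A] {ρ : Action A} {hρ : IsAlgebraicAction ρ}
  (e : ℂ[X] ≃ₐ[ℂ] invariants ρ)

theorem base_eq_aeval (p : ℂ[X]) : base e p = Polynomial.aeval (base e X) p := by
  rw [Polynomial.aeval_algHom_apply, Polynomial.aeval_X_left, AlgHom.id_apply]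

theorem transcendental_base_X : Transcendental ℂ (base e X) := by
  rw [transcendental_iff]
  intro p hp
  rw [← base_eq_aeval] at hp
  exact base_injective e (by rw [hp, map_zero])

theorem aeval_aeval_X_zero {t f x : A} (p : ℂ[X]) :
    MvPolynomial.aeval ![t, f, x] (Polynomial.aeval (MvPolynomial.X 0 : MvPolynomial (Fin 3) ℂ) p) =
      Polynomial.aeval t p := by
  rw [← Polynomial.aeval_algHom_apply, MvPolynomial.aeval_X]
  rfl

theorem map_mem_adjoin (D : Derivation ℂ A A) {s : Set A} (hs : ∀ a ∈ s, D a ∈ Algebra.adjoin ℂ s)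
    {a : A} (ha : a ∈ Algebra.adjoin ℂ s) : D a ∈ Algebra.adjoin ℂ s := by
  induction ha using Algebra.adjoin_induction with
  | mem a ha => exact hs a ha
  | algebraMap c => rw [Derivation.map_algebraMap]; exact zero_mem _
  | add a b _ _ ha hb => rw [map_add]; exact add_mem ha hb
  | mul a b ha' hb' ha hb =>
    rw [Derivation.leibniz]
    exact add_mem (mul_mem ha' hb) (mul_mem hb' ha)

variable (hρ) in
/-- A subspace that is stable under the lowering operator and contains the highest weight vectors
is everything. -/
theorem mem_of_primitive_mem (S : Submodule ℂ A) (hS : ∀ a ∈ S, lowering hρ a ∈ S)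
    (hprim : ∀ d, ∀ v ∈ primitive hρ d, v ∈ S) (a : A) : a ∈ S := by
  have h1 := mem_span_lowering_primitive hρ ⊤ (fun _ _ _ => Submodule.mem_top)
    (Submodule.mem_top (x := a))
  refine (Submodule.span_le (p := S)).2 ?_ h1
  rintro _ ⟨i, d, v, -, hv, rfl⟩
  induction i with
  | zero => exact hprim d v hv
  | succ i ih =>
    rw [Function.iterate_succ_apply']
    exact hS _ ih

/-- The element `f (F x) - (n - 1) x ^ 2` with `x = F f / n` is a highest weight vector of weight
`2 n - 4`. As this weight is a multiple of `n`, the element vanishes, unless `n = 2` or `n = 4`. -/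
theorem exists_isSlice [IsDomain A] {n : ℕ} (hn : 0 < n)
    (hdiv : ∀ d, (∃ f ∈ primitive hρ d, f ≠ 0) → n ∣ d) {f : A} (hf : f ∈ primitive hρ n)
    (hgen : ∀ h ∈ primitive hρ n, ∃ q, h = base e q * f) :
    ∃ R, IsSlice (lowering hρ) n R (base e X) f ((n : ℂ)⁻¹ • lowering hρ f) ∧
      (R = 0 ∨ (n = 2 ∧ ∃ α : ℂ[X], R = Polynomial.aeval (MvPolynomial.X 0) α) ∨
        (n = 4 ∧ ∃ α : ℂ[X], R = Polynomial.aeval (MvPolynomial.X 0) α * MvPolynomial.X 1)) := by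
  have hn0 : (n : ℂ) ≠ 0 := Nat.cast_ne_zero.2 hn.ne'
  set x := (n : ℂ)⁻¹ • lowering hρ f with hx
  have hFf : lowering hρ f = n * x := by
    rw [hx, ← nsmul_eq_mul, ← Nat.cast_smul_eq_nsmul ℂ, smul_smul, mul_inv_cancel₀ hn0, one_smul]
  have hEx : raising hρ x = f := by
    rw [hx, Derivation.map_smul, raising_lowering_primitive hf, smul_smul, inv_mul_cancel₀ hn0,
      one_smul]
  have hxw : x ∈ weightSpace ρ (n - 2) :=
    Submodule.smul_mem _ _ (lowering_mem_weightSpace hρ (mem_primitive.1 hf).1)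
  have hEF : raising hρ (lowering hρ x) = (2 * (n : A) - 2) * x := by
    have h1 := raising_lowering hρ hxw
    rw [hEx, hFf, sub_eq_iff_eq_add] at h1
    rw [h1, Algebra.smul_def]
    push_cast [map_sub, map_natCast, map_ofNat]
    ring
  set β := f * lowering hρ x - ((n : A) - 1) * x ^ 2 with hβ
  have hcast : ((n : A) - 1) = ((n - 1 : ℤ) : A) := by push_cast; rfl
  have hEβ : raising hρ β = 0 := by
    rw [hβ, map_sub, hcast, ← zsmul_eq_mul, map_zsmul, zsmul_eq_mul, ← hcast, Derivation.leibniz,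
      Derivation.leibniz_pow, hEF, hEx, (mem_primitive.1 hf).2]
    simp only [smul_eq_mul, mul_zero, nsmul_eq_mul]
    push_cast
    ring
  have hβw : β ∈ weightSpace ρ (2 * n - 4) := by
    refine Submodule.sub_mem _ ?_ ?_
    · have := mul_mem_weightSpace (mem_primitive.1 hf).1 (lowering_mem_weightSpace hρ hxw)
      convert this using 2
      ring
    · rw [hcast, ← zsmul_eq_mul]
      refine zsmul_mem ?_ _
      convert pow_mem_weightSpace hxw 2 using 2
      push_cast
      ring
  have hslice : ∀ R, MvPolynomial.aeval ![base e X, f, x] R = β →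
      IsSlice (lowering hρ) n R (base e X) f x := fun R hR =>
    { map_t := lowering_base e hρ X
      map_f := hFf
      map_x := by rw [hR, hβ]; ring }
  by_cases h0 : β = 0
  · exact ⟨0, hslice 0 (by rw [map_zero, h0]), Or.inl rfl⟩
  obtain ⟨d, hd, -⟩ := (sl2Module hρ).weight_of_primitive hβw hEβ h0
  have hβp : β ∈ primitive hρ d := mem_primitive.2 ⟨hd ▸ hβw, hEβ⟩
  obtain ⟨k, hk⟩ := hdiv d ⟨β, hβp, h0⟩
  have hn4 : n = 2 ∨ n = 4 := by
    have h1 : n ∣ 4 := by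
      have h2 : n ∣ 4 + d := by
        have : 4 + d = 2 * n := by omega
        rw [this]
        exact Dvd.intro_left 2 rfl
      exact (Nat.dvd_add_left ⟨k, hk⟩).1 h2
    have h2 : n ≤ 4 := Nat.le_of_dvd (by norm_num) h1
    interval_cases n <;> omega
  rcases hn4 with rfl | rfl
  · obtain rfl : d = 0 := by omega
    obtain ⟨α, hα⟩ := exists_base_eq e ((primitive_zero hρ).1 hβp)
    exact ⟨_, hslice _ (by rw [aeval_aeval_X_zero, ← base_eq_aeval, hα]), Or.inr (Or.inl ⟨rfl, α, rfl⟩)⟩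
  · obtain rfl : d = 4 := by omega
    obtain ⟨α, hα⟩ := hgen β hβp
    refine ⟨_, hslice _ ?_, Or.inr (Or.inr ⟨rfl, α, rfl⟩)⟩
    rw [map_mul, aeval_aeval_X_zero, ← base_eq_aeval, hα, MvPolynomial.aeval_X]
    rfl

variable {n : ℕ} {R : MvPolynomial (Fin 3) ℂ} {f x : A}

/-- The elements that become polynomials in `t`, `f`, `x` after multiplication by a power of `f` and
a power of the function `g` on the base. -/
def localizedLocus (f x : A) (g : ℂ[X]) : Subalgebra ℂ A where
  carrier := {y | ∃ (M N : ℕ) (Q : MvPolynomial (Fin 3) ℂ),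
    f ^ N * (base e g ^ M * y) = MvPolynomial.aeval ![base e X, f, x] Q}
  mul_mem' := by
    rintro y z ⟨M, N, Q, h1⟩ ⟨M', N', Q', h2⟩
    refine ⟨M + M', N + N', Q * Q', ?_⟩
    rw [map_mul, ← h1, ← h2]
    ring
  add_mem' := by
    rintro y z ⟨M, N, Q, h1⟩ ⟨M', N', Q', h2⟩
    refine ⟨M + M', N + N',
      MvPolynomial.X 1 ^ N' * Polynomial.aeval (MvPolynomial.X 0) g ^ M' * Q +
      MvPolynomial.X 1 ^ N * Polynomial.aeval (MvPolynomial.X 0) g ^ M * Q', ?_⟩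
    simp only [map_add, map_mul, map_pow, ← h1, ← h2, aeval_aeval_X_zero, ← base_eq_aeval,
      MvPolynomial.aeval_X, Matrix.cons_val_one, Matrix.cons_val_zero]
    ring
  algebraMap_mem' c := ⟨0, 0, MvPolynomial.C c, by simp⟩

theorem localizedLocus_mono {g g' : ℂ[X]} (h : g ∣ g') :
    localizedLocus e f x g ≤ localizedLocus e f x g' := by
  rintro y ⟨M, N, Q, h1⟩
  obtain ⟨k, rfl⟩ := h
  refine ⟨M, N, Polynomial.aeval (MvPolynomial.X 0) k ^ M * Q, ?_⟩
  simp only [map_mul, map_pow, ← h1, aeval_aeval_X_zero, ← base_eq_aeval]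
  ring

theorem lowering_mem_localizedLocus (h : IsSlice (lowering hρ) n R (base e X) f x) {g : ℂ[X]} {y : A}
    (hy : y ∈ localizedLocus e f x g) : lowering hρ y ∈ localizedLocus e f x g := by
  obtain ⟨M, N, Q, h1⟩ := hy
  have h2 := h.map_of_pow_mul_eq h1
  rw [← map_pow, Derivation.leibniz, lowering_base, smul_zero, add_zero, smul_eq_mul, map_pow] at h2
  exact ⟨M, N + 1, _, h2⟩

variable [IsDomain A] [Algebra.FiniteType ℂ A] [IsIntegrallyClosed A]

theorem exists_mem_localizedLocus (hdim : ringKrullDim A = 3)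
    (hdiv : ∀ d, (∃ f ∈ primitive hρ d, f ≠ 0) → n ∣ d) (hf : f ∈ primitive hρ n) (hf0 : f ≠ 0)
    (h : IsSlice (lowering hρ) n R (base e X) f x) (y : A) :
    ∃ g ≠ 0, y ∈ localizedLocus e f x g := by
  let S : Submodule ℂ A :=
    { carrier := {y | ∃ g ≠ 0, y ∈ localizedLocus e f x g}
      add_mem' := by
        rintro y z ⟨g, hg, hy⟩ ⟨g', hg', hz⟩
        exact ⟨g * g', mul_ne_zero hg hg', add_mem (localizedLocus_mono e (dvd_mul_right _ _) hy)
          (localizedLocus_mono e (dvd_mul_left _ _) hz)⟩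
      zero_mem' := ⟨1, one_ne_zero, zero_mem _⟩
      smul_mem' := by
        rintro c y ⟨g, hg, hy⟩
        exact ⟨g, hg, Subalgebra.smul_mem _ hy c⟩ }
  refine mem_of_primitive_mem hρ S ?_ ?_ y
  · rintro y ⟨g, hg, hy⟩
    exact ⟨g, hg, lowering_mem_localizedLocus e h hy⟩
  · intro d v hv
    by_cases hv0 : v = 0
    · rw [hv0]
      exact S.zero_mem
    obtain ⟨m, rfl⟩ := hdiv d ⟨v, hv, hv0⟩
    rw [mul_comm] at hv
    obtain ⟨p, q, hp, hpq⟩ := exists_base_mul_eq e hdim hv (pow_mem_primitive hf m)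
      (pow_ne_zero _ hf0)
    refine ⟨p, hp, 1, 0, Polynomial.aeval (MvPolynomial.X 0) q * MvPolynomial.X 1 ^ m, ?_⟩
    simp [aeval_aeval_X_zero, ← base_eq_aeval, hpq]

theorem exists_localizedLocus_eq_top (hdim : ringKrullDim A = 3)
    (hdiv : ∀ d, (∃ f ∈ primitive hρ d, f ≠ 0) → n ∣ d) (hf : f ∈ primitive hρ n) (hf0 : f ≠ 0)
    (h : IsSlice (lowering hρ) n R (base e X) f x) : ∃ g ≠ 0, localizedLocus e f x g = ⊤ := by
  obtain ⟨s, hs⟩ := (inferInstance : Algebra.FiniteType ℂ A).out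
  choose g hg0 hg using exists_mem_localizedLocus e hdim hdiv hf hf0 h
  refine ⟨∏ y ∈ s, g y, Finset.prod_ne_zero_iff.2 fun y _ => hg0 y, ?_⟩
  rw [eq_top_iff, ← hs]
  exact Algebra.adjoin_le fun y hy => localizedLocus_mono e (Finset.dvd_prod_of_mem g hy) (hg y)

omit [IsDomain A] [Algebra.FiniteType ℂ A] [IsIntegrallyClosed A] in
/-- If `f ^ m` is divisible by a function `c` on the base, then the zeros of `c` are zeros of
`g`. -/
theorem exists_dvd_pow (hind : AlgebraicIndependent ℂ ![base e X, f, x]) {g : ℂ[X]}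
    (hg : localizedLocus e f x g = ⊤) {m : ℕ} {c : ℂ[X]} {h : A} (hc : f ^ m = base e c * h) :
    ∃ M, c ∣ g ^ M := by
  obtain ⟨M, N, Q, h1⟩ : h ∈ localizedLocus e f x g := hg ▸ Algebra.mem_top
  refine ⟨M, ?_⟩
  have h2 : Polynomial.aeval (MvPolynomial.X 0) (g ^ M) * MvPolynomial.X 1 ^ (N + m) =
      Polynomial.aeval (MvPolynomial.X 0) c * Q := by
    refine hind ?_
    simp only [map_mul, map_pow, aeval_aeval_X_zero, ← base_eq_aeval, MvPolynomial.aeval_X, ← h1,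
      Matrix.cons_val_one, Matrix.cons_val_zero]
    rw [pow_add, hc]
    ring
  have h3 := congrArg (MvPolynomial.aeval ![(X : ℂ[X]), 1, 0]) h2
  simp only [map_mul, aeval_aeval_X_zero, Polynomial.aeval_X_left, AlgHom.id_apply,
    MvPolynomial.aeval_X, map_pow, Matrix.cons_val_one, Matrix.cons_val_zero, one_pow, mul_one] at h3
  exact ⟨_, h3⟩

omit [Algebra.FiniteType ℂ A] [IsIntegrallyClosed A] in
/-- A generator of the module of highest weight vectors of a given weight does not vanish on any
fiber. -/
theorem eval_eq_zero_of_mem_fiberIdeal {d : ℕ} {k : A} (hk : k ∈ primitive hρ d) (hk0 : k ≠ 0)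
    (hgen : ∀ h ∈ primitive hρ d, ∃ q, h = base e q * k) {a : ℂ} {r : ℂ[X]}
    (h : base e r * k ∈ fiberIdeal e a) : r.eval a = 0 := by
  obtain ⟨w, hw⟩ := Ideal.mem_span_singleton.1 h
  change base e r * k = base e (X - C a) * w at hw
  have hw' : w ∈ primitive hρ d := mem_primitive_of_mul (e := 0) (g := base e (X - C a))
    ((primitive_zero hρ).2 (base_mem e _)) (base_ne_zero e (X_sub_C_ne_zero a)) (by
      rw [mul_comm, ← hw, add_zero]
      exact base_mul_mem_primitive e r hk)
  obtain ⟨s, rfl⟩ := hgen w hw'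
  have h1 : r = (X - C a) * s := base_injective e (mul_right_cancel₀ hk0 (by
    rw [hw, map_mul]
    ring))
  rw [h1]
  simp

omit [IsDomain A] [Algebra.FiniteType ℂ A] [IsIntegrallyClosed A] in
theorem base_mem_fiberIdeal {a : ℂ} {p : ℂ[X]} (hp : p.eval a = 0) : base e p ∈ fiberIdeal e a := by
  obtain ⟨q, rfl⟩ := dvd_iff_isRoot.2 hp
  rw [map_mul]
  exact Ideal.mul_mem_right _ _ (Ideal.subset_span rfl)

omit [IsDomain A] [Algebra.FiniteType ℂ A] [IsIntegrallyClosed A] in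
theorem rho_mem_fiberIdeal {a : ℂ} (g : SL2) {y : A} (hy : y ∈ fiberIdeal e a) :
    ρ g y ∈ fiberIdeal e a := by
  obtain ⟨w, rfl⟩ := Ideal.mem_span_singleton.1 hy
  rw [map_mul]
  exact Ideal.mul_mem_right _ _ (Ideal.mem_span_singleton.2 ⟨1, by
    rw [mul_one]
    exact rho_base e g _⟩)

omit [IsDomain A] [Algebra.FiniteType ℂ A] [IsIntegrallyClosed A] in
theorem lowering_mem_fiberIdeal {a : ℂ} {y : A} (hy : y ∈ fiberIdeal e a) :
    lowering hρ y ∈ fiberIdeal e a :=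
  (polyFlow_lower hρ).gen_mem (N := (fiberIdeal e a).restrictScalars ℂ) fun _ =>
    rho_mem_fiberIdeal e _ hy

/-- The fibers outside the zeros of `g` are reduced: the ideal of nilpotent functions is
generated by highest weight vectors, and these generators are not nilpotent, since up to units of
the local ring of the base they are powers of `f`. -/
theorem isReduced_fiber (hdim : ringKrullDim A = 3)
    (hdiv : ∀ d, (∃ f ∈ primitive hρ d, f ≠ 0) → n ∣ d) (hf : f ∈ primitive hρ n)
    (hind : AlgebraicIndependent ℂ ![base e X, f, x]) {g : ℂ[X]}
    (hg : localizedLocus e f x g = ⊤) {b : ℂ} (hb : g.eval b ≠ 0) : IsReduced (Fiber e b) := by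
  rw [← Ideal.isRadical_iff_quotient_reduced]
  have hrad : ∀ s, ∀ y ∈ (fiberIdeal e b).radical, ρ s y ∈ (fiberIdeal e b).radical := by
    rintro s y ⟨l, hl⟩
    exact ⟨l, by rw [← map_pow]; exact rho_mem_fiberIdeal e s hl⟩
  intro y hy
  refine (Submodule.span_le (p := (fiberIdeal e b).restrictScalars ℂ)).2 ?_
    (mem_span_lowering_primitive hρ ((fiberIdeal e b).radical.restrictScalars ℂ) hrad hy)
  rintro _ ⟨i, d, v, ⟨l, hl⟩, hv, rfl⟩
  suffices v ∈ fiberIdeal e b by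
    clear hl
    induction i with
    | zero => exact this
    | succ i ih =>
      rw [Function.iterate_succ_apply']
      exact lowering_mem_fiberIdeal e ih
  by_cases hv0 : v = 0
  · rw [hv0]
    exact zero_mem _
  obtain ⟨m, rfl⟩ := hdiv d ⟨v, hv, hv0⟩
  rw [mul_comm] at hv
  obtain ⟨h, hh, hh0, hgen⟩ := exists_generator e hdim ⟨v, hv, hv0⟩
  obtain ⟨p, rfl⟩ := hgen v hv
  obtain ⟨c, hc⟩ := hgen _ (pow_mem_primitive hf m)
  have hhl := pow_mem_primitive hh l
  obtain ⟨k, hk, hk0, hgenk⟩ := exists_generator e hdim ⟨_, hhl, pow_ne_zero _ hh0⟩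
  obtain ⟨q, hq⟩ := hgenk _ hhl
  have h1 : f ^ (m * l) = base e (c ^ l * q) * k := by
    rw [pow_mul, hc, mul_pow, hq, map_mul, map_pow]
    ring
  obtain ⟨M, hM⟩ := exists_dvd_pow e hind hg h1
  have hqb : q.eval b ≠ 0 := by
    intro h0
    obtain ⟨w, hw⟩ := (dvd_mul_left q (c ^ l)).trans hM
    have h2 := congrArg (eval b) hw
    rw [eval_pow, eval_mul, h0, zero_mul] at h2
    exact pow_ne_zero _ hb h2
  have h3 : (p ^ l * q).eval b = 0 := eval_eq_zero_of_mem_fiberIdeal e hk hk0 hgenk (by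
    rw [map_mul, mul_assoc, ← hq, map_pow, ← mul_pow]
    exact hl)
  rw [eval_mul, eval_pow] at h3
  have hp : p.eval b = 0 := eq_zero_of_pow_eq_zero ((mul_eq_zero.1 h3).resolve_right hqb)
  exact Ideal.mul_mem_right _ _ (base_mem_fiberIdeal e hp)

omit [Algebra.FiniteType ℂ A] [IsIntegrallyClosed A] in
/-- If all fibers are reduced, then no power of `f` vanishes on a fiber. -/
theorem isUnit_of_pow_eq (hred : ∀ a, IsReduced (Fiber e a)) (hf : f ∈ primitive hρ n) (hf0 : f ≠ 0)
    (hgen : ∀ h ∈ primitive hρ n, ∃ q, h = base e q * f) {m : ℕ} {c : ℂ[X]} {h : A}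
    (hc : f ^ m = base e c * h) : IsUnit c := by
  by_contra hu
  have hdeg : c.degree ≠ 0 := by
    intro h0
    exact hu (isUnit_iff_degree_eq_zero.2 h0)
  obtain ⟨a, ha⟩ := IsAlgClosed.exists_root c hdeg
  have h1 : f ∈ (fiberIdeal e a).radical := ⟨m, by
    rw [hc]
    exact Ideal.mul_mem_right _ _ (base_mem_fiberIdeal e ha)⟩
  have h2 : f ∈ fiberIdeal e a := (Ideal.isRadical_iff_quotient_reduced _).2 (hred a) h1
  have h3 := eval_eq_zero_of_mem_fiberIdeal e hf hf0 hgen (a := a) (r := 1) (by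
    rwa [map_one, one_mul])
  simp at h3

/-- If all fibers over `ℂ \ {0}` are isomorphic and the fiber over `0` is reduced, then `A` has a
presentation. -/
theorem exists_presentation (hdim : ringKrullDim A = 3) (hred : IsReduced (Fiber e 0))
    (hiso : ∀ a b : ℂ, a ≠ 0 → b ≠ 0 → Nonempty (Fiber e a ≃ₐ[ℂ] Fiber e b)) :
    ∃ (n : ℕ) (R : MvPolynomial (Fin 3) ℂ) (f x : A),
      Presentation ρ (polyFlow_lower hρ) n R (base e X) f x ∧ raising hρ x = f ∧
      (R = 0 ∨ (n = 2 ∧ ∃ α : ℂ[X], R = Polynomial.aeval (MvPolynomial.X 0) α) ∨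
        (n = 4 ∧ ∃ α : ℂ[X], R = Polynomial.aeval (MvPolynomial.X 0) α * MvPolynomial.X 1)) := by
  obtain ⟨n, hn, hex, hdiv⟩ := exists_weight_generator (hρ := hρ) e hdim
  obtain ⟨f, hf, hf0, hgen⟩ := exists_generator e hdim hex
  obtain ⟨R, hR, hRcases⟩ := exists_isSlice e hn hdiv hf hgen
  have hn0 : (n : ℂ) ≠ 0 := Nat.cast_ne_zero.2 hn.ne'
  set x := (n : ℂ)⁻¹ • lowering hρ f with hx
  have hEx : raising hρ x = f := by
    rw [hx, Derivation.map_smul, raising_lowering_primitive hf, smul_smul, inv_mul_cancel₀ hn0,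
      one_smul]
  have hfU := upper_primitive hρ hf
  have hfT : ∀ z, ρ (torus z) f = ((z : ℂ) ^ n) • f := fun z => by
    rw [(mem_primitive.1 hf).1 z, zpow_natCast]
  have hxU : ∀ s, ρ (upper s) x = x + s • f := fun s => by
    rw [hx, map_smul, upper_lowering_primitive hf, smul_add, smul_comm, smul_smul (n : ℂ)⁻¹,
      inv_mul_cancel₀ hn0, one_smul]
  have hfreg : f ∈ nonZeroDivisors A := mem_nonZeroDivisors_of_ne_zero hf0
  have hind := Presentation.algebraicIndependent_of_weights hn (fun g => rho_base e g X)
    (transcendental_base_X e) hfU hfT hfreg hxU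
  obtain ⟨g, hg0, hg⟩ := exists_localizedLocus_eq_top e hdim hdiv hf hf0 hR
  obtain ⟨b, hb⟩ : ∃ b, (X * g).eval b ≠ 0 := by
    by_contra! h0
    exact mul_ne_zero X_ne_zero hg0 (Polynomial.funext fun b => by rw [h0, eval_zero])
  rw [eval_mul, eval_X, mul_ne_zero_iff] at hb
  have hredb := isReduced_fiber e hdim hdiv hf hind hg hb.2
  have hreda : ∀ a, IsReduced (Fiber e a) := by
    intro a
    by_cases ha : a = 0
    · rw [ha]
      exact hred
    · obtain ⟨φ⟩ := hiso a b ha hb.1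
      exact isReduced_of_injective φ φ.injective
  refine ⟨n, R, f, x, ⟨hn, fun g => rho_base e g X, transcendental_base_X e, hfU, hfT, hfreg, hxU, hR,
    ?_⟩, hEx, hRcases⟩
  set s := insert (base e X) (Set.range fun i => (lowering hρ)^[i] f) with hs
  have hbase : ∀ p, base e p ∈ Algebra.adjoin ℂ s := fun p => by
    rw [base_eq_aeval]
    exact Algebra.adjoin_mono (Set.singleton_subset_iff.2 (Set.mem_insert _ _))
      (aeval_mem_adjoin_singleton ℂ _)
  rw [eq_top_iff]
  rintro y -
  refine mem_of_primitive_mem hρ (Subalgebra.toSubmodule (Algebra.adjoin ℂ s)) ?_ ?_ y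
  · refine fun y hy => map_mem_adjoin (lowering hρ) ?_ hy
    rintro _ (rfl | ⟨i, rfl⟩)
    · rw [lowering_base]
      exact zero_mem _
    · refine Algebra.subset_adjoin (Or.inr ⟨i + 1, ?_⟩)
      exact Function.iterate_succ_apply' _ _ _
  · intro d v hv
    by_cases hv0 : v = 0
    · rw [hv0]
      exact zero_mem _
    obtain ⟨m, rfl⟩ := hdiv d ⟨v, hv, hv0⟩
    rw [mul_comm] at hv
    obtain ⟨h, hh, -, hgenh⟩ := exists_generator e hdim ⟨v, hv, hv0⟩
    obtain ⟨c, hc⟩ := hgenh _ (pow_mem_primitive hf m)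
    obtain ⟨q, rfl⟩ := hgenh v hv
    obtain ⟨w, hw⟩ := (isUnit_of_pow_eq e hreda hf hf0 hgen hc).exists_left_inv
    have h1 : base e q * h = base e (q * w) * f ^ m := by
      rw [hc, ← mul_assoc, ← map_mul, mul_assoc q, hw, mul_one]
    rw [h1]
    exact (Algebra.adjoin ℂ s).mul_mem (hbase _) ((Algebra.adjoin ℂ s).pow_mem (Algebra.subset_adjoin (Or.inr ⟨0, rfl⟩)) m)

end Analysis

/-! ### Common zeros of the vector fields on a fiber -/

/-- There is a point at which all algebraic vector fields vanish. -/
def HasFixedPoint (B : Type*) [CommRing B] [Algebra ℂ B] : Prop :=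
  ∃ χ : B →ₐ[ℂ] ℂ, ∀ (D : Derivation ℂ B B) (b : B), χ (D b) = 0

theorem HasFixedPoint.of_algEquiv {B B' : Type*} [CommRing B] [Algebra ℂ B] [CommRing B']
    [Algebra ℂ B'] (φ : B ≃ₐ[ℂ] B') (h : HasFixedPoint B) : HasFixedPoint B' := by
  obtain ⟨χ, hχ⟩ := h
  refine ⟨χ.comp φ.symm.toAlgHom, fun D b => ?_⟩
  let D' : Derivation ℂ B B := Derivation.mk'
    (φ.symm.toLinearMap ∘ₗ (D : B' →ₗ[ℂ] B') ∘ₗ φ.toLinearMap) (fun a b => by simp)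
  have h1 : D' (φ.symm b) = φ.symm (D b) := by
    change φ.symm (D (φ (φ.symm b))) = _
    rw [φ.apply_symm_apply]
  have h2 := hχ D' (φ.symm b)
  rwa [h1] at h2

/-- The scalar equation satisfied by the elements `f` and `x` of a presentation: the polynomial `R`
is `α(T)` if `n = 2`, and `α(T) Y` if `n = 4`. -/
def IsRelation (n : ℕ) (R : MvPolynomial (Fin 3) ℂ) (α : ℂ[X]) : Prop :=
  (n = 2 ∧ R = Polynomial.aeval (MvPolynomial.X 0) α) ∨
    (n = 4 ∧ R = Polynomial.aeval (MvPolynomial.X 0) α * MvPolynomial.X 1)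

section

variable {A : Type*} [CommRing A] [Algebra ℂ A] {ρ : Action A} {hρ : IsAlgebraicAction ρ}
  {e : ℂ[X] ≃ₐ[ℂ] invariants ρ} {n : ℕ} {R : MvPolynomial (Fin 3) ℂ} {f x : A}

theorem isSlice_cone {n : ℕ} (hn : 2 ≤ n) {R : MvPolynomial (Fin 3) ℂ}
    {t : MvPolynomial (Fin 2) ℂ} {F : Derivation ℂ (MvPolynomial (Fin 2) ℂ) (MvPolynomial (Fin 2) ℂ)}
    (ht : F t = 0) (hF0 : F (MvPolynomial.X 0) = MvPolynomial.X 1) (hF1 : F (MvPolynomial.X 1) = 0)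
    (hR : MvPolynomial.aeval ![t, MvPolynomial.X 0 ^ n, MvPolynomial.X 0 ^ (n - 1) * MvPolynomial.X 1]
      R = 0) :
    IsSlice F n R t (MvPolynomial.X 0 ^ n) (MvPolynomial.X 0 ^ (n - 1) * MvPolynomial.X 1) where
  map_t := ht
  map_f := by
    rw [Derivation.leibniz_pow, hF0]
    simp
  map_x := by
    obtain ⟨n, rfl⟩ := Nat.exists_eq_add_of_le' hn
    rw [hR, Derivation.leibniz, Derivation.leibniz_pow, hF0, hF1]
    simp
    ring

/-- The derivation of the fiber induced by a derivation that annihilates the invariants. -/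
theorem exists_derivation_fiber (e : ℂ[X] ≃ₐ[ℂ] invariants ρ) (D : Derivation ℂ A A)
    (hD : ∀ p, D (base e p) = 0) (a : ℂ) : ∃ D' : Derivation ℂ (Fiber e a) (Fiber e a),
      ∀ y, D' (Ideal.Quotient.mkₐ ℂ (fiberIdeal e a) y) =
        Ideal.Quotient.mkₐ ℂ (fiberIdeal e a) (D y) := by
  have h0 : ∀ y, Ideal.Quotient.mkₐ ℂ (fiberIdeal e a) y = 0 →
      Ideal.Quotient.mkₐ ℂ (fiberIdeal e a) (D y) = 0 := by
    intro y hy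
    rw [Ideal.Quotient.mkₐ_eq_mk, Ideal.Quotient.eq_zero_iff_mem] at hy ⊢
    obtain ⟨w, rfl⟩ := Ideal.mem_span_singleton.1 hy
    have h1 : D (e (X - C a) : A) = 0 := hD _
    rw [Derivation.leibniz, h1, smul_zero, add_zero, smul_eq_mul]
    exact Ideal.mul_mem_right _ _ (Ideal.subset_span rfl)
  exact ⟨Derivation.liftOfSurjective (Ideal.Quotient.mkₐ_surjective ℂ _) h0,
    Derivation.liftOfSurjective_apply (Ideal.Quotient.mkₐ_surjective ℂ _) h0⟩

theorem mk_base (a : ℂ) (p : ℂ[X]) :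
    Ideal.Quotient.mkₐ ℂ (fiberIdeal e a) (base e p) = algebraMap ℂ (Fiber e a) (p.eval a) := by
  have h1 : Ideal.Quotient.mkₐ ℂ (fiberIdeal e a) (base e (p - C (p.eval a))) = 0 := by
    rw [Ideal.Quotient.mkₐ_eq_mk, Ideal.Quotient.eq_zero_iff_mem]
    exact base_mem_fiberIdeal e (by simp)
  rw [map_sub, map_sub, sub_eq_zero] at h1
  rw [h1, ← Polynomial.algebraMap_eq, AlgHom.commutes, AlgHom.commutes]

/-- Over a zero of `α`, the fiber is an affine cone, and its vertex is fixed by all vector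
fields. -/
theorem hasFixedPoint_fiber (h : Presentation ρ (polyFlow_lower hρ) n R (base e X) f x) {α : ℂ[X]}
    (hR : IsRelation n R α) {a : ℂ} (ha : α.eval a = 0) : HasFixedPoint (Fiber e a) := by
  have hn : 2 ≤ n := by
    rcases hR with ⟨rfl, -⟩ | ⟨rfl, -⟩ <;> norm_num
  have hRt : ∀ y z : MvPolynomial (Fin 2) ℂ,
      MvPolynomial.aeval ![MvPolynomial.C a, y, z] R = 0 := by
    have h1 : Polynomial.aeval (MvPolynomial.C (σ := Fin 2) a) α = 0 := by
      rw [← MvPolynomial.algebraMap_eq, Polynomial.aeval_algebraMap_apply,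
        Polynomial.coe_aeval_eq_eval, ha, map_zero]
    intro y z
    rcases hR with ⟨-, rfl⟩ | ⟨-, rfl⟩
    · rw [aeval_aeval_X_zero, h1]
    · rw [map_mul, aeval_aeval_X_zero, h1, zero_mul]
  -- The fiber maps to the ring of functions on the plane, which covers the cone.
  set F' : Derivation ℂ (MvPolynomial (Fin 2) ℂ) (MvPolynomial (Fin 2) ℂ) :=
    (MvPolynomial.X 1 : MvPolynomial (Fin 2) ℂ) • MvPolynomial.pderiv 0 with hF'
  have hslice := isSlice_cone hn (F := F') (t := MvPolynomial.C a) (R := R)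
    (by simp [hF']) (by simp [hF']) (by simp [hF']) (hRt _ _)
  obtain ⟨φ, hφt, hφf, hφF⟩ := h.isSlice.exists_algHom hslice h.algebraicIndependent h.generates
    (mem_nonZeroDivisors_of_ne_zero (pow_ne_zero _ (MvPolynomial.X_ne_zero 0)))
  have hφx : φ x = MvPolynomial.X 0 ^ (n - 1) * MvPolynomial.X 1 := by
    have h1 := congrArg φ h.isSlice.map_f
    rw [hφF, hφf, hslice.map_f, map_mul, map_natCast] at h1
    exact (mul_left_cancel₀ (Nat.cast_ne_zero.2 h.pos.ne') h1).symm
  have hφ0 : ∀ y ∈ fiberIdeal e a, φ y = 0 := by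
    intro y hy
    obtain ⟨w, rfl⟩ := Ideal.mem_span_singleton.1 hy
    have h1 : φ (base e (X - C a)) = 0 := by
      rw [map_sub, map_sub, hφt, ← Polynomial.algebraMap_eq, AlgHom.commutes, AlgHom.commutes,
        MvPolynomial.algebraMap_eq, sub_self]
    rw [map_mul]
    exact mul_eq_zero_of_left h1 _
  set π := Ideal.Quotient.mkₐ ℂ (fiberIdeal e a) with hπ
  set φ' : Fiber e a →ₐ[ℂ] MvPolynomial (Fin 2) ℂ := Ideal.Quotient.liftₐ _ φ hφ0
  have hφ' : ∀ y, φ' (π y) = φ y := fun y => rfl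
  set ψ : MvPolynomial (Fin 2) ℂ →ₐ[ℂ] ℂ[X] := MvPolynomial.aeval ![0, X] with hψ
  obtain ⟨F, hF⟩ := exists_derivation_fiber e (lowering hρ) (lowering_base e hρ) a
  have hsurj : Function.Surjective π := Ideal.Quotient.mkₐ_surjective ℂ _
  have hFF' : ∀ b, φ' (F b) = F' (φ' b) := by
    intro b
    obtain ⟨y, rfl⟩ := hsurj b
    rw [hF, hφ', hφ', hφF]
  set χ : Fiber e a →ₐ[ℂ] ℂ := ((Polynomial.aeval 0).comp ψ).comp φ' with hχ
  have hχF : ∀ b, χ (F b) = 0 := by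
    intro b
    simp [hχ, hFF', hF', hψ]
  -- Apply `D` to the equation of the cone, divide by `u ^ (n - 2)`, and restrict to the line `u = 0`.
  have hDf : ∀ D : Derivation ℂ (Fiber e a) (Fiber e a), χ (D (π f)) = 0 := by
    intro D
    have h1 : π f * F (π x) = (n - 1) * π x ^ 2 := by
      have h2 := congrArg π h.isSlice.map_x
      rw [map_mul, map_add, map_mul, map_sub, map_natCast, map_one, map_pow] at h2
      rw [hF]
      refine h2.trans (add_eq_left.2 ?_)
      rcases hR with ⟨-, rfl⟩ | ⟨-, rfl⟩ <;>
        simp [aeval_aeval_X_zero, ← base_eq_aeval, hπ, mk_base, ha, -Ideal.Quotient.mkₐ_eq_mk]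
    have h2 : ((n : Fiber e a) - 1) = ((n - 1 : ℤ) : Fiber e a) := by push_cast; rfl
    have h3 := congrArg φ' (congrArg D h1)
    rw [h2, ← zsmul_eq_mul, map_zsmul, zsmul_eq_mul, Derivation.leibniz, Derivation.leibniz_pow] at h3
    obtain ⟨m, rfl⟩ := Nat.exists_eq_add_of_le' hn
    simp only [smul_eq_mul, nsmul_eq_mul, map_add, map_mul, map_intCast, map_natCast, map_pow, hφ',
      hφf, hφx, hFF', hF', Derivation.smul_apply, Derivation.leibniz, Derivation.leibniz_pow,
      MvPolynomial.pderiv_X_self, MvPolynomial.pderiv_X_of_ne (one_ne_zero (α := Fin 2))] at h3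
    set p := φ' (D (π f))
    set q := φ' (D (F (π x)))
    set r := φ' (D (π x))
    have h4 : MvPolynomial.X 0 ^ 2 * q + ((m : MvPolynomial (Fin 2) ℂ) + 1) * MvPolynomial.X 1 ^ 2 * p =
        2 * ((m : MvPolynomial (Fin 2) ℂ) + 1) * MvPolynomial.X 0 * MvPolynomial.X 1 * r := by
      refine mul_left_cancel₀ (pow_ne_zero m (MvPolynomial.X_ne_zero (R := ℂ) (0 : Fin 2))) ?_
      push_cast [Nat.add_sub_cancel, show m + 2 - 1 = m + 1 by omega] at h3
      linear_combination h3
    have h5 := congrArg ψ h4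
    simp only [hψ, map_add, map_mul, map_pow, MvPolynomial.aeval_X, Matrix.cons_val_zero,
      Matrix.cons_val_one, map_natCast, map_one, map_ofNat] at h5
    have h6 : ((m : ℂ[X]) + 1) * X ^ 2 * ψ p = 0 := by linear_combination h5
    have h7 : ((m : ℂ[X]) + 1) ≠ 0 := by exact_mod_cast m.succ_ne_zero
    have h8 : ψ p = 0 := (mul_eq_zero.1 h6).resolve_left (mul_ne_zero h7 (pow_ne_zero _ X_ne_zero))
    change Polynomial.aeval 0 (ψ p) = 0
    rw [h8, map_zero]
  have hiter : ∀ i (D : Derivation ℂ (Fiber e a) (Fiber e a)),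
      χ (D (π ((lowering hρ)^[i] f))) = 0 := by
    intro i
    induction i with
    | zero => exact hDf
    | succ i ih =>
      intro D
      have h1 := ih ⁅D, F⁆
      rwa [Derivation.commutator_apply, map_sub, hχF, sub_zero, hF,
        ← Function.iterate_succ_apply' (lowering hρ)] at h1
  refine ⟨χ, fun D b => ?_⟩
  obtain ⟨y, rfl⟩ := hsurj b
  have hy : y ∈ Algebra.adjoin ℂ (insert (base e X) (Set.range fun i => (lowering hρ)^[i] f)) :=
    h.generates ▸ Algebra.mem_top
  induction hy using Algebra.adjoin_induction with
  | mem y hy =>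
    rcases hy with rfl | ⟨i, rfl⟩
    · rw [mk_base, Derivation.map_algebraMap, map_zero]
    · exact hiter i D
  | algebraMap c => rw [AlgHom.commutes, Derivation.map_algebraMap, map_zero]
  | add y z _ _ hy hz => rw [map_add, map_add, map_add, hy, hz, add_zero]
  | mul y z _ _ hy hz =>
    rw [map_mul, Derivation.leibniz, smul_eq_mul, smul_eq_mul, map_add, map_mul, map_mul, hy, hz,
      mul_zero, mul_zero, add_zero]

/-- Outside the zeros of `α`, the action on the fiber has no fixed point. -/
theorem not_hasFixedPoint_fiber [IsDomain A]
    (h : Presentation ρ (polyFlow_lower hρ) n R (base e X) f x) (hE : raising hρ x = f) {α : ℂ[X]}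
    (hR : IsRelation n R α) {a : ℂ} (ha : α.eval a ≠ 0) : ¬ HasFixedPoint (Fiber e a) := by
  rintro ⟨χ, hχ⟩
  refine ha ?_
  obtain ⟨F, hF⟩ := exists_derivation_fiber e (lowering hρ) (lowering_base e hρ) a
  obtain ⟨E, hE'⟩ := exists_derivation_fiber e (raising hρ) (raising_base e hρ) a
  set π := Ideal.Quotient.mkₐ ℂ (fiberIdeal e a)
  have hχF : ∀ y, χ (π (lowering hρ y)) = 0 := fun y => by rw [← hF, hχ]
  have hf : χ (π f) = 0 := by rw [← hE, ← hE', hχ]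
  have hx : χ (π x) = 0 := by
    have h1 := hχF f
    rw [h.isSlice.map_f, map_mul, map_mul, map_natCast, map_natCast] at h1
    exact (mul_eq_zero.1 h1).resolve_left (Nat.cast_ne_zero.2 h.pos.ne')
  have hα : χ (π (base e α)) = α.eval a := by rw [mk_base]; exact χ.commutes _
  rw [← hα]
  have hslice := h.isSlice
  rcases hR with ⟨rfl, rfl⟩ | ⟨rfl, rfl⟩
  · have h1 := hslice.map_x
    rw [aeval_aeval_X_zero, ← base_eq_aeval] at h1
    have h2 : base e α = f * lowering hρ x - x ^ 2 := by
      linear_combination -h1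
    rw [h2, map_sub, map_sub, map_mul, map_mul, map_pow, map_pow, hf, hx]
    simp
  · have hf0 : f ≠ 0 := nonZeroDivisors.ne_zero h.f_regular
    have h1 := hslice.map_x
    have hFf := hslice.map_f
    rw [map_mul, aeval_aeval_X_zero, ← base_eq_aeval, MvPolynomial.aeval_X] at h1
    change f * lowering hρ x = (4 - 1) * x ^ 2 + base e α * f at h1
    change lowering hρ f = 4 * x at hFf
    set w := lowering hρ x with hw
    have h2 : f * lowering hρ w = 2 * x * w + 4 * base e α * x := by
      have h3 := congrArg (lowering hρ) (show f * w = 3 • x ^ 2 + base e α * f by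
        rw [h1, nsmul_eq_mul]; norm_num)
      rw [map_add, map_nsmul, Derivation.leibniz, Derivation.leibniz, Derivation.leibniz_pow,
        lowering_base, hFf, ← hw] at h3
      simp only [smul_eq_mul, nsmul_eq_mul, mul_zero, add_zero] at h3
      push_cast at h3
      linear_combination h3
    have h4 : 8 * base e α ^ 2 = 4 * w ^ 2 - 6 * (x * lowering hρ w) + 4 * (base e α * w) := by
      refine mul_left_cancel₀ hf0 ?_
      linear_combination 6 * x * h2 - (4 * w + 8 * base e α) * h1
    have h5 := congrArg (fun b => χ (π b)) h4
    simp only [map_add, map_sub, map_mul, map_pow, hχF, hw, map_ofNat] at h5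
    simpa using h5

/-- The fibers over `ℂ \ {0}` being isomorphic, `α` has no zeros there, unless `α = 0`. -/
theorem eq_zero_or_eq_mul_X_pow [IsDomain A]
    (h : Presentation ρ (polyFlow_lower hρ) n R (base e X) f x) (hE : raising hρ x = f) {α : ℂ[X]}
    (hR : IsRelation n R α)
    (hiso : ∀ a b : ℂ, a ≠ 0 → b ≠ 0 → Nonempty (Fiber e a ≃ₐ[ℂ] Fiber e b)) :
    α = 0 ∨ ∃ (c : ℂ) (k : ℕ), c ≠ 0 ∧ α = C c * X ^ k := by
  by_cases hex : ∃ a ≠ 0, α.eval a = 0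
  · left
    obtain ⟨a, ha0, ha⟩ := hex
    refine eq_zero_of_infinite_isRoot α (infinite_ne_zero.mono fun b hb => ?_)
    by_contra hb'
    obtain ⟨φ⟩ := hiso a b ha0 hb
    exact not_hasFixedPoint_fiber (hρ := hρ) h hE hR hb' ((hasFixedPoint_fiber (hρ := hρ) h hR ha).of_algEquiv φ)
  · by_cases h0 : α = 0
    · exact Or.inl h0
    right
    push Not at hex
    obtain ⟨q, hq, hdvd⟩ := exists_eq_pow_rootMultiplicity_mul_and_not_dvd α h0 0
    rw [map_zero, sub_zero] at hq hdvd
    have hroot : ∀ b, q.eval b ≠ 0 := by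
      intro b hb
      by_cases hb0 : b = 0
      · rw [hb0, ← coeff_zero_eq_eval_zero] at hb
        exact hdvd (X_dvd_iff.2 hb)
      · exact hex b hb0 (by rw [hq, eval_mul, hb, mul_zero])
    have hdeg : q.degree = 0 := by
      by_contra hdeg
      obtain ⟨b, hb⟩ := IsAlgClosed.exists_root q hdeg
      exact hroot b hb
    rw [eq_C_of_degree_eq_zero hdeg] at hq hroot
    refine ⟨q.coeff 0, α.rootMultiplicity 0, ?_, ?_⟩
    · simpa using hroot 0
    · rw [mul_comm]
      exact hq

end

/-- Rescaling the highest weight vector. -/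
theorem Presentation.smul {A : Type*} [CommRing A] [Algebra ℂ A] {ρ : Action A}
    {hF : PolyFlow fun y => ρ (lower y)} {n : ℕ} {R R' : MvPolynomial (Fin 3) ℂ} {t f x : A}
    (h : Presentation ρ hF n R t f x) {c : ℂ} (hc : c ≠ 0)
    (hR : MvPolynomial.aeval ![t, c • f, c • x] R' = c ^ 2 • MvPolynomial.aeval ![t, f, x] R) :
    Presentation ρ hF n R' t (c • f) (c • x) where
  pos := h.pos
  t_inv := h.t_inv
  t_transcendental := h.t_transcendental
  f_upper s := by rw [map_smul, h.f_upper]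
  f_torus z := by rw [map_smul, h.f_torus, smul_comm]
  f_regular := by
    rw [Algebra.smul_def]
    exact mul_mem ((IsUnit.mk0 c hc).map (algebraMap ℂ A)).mem_nonZeroDivisors h.f_regular
  x_upper s := by rw [map_smul, h.x_upper, smul_add, smul_comm]
  isSlice :=
    { map_t := h.isSlice.map_t
      map_f := by rw [Derivation.map_smul, h.isSlice.map_f, mul_smul_comm]
      map_x := by
        rw [Derivation.map_smul, smul_mul_smul_comm, h.isSlice.map_x, hR, smul_add, _root_.smul_pow,
          mul_smul_comm, pow_two c] }
  generates := by
    rw [eq_top_iff, ← h.generates]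
    refine Algebra.adjoin_le ?_
    rintro _ (rfl | ⟨i, rfl⟩)
    · exact Algebra.subset_adjoin (Or.inl rfl)
    · have h1 : hF.gen^[i] f = c⁻¹ • hF.gen^[i] (c • f) := by
        rw [hF.gen_iterate, hF.gen_iterate, hF.orbit_smul, coeff_smul, mul_smul_comm, smul_smul,
          inv_mul_cancel₀ hc, one_smul]
      change hF.gen^[i] f ∈ Algebra.adjoin ℂ (insert t (Set.range fun i => hF.gen^[i] (c • f)))
      rw [h1]
      refine Subalgebra.smul_mem _ ?_ _
      exact Algebra.subset_adjoin (Or.inr ⟨i, rfl⟩)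

theorem Presentation.exists_normalized {A : Type*} [CommRing A] [Algebra ℂ A] {ρ : Action A}
    {hF : PolyFlow fun y => ρ (lower y)} {n : ℕ} {R : MvPolynomial (Fin 3) ℂ} {t f x : A}
    (h : Presentation ρ hF n R t f x) {c : ℂ} (hc : c ≠ 0) {p : ℂ[X]} (hR : IsRelation n R (C c * p))
    {d : ℂ} (hd : d ≠ 0) :
    ∃ R' f' x', Presentation ρ hF n R' t f' x' ∧ IsRelation n R' (C d * p) := by
  rcases hR with ⟨rfl, rfl⟩ | ⟨rfl, rfl⟩
  · obtain ⟨l, hl⟩ := IsAlgClosed.exists_pow_nat_eq (d / c) (n := 2) (by norm_num)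
    have hl0 : l ≠ 0 := by
      rintro rfl
      exact div_ne_zero hd hc (by rw [← hl]; norm_num)
    refine ⟨_, _, _, h.smul hl0 (R' := Polynomial.aeval (MvPolynomial.X 0) (C d * p)) ?_,
      Or.inl ⟨rfl, rfl⟩⟩
    rw [aeval_aeval_X_zero, aeval_aeval_X_zero, hl, ← map_smul, smul_eq_C_mul, ← mul_assoc, ← map_mul,
      div_mul_cancel₀ _ hc]
  · refine ⟨_, _, _, h.smul (div_ne_zero hd hc)
      (R' := Polynomial.aeval (MvPolynomial.X 0) (C d * p) * MvPolynomial.X 1) ?_,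
      Or.inr ⟨rfl, rfl⟩⟩
    rw [map_mul (MvPolynomial.aeval _), map_mul (MvPolynomial.aeval _), aeval_aeval_X_zero,
      aeval_aeval_X_zero, MvPolynomial.aeval_X, MvPolynomial.aeval_X]
    change _ * ((d / c) • f) = _ • (_ * f)
    have h1 : Polynomial.aeval t (C d * p) = (d / c) • Polynomial.aeval t (C c * p) := by
      rw [← map_smul, smul_eq_C_mul, ← mul_assoc, ← map_mul, div_mul_cancel₀ _ hc]
    rw [h1, mul_smul_comm, smul_mul_assoc, smul_smul, pow_two]

/-! ### Flows on the models -/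

section

variable {A : Type*} [CommRing A] [Algebra ℂ A]

theorem polyFlow_of_adjoin (ρ : Action A) {s : Set A} (hs : Algebra.adjoin ℂ s = ⊤)
    (h : ∀ a ∈ s, ∃ p : A[X], ∀ y, ρ (lower y) a = p.eval (algebraMap ℂ A y)) :
    PolyFlow fun y => ρ (lower y) where
  add x y a := by rw [lower_add, map_mul]; rfl
  zero a := by rw [lower_zero, map_one]; rfl
  poly a := by
    have h1 : Algebra.adjoin ℂ s ≤ polynomialLocus fun y => ρ (lower y) := Algebra.adjoin_le h
    rw [hs] at h1
    exact h1 Algebra.mem_top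

variable {ρ : Action A} (h : PolyFlow fun y => ρ (lower y))
include h

theorem polyFlow_subalgebra (S : Subalgebra ℂ A) (hS : ∀ g, ∀ f ∈ S, ρ g f ∈ S) :
    PolyFlow fun y => subalgebraAction ρ S hS (lower y) where
  add x y a := by rw [lower_add, map_mul]; rfl
  zero a := by rw [lower_zero, map_one]; rfl
  poly a := by
    have h1 : ∀ k, (h.orbit a.1).coeff k ∈ Set.range (S.val : S →+* A) := fun k =>
      ⟨⟨_, coeff_mem_of_eval_mem (Subalgebra.toSubmodule S) (h.orbit a.1) Set.infinite_univ
        (fun y _ => by rw [h.eval_orbit]; exact hS _ _ a.2) k⟩, rfl⟩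
    obtain ⟨q, hq⟩ := (mem_lifts _).1 ((lifts_iff_coeff_lifts _).2 h1)
    refine ⟨q, fun y => Subtype.ext ?_⟩
    change ρ (lower y) a = (S.val : S →+* A) _
    rw [← h.eval_orbit, ← hq, ← eval₂_at_apply, eval_map]
    rfl

theorem polyFlow_timesLine : PolyFlow fun y => timesLine ρ (lower y) where
  add x y a := by rw [lower_add, map_mul]; rfl
  zero a := by rw [lower_zero, map_one]; rfl
  poly a := by
    suffices a ∈ polynomialLocus fun y => timesLine ρ (lower y) from this
    have hX : X ∈ polynomialLocus fun y => timesLine ρ (lower y) :=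
      ⟨C X, fun y => by simp [timesLine]⟩
    have hC : ∀ b, C b ∈ polynomialLocus fun y => timesLine ρ (lower y) := fun b =>
      ⟨(h.orbit b).map C, fun y => by
        have h1 : algebraMap ℂ A[X] y = C (algebraMap ℂ A y) := rfl
        rw [h1, eval_map, eval₂_at_apply, h.eval_orbit]
        simp [timesLine]⟩
    induction a using Polynomial.induction_on' with
    | add p q hp hq => exact add_mem hp hq
    | monomial k b =>
      rw [← C_mul_X_pow_eq_monomial]
      exact mul_mem (hC b) (pow_mem hX k)

theorem polyFlow_quotient (I : Ideal A) (hI : ∀ g, I ≤ I.comap (ρ g)) :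
    PolyFlow fun y => quotientAction ρ I hI (lower y) where
  add x y a := by rw [lower_add, map_mul]; rfl
  zero a := by rw [lower_zero, map_one]; rfl
  poly a := by
    obtain ⟨b, rfl⟩ := Ideal.Quotient.mk_surjective a
    refine ⟨(h.orbit b).map (Ideal.Quotient.mk I), fun y => ?_⟩
    have h1 : algebraMap ℂ (A ⧸ I) y = Ideal.Quotient.mk I (algebraMap ℂ A y) := rfl
    rw [h1, eval_map, eval₂_at_apply, h.eval_orbit]
    rfl

end

theorem timesLine_C {A : Type*} [CommRing A] [Algebra ℂ A] (ρ : Action A) (g : SL2) (a : A) :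
    timesLine ρ g (C a) = C (ρ g a) := by simp [timesLine]

theorem timesLine_X {A : Type*} [CommRing A] [Algebra ℂ A] (ρ : Action A) (g : SL2) :
    timesLine ρ g X = X := by simp [timesLine]

theorem lower_inv (y : ℂ) : (lower y)⁻¹ = lower (-y) :=
  inv_eq_of_mul_eq_one_left (by rw [← lower_add, add_neg_cancel, lower_zero])

theorem upper_inv (y : ℂ) : (upper y)⁻¹ = upper (-y) :=
  inv_eq_of_mul_eq_one_left (by rw [← upper_add, add_neg_cancel, upper_zero])

theorem torus_inv (z : ℂˣ) : (torus z)⁻¹ = torus z⁻¹ := by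
  refine inv_eq_of_mul_eq_one_left ?_
  rw [← torus_mul, inv_mul_cancel]
  ext i j; fin_cases i <;> fin_cases j <;> simp

theorem linearAction_X {m : ℕ} (τ : SL2 →* Matrix (Fin m) (Fin m) ℂ) (g : SL2) (i : Fin m) :
    linearAction τ g (MvPolynomial.X i) = ∑ j, τ g⁻¹ i j • MvPolynomial.X j := by
  simp [linearAction, subst, MvPolynomial.smul_eq_C_mul]

theorem transcendental_X_of_nontrivial {A : Type*} [CommRing A] [Algebra ℂ A] [Nontrivial A] :
    Transcendental ℂ (X : A[X]) := by
  rw [transcendental_iff]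
  intro p hp
  have h1 : p.map (algebraMap ℂ A) = 0 := hp
  exact (Polynomial.map_eq_zero_iff (algebraMap ℂ A).injective).1 h1

/-! ### The product of a cone with a line -/

theorem standardRep_X0 (g : SL2) : linearAction standardRep g (MvPolynomial.X 0) =
    g⁻¹.1 0 0 • MvPolynomial.X 0 + g⁻¹.1 0 1 • MvPolynomial.X 1 := by
  rw [linearAction_X, Fin.sum_univ_two]
  rfl

theorem standardRep_X1 (g : SL2) : linearAction standardRep g (MvPolynomial.X 1) =
    g⁻¹.1 1 0 • MvPolynomial.X 0 + g⁻¹.1 1 1 • MvPolynomial.X 1 := by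
  rw [linearAction_X, Fin.sum_univ_two]
  rfl

theorem standardRep_lower_X0 (y : ℂ) :
    linearAction standardRep (lower y) (MvPolynomial.X 0) =
      (C (MvPolynomial.X 0) : (MvPolynomial (Fin 2) ℂ)[X]).eval (algebraMap ℂ _ y) := by
  simp [standardRep_X0, lower_inv, -Matrix.SpecialLinearGroup.coe_inv]

theorem standardRep_lower_X1 (y : ℂ) :
    linearAction standardRep (lower y) (MvPolynomial.X 1) =
      (C (MvPolynomial.X 1) - C (MvPolynomial.X 0) * X : (MvPolynomial (Fin 2) ℂ)[X]).eval
        (algebraMap ℂ _ y) := by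
  simp [standardRep_X1, lower_inv, -Matrix.SpecialLinearGroup.coe_inv, MvPolynomial.smul_eq_C_mul]
  ring

theorem polyFlow_standardRep : PolyFlow fun y => linearAction standardRep (lower y) :=
  polyFlow_of_adjoin _ MvPolynomial.adjoin_range_X (by
    rintro _ ⟨i, rfl⟩
    fin_cases i
    · exact ⟨_, standardRep_lower_X0⟩
    · exact ⟨_, standardRep_lower_X1⟩)

theorem gen_standardRep_X0 : polyFlow_standardRep.gen (MvPolynomial.X 0) = 0 := by
  rw [polyFlow_standardRep.gen_eq standardRep_lower_X0]
  simp

theorem gen_standardRep_X1 :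
    polyFlow_standardRep.gen (MvPolynomial.X 1) = -MvPolynomial.X 0 := by
  rw [polyFlow_standardRep.gen_eq standardRep_lower_X1]
  simp

theorem gen_standardRep_iterate (n : ℕ) {i : ℕ} (hi : i ≤ n) :
    polyFlow_standardRep.gen^[i] (MvPolynomial.X 1 ^ n) =
      ((-1) ^ i * n.descFactorial i : ℂ) • (MvPolynomial.X 0 ^ i * MvPolynomial.X 1 ^ (n - i)) := by
  induction i with
  | zero => simp
  | succ i ih =>
    rw [Function.iterate_succ_apply', ih (by omega), Derivation.map_smul, Derivation.leibniz,
      Derivation.leibniz_pow, Derivation.leibniz_pow, gen_standardRep_X0, gen_standardRep_X1,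
      Nat.descFactorial_succ, show n - i - 1 = n - (i + 1) by omega]
    simp only [smul_eq_mul, nsmul_eq_mul, mul_zero, add_zero, MvPolynomial.smul_eq_C_mul, map_mul,
      map_pow, map_neg, map_one, map_natCast, Nat.cast_mul]
    ring

section Cone

variable (n : ℕ)

theorem polyFlow_cone : PolyFlow fun y => coneAction n (lower y) :=
  polyFlow_subalgebra polyFlow_standardRep _ (coneRing_invariant n)

theorem polyFlow_coneLine : PolyFlow fun y => timesLine (coneAction n) (lower y) :=
  polyFlow_timesLine (polyFlow_cone n)

theorem gen_cone (a : coneRing n) :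
    ((polyFlow_cone n).gen a).1 = polyFlow_standardRep.gen a.1 :=
  (polyFlow_cone n).map_gen polyFlow_standardRep (coneRing n).val (fun _ _ => rfl) a

theorem gen_coneLine_C (a : coneRing n) :
    (polyFlow_coneLine n).gen (C a) = C ((polyFlow_cone n).gen a) :=
  ((polyFlow_cone n).map_gen (polyFlow_coneLine n) CAlgHom
    (fun y a => (timesLine_C (coneAction n) (lower y) a).symm) a).symm

/-- The function `uⁱ vⁿ⁻ⁱ` on the cone. -/
def coneMonomial (i : ℕ) (hi : i ≤ n) : coneRing n :=
  ⟨MvPolynomial.X 0 ^ i * MvPolynomial.X 1 ^ (n - i),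
    Algebra.subset_adjoin ⟨n - i, Nat.sub_le n i, by rw [Nat.sub_sub_self hi]⟩⟩

theorem gen_coneLine_iterate {i : ℕ} (hi : i ≤ n) :
    (polyFlow_coneLine n).gen^[i] (C (coneMonomial n 0 (Nat.zero_le n))) =
      ((-1) ^ i * n.descFactorial i : ℂ) • C (coneMonomial n i hi) := by
  have h1 : (polyFlow_coneLine n).gen^[i] (C (coneMonomial n 0 (Nat.zero_le n))) =
      C ((polyFlow_cone n).gen^[i] (coneMonomial n 0 (Nat.zero_le n))) :=
    (Function.Semiconj.iterate_right (f := C) (fun a => (gen_coneLine_C n a).symm) i _).symm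
  have h2 : ((polyFlow_cone n).gen^[i] (coneMonomial n 0 (Nat.zero_le n))).1 =
      polyFlow_standardRep.gen^[i] (MvPolynomial.X 1 ^ n) := by
    have := Function.Semiconj.iterate_right (f := (coneRing n).val) (gen_cone n) i
      (coneMonomial n 0 (Nat.zero_le n))
    refine this.trans ?_
    simp [coneMonomial]
  rw [h1, smul_C]
  congr 1
  exact Subtype.ext (by rw [h2, gen_standardRep_iterate n hi]; rfl)

variable {n} in
/-- The model `𝔽ᵃₙ × ℂ`. The highest weight vector is the `n`-th power of the second coordinate of
the plane. -/
theorem presentation_cone (hn : 0 < n) : Presentation (timesLine (coneAction n))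
    (polyFlow_coneLine n) n 0 X (C (coneMonomial n 0 (Nat.zero_le n)))
      (C (-coneMonomial n 1 hn)) where
  pos := hn
  t_inv g := timesLine_X _ g
  t_transcendental := transcendental_X_of_nontrivial
  f_upper s := by
    rw [timesLine_C]
    congr 1
    refine Subtype.ext ?_
    change linearAction standardRep (upper s) (_ * _) = _
    simp [coneMonomial, standardRep_X1, upper_inv, -Matrix.SpecialLinearGroup.coe_inv]
  f_torus z := by
    rw [timesLine_C, smul_C]
    congr 1
    refine Subtype.ext ?_
    change linearAction standardRep (torus z) (_ * _) = ((z : ℂ) ^ n) • (_ * _)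
    simp [standardRep_X1, torus_inv, -Matrix.SpecialLinearGroup.coe_inv, _root_.smul_pow]
  f_regular := by
    refine mem_nonZeroDivisors_of_ne_zero (C_ne_zero.2 fun h0 => ?_)
    have h1 : (MvPolynomial.X 0 ^ 0 * MvPolynomial.X 1 ^ (n - 0) : MvPolynomial (Fin 2) ℂ) = 0 :=
      congrArg Subtype.val h0
    simp at h1
  x_upper s := by
    rw [timesLine_C, smul_C, ← C_add]
    congr 1
    refine Subtype.ext ?_
    change linearAction standardRep (upper s) (-(_ * _)) = -(_ * _) + s • (_ * _)
    obtain ⟨m, rfl⟩ := Nat.exists_eq_add_of_le' hn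
    simp [standardRep_X1, standardRep_X0, upper_inv, -Matrix.SpecialLinearGroup.coe_inv,
      MvPolynomial.smul_eq_C_mul]
    ring
  isSlice :=
    { map_t := (polyFlow_coneLine n).gen_eq_zero_of_fixed fun y => timesLine_X _ _
      map_f := by
        have h1 := gen_coneLine_iterate n hn
        simp only [Function.iterate_one, pow_one, Nat.descFactorial_one] at h1
        rw [h1]
        change (-1 * (n : ℂ)) • C (coneMonomial n 1 hn) = _
        rw [Algebra.smul_def, map_mul, map_neg, map_one, map_natCast, C_neg]
        ring
      map_x := by
        rw [map_zero, add_zero, gen_coneLine_C, ← C_mul, ← C_pow]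
        have h1 : ((n : (coneRing n)[X]) - 1) = C ((n : coneRing n) - 1) := by simp
        rw [h1, ← C_mul]
        congr 1
        refine Subtype.ext ?_
        rw [map_neg]
        change (_ * _) * (-((polyFlow_cone n).gen (coneMonomial n 1 hn)).1) =
          (((n : coneRing n) : MvPolynomial (Fin 2) ℂ) - 1) * (-(_ * _)) ^ 2
        rw [gen_cone]
        obtain ⟨m, rfl⟩ := Nat.exists_eq_add_of_le' hn
        rcases m with _ | m
        · simp [coneMonomial, gen_standardRep_X0]
        · simp [coneMonomial, gen_standardRep_X0, gen_standardRep_X1, Derivation.leibniz,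
            Derivation.leibniz_pow]
          ring }
  generates := by
    set T := Algebra.adjoin ℂ (insert X (Set.range fun i => (polyFlow_coneLine n).gen^[i]
      (C (coneMonomial n 0 (Nat.zero_le n))))) with hT
    have hmon : ∀ i hi, C (coneMonomial n i hi) ∈ T := by
      intro i hi
      have h1 : ((-1) ^ i * n.descFactorial i : ℂ) • C (coneMonomial n i hi) ∈ T := by
        rw [← gen_coneLine_iterate]
        exact Algebra.subset_adjoin (Or.inr ⟨i, rfl⟩)
      have h2 : ((-1) ^ i * n.descFactorial i : ℂ) ≠ 0 :=
        mul_ne_zero (pow_ne_zero _ (by norm_num)) (Nat.cast_ne_zero.2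
          (by rw [Ne, Nat.descFactorial_eq_zero_iff_lt]; omega))
      have h3 := T.smul_mem h1 ((-1) ^ i * n.descFactorial i : ℂ)⁻¹
      rwa [smul_smul, inv_mul_cancel₀ h2, one_smul] at h3
    have hC : ∀ a : coneRing n, C a ∈ T := by
      have h1 : coneRing n ≤ (T.comap CAlgHom).map (coneRing n).val := by
        refine Algebra.adjoin_le ?_
        rintro _ ⟨i, hi, rfl⟩
        refine ⟨_, hmon (n - i) (Nat.sub_le _ _), ?_⟩
        simp [coneMonomial, Nat.sub_sub_self hi]
      intro a
      obtain ⟨b, hb, hba⟩ := h1 a.2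
      obtain rfl : b = a := Subtype.ext hba
      exact hb
    rw [eq_top_iff]
    rintro p -
    induction p using Polynomial.induction_on' with
    | add p q hp hq => exact T.add_mem hp hq
    | monomial k b =>
      rw [← C_mul_X_pow_eq_monomial]
      exact T.mul_mem (hC b) (T.pow_mem (Algebra.subset_adjoin (Or.inl rfl)) k)

end Cone

/-! ### The three-dimensional representation -/

theorem irreducibleRep3_X0 (g : SL2) : linearAction irreducibleRep3 g (MvPolynomial.X 0) =
    g⁻¹.1 0 0 ^ 2 • MvPolynomial.X 0 + (g⁻¹.1 0 0 * g⁻¹.1 0 1) • MvPolynomial.X 1 +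
      g⁻¹.1 0 1 ^ 2 • MvPolynomial.X 2 := by
  rw [linearAction_X, Fin.sum_univ_three]
  rfl

theorem irreducibleRep3_X1 (g : SL2) : linearAction irreducibleRep3 g (MvPolynomial.X 1) =
    (2 * g⁻¹.1 0 0 * g⁻¹.1 1 0) • MvPolynomial.X 0 +
      (g⁻¹.1 0 0 * g⁻¹.1 1 1 + g⁻¹.1 0 1 * g⁻¹.1 1 0) • MvPolynomial.X 1 +
      (2 * g⁻¹.1 0 1 * g⁻¹.1 1 1) • MvPolynomial.X 2 := by
  rw [linearAction_X, Fin.sum_univ_three]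
  rfl

theorem irreducibleRep3_X2 (g : SL2) : linearAction irreducibleRep3 g (MvPolynomial.X 2) =
    g⁻¹.1 1 0 ^ 2 • MvPolynomial.X 0 + (g⁻¹.1 1 0 * g⁻¹.1 1 1) • MvPolynomial.X 1 +
      g⁻¹.1 1 1 ^ 2 • MvPolynomial.X 2 := by
  rw [linearAction_X, Fin.sum_univ_three]
  rfl

theorem irreducibleRep3_lower_X0 (y : ℂ) :
    linearAction irreducibleRep3 (lower y) (MvPolynomial.X 0) =
      (C (MvPolynomial.X 0) : (MvPolynomial (Fin 3) ℂ)[X]).eval (algebraMap ℂ _ y) := by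
  simp [irreducibleRep3_X0, lower_inv, -Matrix.SpecialLinearGroup.coe_inv]

theorem irreducibleRep3_lower_X1 (y : ℂ) :
    linearAction irreducibleRep3 (lower y) (MvPolynomial.X 1) =
      (C (MvPolynomial.X 1) - 2 * C (MvPolynomial.X 0) * X : (MvPolynomial (Fin 3) ℂ)[X]).eval
        (algebraMap ℂ _ y) := by
  simp [irreducibleRep3_X1, lower_inv, -Matrix.SpecialLinearGroup.coe_inv, MvPolynomial.smul_eq_C_mul,
    map_ofNat]
  ring

theorem irreducibleRep3_lower_X2 (y : ℂ) :
    linearAction irreducibleRep3 (lower y) (MvPolynomial.X 2) =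
      (C (MvPolynomial.X 2) - C (MvPolynomial.X 1) * X + C (MvPolynomial.X 0) * X ^ 2 :
        (MvPolynomial (Fin 3) ℂ)[X]).eval (algebraMap ℂ _ y) := by
  simp [irreducibleRep3_X2, lower_inv, -Matrix.SpecialLinearGroup.coe_inv,
    MvPolynomial.smul_eq_C_mul]
  ring

theorem polyFlow_irreducibleRep3 : PolyFlow fun y => linearAction irreducibleRep3 (lower y) :=
  polyFlow_of_adjoin _ MvPolynomial.adjoin_range_X (by
    rintro _ ⟨i, rfl⟩
    fin_cases i
    · exact ⟨_, irreducibleRep3_lower_X0⟩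
    · exact ⟨_, irreducibleRep3_lower_X1⟩
    · exact ⟨_, irreducibleRep3_lower_X2⟩)

theorem gen_irreducibleRep3_X0 : polyFlow_irreducibleRep3.gen (MvPolynomial.X 0) = 0 := by
  rw [polyFlow_irreducibleRep3.gen_eq irreducibleRep3_lower_X0]
  simp

theorem gen_irreducibleRep3_X1 :
    polyFlow_irreducibleRep3.gen (MvPolynomial.X 1) = -(2 * MvPolynomial.X 0) := by
  rw [polyFlow_irreducibleRep3.gen_eq irreducibleRep3_lower_X1, ← C_ofNat, ← C_mul, coeff_sub,
    coeff_C_mul]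
  simp

theorem gen_irreducibleRep3_X2 :
    polyFlow_irreducibleRep3.gen (MvPolynomial.X 2) = -MvPolynomial.X 1 := by
  rw [polyFlow_irreducibleRep3.gen_eq irreducibleRep3_lower_X2, coeff_add, coeff_sub, coeff_C_mul,
    coeff_C_mul]
  simp [coeff_X_pow]

/-! ### The families of quadrics and their quotients -/

theorem algebraMap_half (B : Type*) [CommRing B] [Algebra ℂ B] :
    2 * algebraMap ℂ B (1 / 2) = 1 := by
  rw [← map_ofNat (algebraMap ℂ B), ← map_mul]
  norm_num

/-- The properties of the coordinate functions `x`, `y`, `z` and `t = δ` on `X_k` that are used to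
find its presentation. -/
structure IsQuadricFamily {B : Type*} [CommRing B] [Algebra ℂ B] (σ : Action B)
    (hF : PolyFlow fun y => σ (lower y)) (k : ℕ) (t x y z : B) : Prop where
  quadric : 4 * x * z - y ^ 2 = t ^ k
  t_inv : ∀ g, σ g t = t
  t_transcendental : Transcendental ℂ t
  gen_x : hF.gen x = 0
  gen_y : hF.gen y = -(2 * x)
  gen_z : hF.gen z = -y
  upper_y : ∀ s, σ (upper s) y = y - (2 * s) • z
  upper_z : ∀ s, σ (upper s) z = z
  torus_z : ∀ w : ℂˣ, σ (torus w) z = ((w : ℂ) ^ 2) • z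
  z_regular : z ∈ nonZeroDivisors B
  generates : Algebra.adjoin ℂ (insert t {x, y, z}) = ⊤

section

variable {B : Type*} [CommRing B] [Algebra ℂ B] {σ : Action B}
  {hF : PolyFlow fun y => σ (lower y)} {k : ℕ} {t x y z : B}

/-- The presentation of `X_k` by the highest weight vector `z`. -/
theorem IsQuadricFamily.presentation (h : IsQuadricFamily σ hF k t x y z) :
    Presentation σ hF 2 (Polynomial.aeval (MvPolynomial.X 0) (C (1 / 4) * X ^ k : ℂ[X])) t z
      ((-(1 / 2) : ℂ) • y) where
  pos := two_pos
  t_inv := h.t_inv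
  t_transcendental := h.t_transcendental
  f_upper := h.upper_z
  f_torus := h.torus_z
  f_regular := h.z_regular
  x_upper s := by
    rw [map_smul, h.upper_y, smul_sub, smul_smul, sub_eq_add_neg, ← _root_.neg_smul]
    congr 2
    ring
  isSlice :=
    { map_t := hF.gen_eq_zero_of_fixed fun _ => h.t_inv _
      map_f := by
        rw [h.gen_z, Algebra.smul_def, map_neg]
        push_cast
        linear_combination y * algebraMap_half B
      map_x := by
        rw [Derivation.map_smul, h.gen_y, aeval_aeval_X_zero, Algebra.smul_def, Algebra.smul_def,
          map_neg, map_mul, map_pow, Polynomial.aeval_X, Polynomial.aeval_C, ← h.quadric,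
          show (1 / 4 : ℂ) = 1 / 2 * (1 / 2) by norm_num, map_mul]
        push_cast
        linear_combination (-2 * z * x * algebraMap ℂ B (1 / 2)) * algebraMap_half B }
  generates := by
    rw [eq_top_iff, ← h.generates]
    refine Algebra.adjoin_le ?_
    set T := Algebra.adjoin ℂ (insert t (Set.range fun i => hF.gen^[i] z))
    have hmem : ∀ i, hF.gen^[i] z ∈ T := fun i => Algebra.subset_adjoin (Or.inr ⟨i, rfl⟩)
    have h1 := hmem 1
    have h2 := hmem 2
    rw [Function.iterate_succ_apply', Function.iterate_one, h.gen_z, map_neg, h.gen_y, neg_neg] at h2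
    rw [Function.iterate_one, h.gen_z, neg_mem_iff] at h1
    rintro _ (rfl | rfl | rfl | rfl)
    · exact Algebra.subset_adjoin (Or.inl rfl)
    · have h3 := T.smul_mem h2 (1 / 2)
      rwa [Algebra.smul_def, ← mul_assoc, mul_comm (algebraMap _ _ _), algebraMap_half,
        one_mul] at h3
    · exact h1
    · exact hmem 0

variable {ι : B →ₐ[ℂ] B}

/-- If `B` is generated by an even element `t` and a set `s` of odd elements, then a subalgebra that
contains `t` and the products of two elements of `s` contains all even elements. The second
part of the statement makes the induction work. -/
theorem even_mem {s : Set B} (hs : Algebra.adjoin ℂ (insert t s) = ⊤) (ht : ι t = t)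
    (hodd : ∀ a ∈ s, ι a = -a) {T : Subalgebra ℂ B} (hT : t ∈ T)
    (hsT : ∀ a ∈ s, ∀ b ∈ s, a * b ∈ T) (b : B) :
    b + ι b ∈ T ∧ ∀ a ∈ s, a * (b - ι b) ∈ T := by
  suffices h : ∀ c ∈ Algebra.adjoin ℂ (insert t s), ∀ b : B,
      (b + ι b ∈ T ∧ ∀ a ∈ s, a * (b - ι b) ∈ T) →
      (c * b + ι (c * b) ∈ T ∧ ∀ a ∈ s, a * (c * b - ι (c * b)) ∈ T) by
    have h1 := h b (by rw [hs]; exact Algebra.mem_top) 1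
      ⟨by rw [map_one]; exact T.add_mem T.one_mem T.one_mem, fun i _ => by
        rw [map_one, sub_self, mul_zero]
        exact T.zero_mem⟩
    rwa [mul_one] at h1
  intro c hc
  induction hc using Algebra.adjoin_induction with
  | mem c hc =>
    rintro b ⟨h1, h2⟩
    rcases hc with rfl | hc
    · rw [map_mul, ht, ← mul_add, ← mul_sub]
      refine ⟨T.mul_mem hT h1, fun a ha => ?_⟩
      rw [mul_left_comm]
      exact T.mul_mem hT (h2 a ha)
    · rw [map_mul, hodd c hc, neg_mul, ← sub_eq_add_neg, sub_neg_eq_add, ← mul_sub, ← mul_add]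
      refine ⟨h2 c hc, fun a ha => ?_⟩
      rw [← mul_assoc]
      exact T.mul_mem (hsT a ha c hc) h1
  | algebraMap c =>
    rintro b ⟨h1, h2⟩
    rw [map_mul, AlgHom.commutes, ← mul_add, ← mul_sub]
    refine ⟨T.mul_mem (T.algebraMap_mem c) h1, fun a ha => ?_⟩
    rw [mul_left_comm]
    exact T.mul_mem (T.algebraMap_mem c) (h2 a ha)
  | add c d _ _ hc hd =>
    intro b hb
    obtain ⟨h1, h2⟩ := hc b hb
    obtain ⟨h3, h4⟩ := hd b hb
    rw [add_mul, map_add, add_add_add_comm, add_sub_add_comm]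
    refine ⟨T.add_mem h1 h3, fun a ha => ?_⟩
    rw [mul_add]
    exact T.add_mem (h2 a ha) (h4 a ha)
  | mul c d _ _ hc hd =>
    intro b hb
    rw [mul_assoc]
    exact hc _ (hd b hb)

/-- The subalgebra of elements fixed by `ι`. -/
abbrev evenSubalgebra (ι : B →ₐ[ℂ] B) : Subalgebra ℂ B := AlgHom.equalizer ι (AlgHom.id ℂ B)

/-- An element fixed by `ι`, as an even element. -/
def evenMk {a : B} (ha : ι a = a) : evenSubalgebra ι := ⟨a, ha⟩

/-- The product of two odd elements, as an even element. -/
def oddMul {a b : B} (ha : ι a = -a) (hb : ι b = -b) : evenSubalgebra ι :=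
  ⟨a * b, by
    change ι (a * b) = a * b
    rw [map_mul, ha, hb, neg_mul_neg]⟩

theorem equalizer_eq_top {s : Set B} (hs : Algebra.adjoin ℂ (insert t s) = ⊤) (ht : ι t = t)
    (hodd : ∀ a ∈ s, ι a = -a) {T : Subalgebra ℂ (evenSubalgebra ι)}
    (hT : evenMk ht ∈ T) (hsT : ∀ a (ha : a ∈ s), ∀ b (hb : b ∈ s), oddMul (hodd a ha) (hodd b hb) ∈ T) :
    T = ⊤ := by
  rw [eq_top_iff]
  rintro b -
  have h1 := (even_mem hs ht hodd (T := T.map (evenSubalgebra ι).val)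
    ⟨_, hT, rfl⟩ (fun a ha b hb => ⟨_, hsT a ha b hb, rfl⟩) b.1).1
  have hb : ι b.1 = b.1 := b.2
  rw [hb] at h1
  obtain ⟨c, hc, hcb⟩ := h1
  have h2 : c = 2 * b := Subtype.ext (by rw [two_mul]; exact hcb)
  have h3 := T.smul_mem hc (1 / 2)
  rwa [h2, Algebra.smul_def, ← mul_assoc, mul_comm (algebraMap _ _ _), algebraMap_half,
    one_mul] at h3

theorem gen_oddMul {hS : ∀ g, ∀ a ∈ evenSubalgebra ι,
    σ g a ∈ evenSubalgebra ι} {a b : B} (ha : ι a = -a) (hb : ι b = -b) :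
    ((polyFlow_subalgebra hF _ hS).gen (oddMul ha hb)).1 = a * hF.gen b + b * hF.gen a := by
  have h1 := (polyFlow_subalgebra hF _ hS).map_gen hF (evenSubalgebra ι).val
    (fun _ _ => rfl) (oddMul ha hb)
  exact h1.trans (hF.gen.leibniz a b)

/-- The presentation of `X_k / ℤ₂` by the highest weight vector `z ^ 2`. -/
theorem IsQuadricFamily.presentation_quotient (h : IsQuadricFamily σ hF k t x y z)
    (hS : ∀ g, ∀ a ∈ evenSubalgebra ι, σ g a ∈ evenSubalgebra ι)
    (ht : ι t = t) (hx : ι x = -x) (hy : ι y = -y) (hz : ι z = -z) :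
    Presentation (subalgebraAction σ _ hS) (polyFlow_subalgebra hF _ hS) 4
      (Polynomial.aeval (MvPolynomial.X 0) (C (1 / 4) * X ^ k : ℂ[X]) * MvPolynomial.X 1) (evenMk ht)
      (oddMul hz hz) ((-(1 / 2) : ℂ) • oddMul hy hz) := by
  set hFS := polyFlow_subalgebra hF (evenSubalgebra ι) hS
  have gen_zz : hFS.gen (oddMul hz hz) = -(2 * oddMul hy hz) := Subtype.ext (by
    rw [gen_oddMul (hF := hF), h.gen_z]
    change _ = -(2 * (y * z))
    ring)
  have gen_yz : hFS.gen (oddMul hy hz) = -(2 * oddMul hx hz + oddMul hy hy) := Subtype.ext (by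
    rw [gen_oddMul (hF := hF), h.gen_z, h.gen_y]
    change _ = -(2 * (x * z) + y * y)
    ring)
  have gen_xz : hFS.gen (oddMul hx hz) = -oddMul hx hy := Subtype.ext (by
    rw [gen_oddMul (hF := hF), h.gen_z, h.gen_x]
    change _ = -(x * y)
    ring)
  have gen_yy : hFS.gen (oddMul hy hy) = -(4 * oddMul hx hy) := Subtype.ext (by
    rw [gen_oddMul (hF := hF), h.gen_y]
    change _ = -(4 * (x * y))
    ring)
  have gen_xy : hFS.gen (oddMul hx hy) = -(2 * oddMul hx hx) := Subtype.ext (by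
    rw [gen_oddMul (hF := hF), h.gen_y, h.gen_x]
    change _ = -(2 * (x * x))
    ring)
  have gen_t : hFS.gen (evenMk ht) = 0 := hFS.gen_eq_zero_of_fixed fun _ => Subtype.ext (h.t_inv _)
  have hquad : 4 * oddMul hx hz - oddMul hy hy = evenMk ht ^ k := Subtype.ext (by
    change 4 * (x * z) - y * y = t ^ k
    rw [← h.quadric]
    ring)
  have hsq : oddMul hy hz ^ 2 = oddMul hy hy * oddMul hz hz := Subtype.ext (by
    change (y * z) ^ 2 = y * y * (z * z)
    ring)
  have gen2 : hFS.gen (2 * oddMul hx hz + oddMul hy hy) = -(6 * oddMul hx hy) := by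
    rw [two_mul, map_add, map_add, gen_xz, gen_yy]
    ring
  refine ⟨four_pos, fun g => Subtype.ext (h.t_inv g), ?_, fun s => Subtype.ext ?_,
    fun w => Subtype.ext ?_, ?_, fun s => Subtype.ext ?_, ⟨gen_t, ?_, ?_⟩, ?_⟩
  · rw [transcendental_iff]
    intro p hp
    have h1 := congrArg (evenSubalgebra ι).val hp
    rw [← Polynomial.aeval_algHom_apply, map_zero] at h1
    exact (transcendental_iff.1 h.t_transcendental) p h1
  · change σ (upper s) (z * z) = z * z
    rw [map_mul, h.upper_z]
  · change σ (torus w) (z * z) = ((w : ℂ) ^ 4) • (z * z)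
    rw [map_mul, h.torus_z, smul_mul_smul_comm, ← pow_add]
  · rw [mem_nonZeroDivisors_iff_right]
    intro b hb
    exact Subtype.ext ((mul_right_mem_nonZeroDivisors_eq_zero_iff
      (mul_mem h.z_regular h.z_regular)).1 (congrArg Subtype.val hb))
  · change σ (upper s) ((-(1 / 2) : ℂ) • (y * z)) = (-(1 / 2) : ℂ) • (y * z) + s • (z * z)
    rw [map_smul, map_mul, h.upper_z, h.upper_y, sub_mul, smul_sub, smul_mul_assoc, smul_smul,
      sub_eq_add_neg, ← _root_.neg_smul]
    congr 2
    ring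
  · rw [gen_zz, Algebra.smul_def, map_neg]
    push_cast
    linear_combination 2 * oddMul hy hz * algebraMap_half (evenSubalgebra ι)
  · rw [Derivation.map_smul, gen_yz, map_mul, aeval_aeval_X_zero, Algebra.smul_def,
      Algebra.smul_def, map_neg, map_mul, map_pow, Polynomial.aeval_X, Polynomial.aeval_C,
      MvPolynomial.aeval_X, ← hquad, show (1 / 4 : ℂ) = 1 / 2 * (1 / 2) by norm_num, map_mul]
    change _ = _ + _ * oddMul hz hz
    push_cast
    linear_combination -3 * algebraMap ℂ (evenSubalgebra ι) (1 / 2) ^ 2 * hsq -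
      (oddMul hz hz * oddMul hy hy + 2 * oddMul hz hz * oddMul hx hz) *
        algebraMap ℂ (evenSubalgebra ι) (1 / 2) * algebraMap_half (evenSubalgebra ι)
  · set T := Algebra.adjoin ℂ (insert (evenMk ht) (Set.range fun i => hFS.gen^[i] (oddMul hz hz)))
    have hgen : ∀ a ∈ T, hFS.gen a ∈ T := by
      refine fun a ha => map_mem_adjoin _ ?_ ha
      rintro _ (rfl | ⟨i, rfl⟩)
      · rw [gen_t]
        exact T.zero_mem
      · exact Algebra.subset_adjoin (Or.inr ⟨i + 1, Function.iterate_succ_apply' _ _ _⟩)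
    have hdiv : ∀ (m : ℂ) (a : evenSubalgebra ι), m ≠ 0 → -(algebraMap ℂ (evenSubalgebra ι) m * a) ∈ T → a ∈ T := by
      intro m a hm ha
      rw [neg_mem_iff, ← Algebra.smul_def] at ha
      have := T.smul_mem ha m⁻¹
      rwa [smul_smul, inv_mul_cancel₀ hm, one_smul] at this
    have htT : evenMk ht ∈ T := Algebra.subset_adjoin (Or.inl rfl)
    have hzz : oddMul hz hz ∈ T := Algebra.subset_adjoin (Or.inr ⟨0, rfl⟩)
    have hyz : oddMul hy hz ∈ T := hdiv 2 _ two_ne_zero (by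
      rw [map_ofNat, ← gen_zz]
      exact hgen _ hzz)
    have hsum : 2 * oddMul hx hz + oddMul hy hy ∈ T := by
      rw [← neg_mem_iff, ← gen_yz]
      exact hgen _ hyz
    have hxy : oddMul hx hy ∈ T := hdiv 6 _ (by norm_num) (by
      rw [map_ofNat, ← gen2]
      exact hgen _ hsum)
    have hxx : oddMul hx hx ∈ T := hdiv 2 _ two_ne_zero (by
      rw [map_ofNat, ← gen_xy]
      exact hgen _ hxy)
    -- The invariant combination of the two products of weight zero is a power of `t`.
    have hxz : oddMul hx hz ∈ T := hdiv 6 _ (by norm_num) (by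
      have h1 := T.neg_mem (T.add_mem hsum (T.pow_mem htT k))
      rw [← hquad] at h1
      rw [map_ofNat]
      convert h1 using 1
      ring)
    have hyy : oddMul hy hy ∈ T := by
      have h1 := T.sub_mem hsum (T.add_mem hxz hxz)
      convert h1 using 1
      ring
    have hcomm : ∀ {a b : B} (ha : ι a = -a) (hb : ι b = -b), oddMul ha hb = oddMul hb ha :=
      fun ha hb => Subtype.ext (mul_comm _ _)
    refine equalizer_eq_top h.generates ht (by
      rintro _ (rfl | rfl | rfl)
      exacts [hx, hy, hz]) htT ?_
    rintro _ (rfl | rfl | rfl) _ (rfl | rfl | rfl)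
    · exact hxx
    · exact hxy
    · exact hxz
    · exact hcomm hx hy ▸ hxy
    · exact hyy
    · exact hyz
    · exact hcomm hx hz ▸ hxz
    · exact hcomm hy hz ▸ hyz
    · exact hzz

end

theorem mk_mem_nonZeroDivisors {P : Type*} [CommRing P] [IsDomain P] {p q : P} (hp : Prime p)
    (hpq : ¬ p ∣ q) : Ideal.Quotient.mk (Ideal.span {q}) p ∈ nonZeroDivisors (P ⧸ Ideal.span {q}) := by
  rw [mem_nonZeroDivisors_iff_right]
  intro b hb
  obtain ⟨a, rfl⟩ := Ideal.Quotient.mk_surjective b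
  rw [← map_mul, Ideal.Quotient.eq_zero_iff_mem, Ideal.mem_span_singleton] at hb
  rw [Ideal.Quotient.eq_zero_iff_mem, Ideal.mem_span_singleton]
  obtain ⟨w, hw⟩ := hb
  obtain ⟨v, rfl⟩ := (hp.2.2 _ _ (hw ▸ dvd_mul_left p a)).resolve_left hpq
  refine ⟨v, mul_right_cancel₀ hp.ne_zero ?_⟩
  rw [hw]
  ring

section Family

variable (k : ℕ)

/-- The functions on `ℂ³` as functions on `X_k`. -/
def familyCoord : MvPolynomial (Fin 3) ℂ →ₐ[ℂ] FamilyRing k :=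
  (Ideal.Quotient.mkₐ ℂ (familyIdeal k)).comp CAlgHom

/-- The coordinate `δ` on `X_k`. -/
def familyBase : FamilyRing k := Ideal.Quotient.mkₐ ℂ (familyIdeal k) X

theorem familyAction_coord (g : SL2) (a : MvPolynomial (Fin 3) ℂ) :
    familyAction k g (familyCoord k a) = familyCoord k (linearAction irreducibleRep3 g a) :=
  congrArg (Ideal.Quotient.mkₐ ℂ (familyIdeal k)) (timesLine_C _ g a)

theorem familyAction_base (g : SL2) : familyAction k g (familyBase k) = familyBase k :=
  congrArg (Ideal.Quotient.mkₐ ℂ (familyIdeal k)) (timesLine_X _ g)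

theorem polyFlow_family : PolyFlow (A := FamilyRing k) fun y => familyAction k (lower y) :=
  polyFlow_quotient (polyFlow_timesLine polyFlow_irreducibleRep3) _ (familyIdeal_invariant k)

theorem gen_family_coord (a : MvPolynomial (Fin 3) ℂ) :
    (polyFlow_family k).gen (familyCoord k a) = familyCoord k (polyFlow_irreducibleRep3.gen a) :=
  (polyFlow_irreducibleRep3.map_gen (polyFlow_family k) (familyCoord k)
    (fun y a => (familyAction_coord k (lower y) a).symm) a).symm

theorem adjoin_familyCoord : Algebra.adjoin ℂ (insert (familyBase k) {familyCoord k (MvPolynomial.X 0),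
    familyCoord k (MvPolynomial.X 1), familyCoord k (MvPolynomial.X 2)}) = ⊤ := by
  set T := Algebra.adjoin ℂ (insert (familyBase k) {familyCoord k (MvPolynomial.X 0),
    familyCoord k (MvPolynomial.X 1), familyCoord k (MvPolynomial.X 2)})
  have hC : ∀ a, familyCoord k a ∈ T := by
    have h1 : Algebra.adjoin ℂ (Set.range MvPolynomial.X) ≤ T.comap (familyCoord k) :=
      Algebra.adjoin_le (by
        rintro _ ⟨i, rfl⟩
        refine Algebra.subset_adjoin (Or.inr ?_)
        fin_cases i
        exacts [Or.inl rfl, Or.inr (Or.inl rfl), Or.inr (Or.inr rfl)])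
    rw [MvPolynomial.adjoin_range_X] at h1
    exact fun a => h1 Algebra.mem_top
  rw [eq_top_iff]
  rintro b -
  obtain ⟨p, rfl⟩ := Ideal.Quotient.mk_surjective b
  induction p using Polynomial.induction_on' with
  | add p q hp hq => rw [map_add]; exact T.add_mem hp hq
  | monomial j b =>
    rw [← C_mul_X_pow_eq_monomial, map_mul, map_pow]
    exact T.mul_mem (hC b) (T.pow_mem (Algebra.subset_adjoin (Or.inl rfl)) j)

/-- The coordinate `δ` is transcendental, since `X_k` has the section `δ ↦ (1, 0, δᵏ / 4)`. -/
theorem transcendental_familyBase : Transcendental ℂ (familyBase k) := by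
  let s : (MvPolynomial (Fin 3) ℂ)[X] →+* ℂ[X] :=
    Polynomial.eval₂RingHom ((MvPolynomial.aeval ![1, 0, C (1 / 4) * X ^ k] :
      MvPolynomial (Fin 3) ℂ →ₐ[ℂ] ℂ[X]) : MvPolynomial (Fin 3) ℂ →+* ℂ[X]) X
  have hs : ∀ p ∈ familyIdeal k, s p = 0 := by
    intro p hp
    obtain ⟨w, rfl⟩ := Ideal.mem_span_singleton.1 hp
    have h4 : (4 : ℂ[X]) * C (1 / 4) = 1 := by
      rw [← C_ofNat, ← C_mul]
      norm_num
    have h1 : s (C quadric - X ^ k) = 0 := by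
      rw [map_sub, map_pow]
      simp only [s, Polynomial.coe_eval₂RingHom, eval₂_C, eval₂_X]
      change MvPolynomial.aeval _ quadric - _ = _
      simp only [quadric, map_sub, map_mul, map_pow, map_ofNat, MvPolynomial.aeval_X]
      change 4 * 1 * (C (1 / 4) * X ^ k : ℂ[X]) - 0 ^ 2 - X ^ k = 0
      linear_combination X ^ k * h4
    rw [map_mul, h1, zero_mul]
  rw [transcendental_iff]
  intro p hp
  have h1 : Ideal.Quotient.mk (familyIdeal k) (p.map (algebraMap ℂ _)) = 0 := by
    rw [← hp]
    exact (Polynomial.aeval_algHom_apply (Ideal.Quotient.mkₐ ℂ (familyIdeal k)) X p).symm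
  have h2 := hs _ (Ideal.Quotient.eq_zero_iff_mem.1 h1)
  have h3 : s (p.map (algebraMap ℂ _)) = p := by
    simp only [s, Polynomial.coe_eval₂RingHom, eval₂_map]
    rw [AlgHom.comp_algebraMap, Polynomial.algebraMap_eq, eval₂_C_X]
  rw [← h3, h2]

/-- The last coordinate does not vanish on a component of `X_k`, as it is prime and does not divide
the equation of `X_k`. -/
theorem familyCoord_X2_mem_nonZeroDivisors :
    familyCoord k (MvPolynomial.X 2) ∈ nonZeroDivisors (FamilyRing k) := by
  have hprime : Prime (C (MvPolynomial.X 2) : (MvPolynomial (Fin 3) ℂ)[X]) :=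
    Polynomial.prime_C_iff.2 MvPolynomial.X_prime
  have hndvd : ¬ (C (MvPolynomial.X 2) : (MvPolynomial (Fin 3) ℂ)[X]) ∣ C quadric - X ^ k := by
    rintro ⟨w, hw⟩
    have h1 := congrArg (Polynomial.map (MvPolynomial.constantCoeff (R := ℂ) (σ := Fin 3))) hw
    simp [quadric] at h1
  exact mk_mem_nonZeroDivisors hprime hndvd

theorem isQuadricFamily : IsQuadricFamily (familyAction k) (polyFlow_family k) k (familyBase k)
    (familyCoord k (MvPolynomial.X 0)) (familyCoord k (MvPolynomial.X 1))
    (familyCoord k (MvPolynomial.X 2)) where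
  quadric := by
    have h1 : familyCoord k quadric = familyBase k ^ k :=
      sub_eq_zero.1 (Ideal.Quotient.eq_zero_iff_mem.2 (Ideal.subset_span rfl))
    rw [← h1, quadric]
    simp only [map_sub, map_mul, map_pow, map_ofNat]
  t_inv := familyAction_base k
  t_transcendental := transcendental_familyBase k
  gen_x := by rw [gen_family_coord, gen_irreducibleRep3_X0, map_zero]
  gen_y := by rw [gen_family_coord, gen_irreducibleRep3_X1, map_neg, map_mul, map_ofNat]
  gen_z := by rw [gen_family_coord, gen_irreducibleRep3_X2, map_neg]
  upper_y s := by
    rw [familyAction_coord, irreducibleRep3_X1, upper_inv, ← map_smul, ← map_sub]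
    congr 1
    simp [sub_eq_add_neg]
  upper_z s := by
    rw [familyAction_coord, irreducibleRep3_X2, upper_inv]
    congr 1
    simp
  torus_z w := by
    rw [familyAction_coord, irreducibleRep3_X2, torus_inv, ← map_smul]
    congr 1
    simp
  z_regular := familyCoord_X2_mem_nonZeroDivisors k
  generates := adjoin_familyCoord k

theorem involution_X (i : Fin 3) : involution k (familyCoord k (MvPolynomial.X i)) =
    -familyCoord k (MvPolynomial.X i) := by
  have h1 : negation (C (MvPolynomial.X i)) = C (-MvPolynomial.X i) := by
    simp only [negation, Polynomial.coe_mapAlgHom, Polynomial.map_C]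
    congr 1
    simp [subst, Matrix.one_apply]
  rw [← map_neg]
  exact congrArg (Ideal.Quotient.mkₐ ℂ (familyIdeal k)) h1

theorem involution_base : involution k (familyBase k) = familyBase k := by
  have h1 : negation X = X := by simp [negation]
  exact congrArg (Ideal.Quotient.mkₐ ℂ (familyIdeal k)) h1

/-- The model `X_k / ℤ₂`. -/
theorem exists_presentation_quotientFamily :
    ∃ (hF : PolyFlow (A := quotientRing k) fun y => quotientFamilyAction k (lower y))
      (t f x : quotientRing k), Presentation (quotientFamilyAction k) hF 4
        (Polynomial.aeval (MvPolynomial.X 0) (C (1 / 4) * X ^ k : ℂ[X]) * MvPolynomial.X 1) t f x :=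
  ⟨_, _, _, _, (isQuadricFamily k).presentation_quotient (quotientRing_invariant k)
    (involution_base k) (involution_X k 0) (involution_X k 1) (involution_X k 2)⟩

end Family

end SL2Var

end

theorem proposition3p2 {A : Type*} [CommRing A] [IsDomain A] [Algebra ℂ A]
    [Algebra.FiniteType ℂ A] [IsIntegrallyClosed A] (hdim : ringKrullDim A = 3)
    (ρ : SL2Var.Action A) (hρ : SL2Var.IsAlgebraicAction ρ)
    (e : Polynomial ℂ ≃ₐ[ℂ] SL2Var.invariants ρ)
    (hred : IsReduced (SL2Var.Fiber e 0))
    (hiso : ∀ a b : ℂ, a ≠ 0 → b ≠ 0 → Nonempty (SL2Var.Fiber e a ≃ₐ[ℂ] SL2Var.Fiber e b)) :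
    (∃ n : ℕ, 1 ≤ n ∧ SL2Var.EquivariantlyIsomorphic ρ (SL2Var.timesLine (SL2Var.coneAction n))) ∨
    (∃ k : ℕ, SL2Var.EquivariantlyIsomorphic ρ (SL2Var.familyAction k)) ∨
    (∃ k : ℕ, SL2Var.EquivariantlyIsomorphic ρ (SL2Var.quotientFamilyAction k)) := by
  obtain ⟨n, R, f, x, h, hE, hR⟩ := SL2Var.exists_presentation (hρ := hρ) e hdim hred hiso
  have hcone : R = 0 → ∃ n : ℕ, 1 ≤ n ∧
      SL2Var.EquivariantlyIsomorphic ρ (SL2Var.timesLine (SL2Var.coneAction n)) := by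
    rintro rfl
    exact ⟨n, h.pos, h.equivariantlyIsomorphic (SL2Var.presentation_cone h.pos)⟩
  have hquarter : (1 / 4 : ℂ) ≠ 0 := by norm_num
  rcases hR with hR | ⟨rfl, α, rfl⟩ | ⟨rfl, α, rfl⟩
  · exact Or.inl (hcone hR)
  · have hrel : SL2Var.IsRelation 2 _ α := Or.inl ⟨rfl, rfl⟩
    rcases SL2Var.eq_zero_or_eq_mul_X_pow h hE hrel hiso with rfl | ⟨c, k, hc, rfl⟩
    · exact Or.inl (hcone (map_zero _))
    · obtain ⟨R', f', x', h', ⟨-, rfl⟩ | ⟨h24, -⟩⟩ := h.exists_normalized hc hrel hquarter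
      · exact Or.inr (Or.inl ⟨k,
          h'.equivariantlyIsomorphic (SL2Var.isQuadricFamily k).presentation⟩)
      · norm_num at h24
  · have hrel : SL2Var.IsRelation 4 _ α := Or.inr ⟨rfl, rfl⟩
    rcases SL2Var.eq_zero_or_eq_mul_X_pow h hE hrel hiso with rfl | ⟨c, k, hc, rfl⟩
    · exact Or.inl (hcone (by rw [map_zero, zero_mul]))
    · obtain ⟨R', f', x', h', ⟨h42, -⟩ | ⟨-, rfl⟩⟩ := h.exists_normalized hc hrel hquarter
      · norm_num at h42
      · obtain ⟨hF, t', f'', x'', hq⟩ := SL2Var.exists_presentation_quotientFamily k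
        exact Or.inr (Or.inr ⟨k, h'.equivariantlyIsomorphic hq⟩)
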